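/- Let $K\subset\mathbb C$ be an imaginary quadratic field of discriminant $-\Delta$, with ring of integers $\mathcal O_K$ and associated quadratic character $\chi_K$, and let $l\ge 1$ be an integer. A Hecke character $\psi$ of $K$ modulo a nonzero ideal $\mathfrak m$ of $\infty$-type $l$ is a homomorphism from the group of fractional ideals prime to $\mathfrak m$ to $\mathbb C^*$ with $\psi(\alpha\mathcal O_K)=\alpha^l$ for all $\alpha\equiv 1$ (multiplicatively) mod $\mathfrak m$, extended by zero; $\mathfrak m$ is its conductor if it divides every modulus for which $\psi$ is defined. It has rational coefficients if all Fourier coefficients of $f_\psi=\sum_{\mathfrak a}\psi(\mathfrak a)q^{\mathcal N(\mathfrak a)}$ ($\mathfrak a$ running through the nonzero integral ideals) are rational. A Hecke character $\psi'$ is a twist of $\psi$ if $\psi'(\mathfrak a)=\psi(\mathfrak a)\,\Xi(\mathfrak a)$ for all $\mathfrak a$ at which $\psi$ and $\Xi$ are both nonzero, where $\Xi=\phi\circ\mathcal N$ for a Dirichlet character $\phi$ with $\phi^2=1$ or, only if $\Delta=4$ (respectively $\Delta=3$), $\Xi$ is a Hecke character of $\infty$-type $0$ with $\Xi^4=1$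 (respectively $\Xi^6=1$) on the ideals prime to its modulus. A Hecke character $\psi$ of $\infty$-type $l$, given modulo its conductor, is canonical if the following holds. - If $\Delta\ne 3,4,8$: $\psi$ takes values in $\mathcal O_K$ on integral ideals, and $\psi(\alpha\mathcal O_K)=\alpha^l$ for all nonzero $\alpha\in\mathcal O_K$ if $l$ is even, while, if $l$ is odd, $\psi(\alpha\mathcal O_K)=\left(\chi_K(a)\,\alpha\right)^l$ for all $\alpha\in\mathcal O_K$ and $a\in\mathbb Z$ with $\alpha\equiv a$ mod $\sqrt{-\Delta}$ (where $\chi_K(a)$ is given by the Jacobi symbol $\left(\frac{a}{\Delta}\right)$). - If $\Delta=3,4,8$: $\psi$ is the primitive Hecke character attached to $\psi_1^l$, where $\psi_1$ is a Hecke character of $\infty$-type $1$ with rational coefficients and conductor $(3)$, $(2+2\sqrt{-1})$, $(4\sqrt{-2})$ respectively (the Hecke character of an elliptic curve over $\mathbb Q$ of conductor $27$, $32$, $256$ with complex multiplication by $\mathcal O_K$). **Proposition 5.1.** (a) For every Hecke character $\psi$ of $K$ of $\infty$-type $l$ with rational coefficients there is a canonical Hecke character of $\infty$-type $l$ that is a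 twist of $\psi$. (b) Every canonical Hecke character of $K$ of $\infty$-type $l$ has rational coefficients. If $\Delta\neq 3,4,8$, its conductor is $(1)$ for even $l$ and $(\sqrt{-\Delta})$ for odd $l$. If $\Delta=8$, its conductor is $(1)$ for even $l$ and $(4\sqrt{-2})$ for odd $l$. If $\Delta=4$, it is $(2+2\sqrt{-1})$ for odd $l$, $(2)$ for $l\equiv 2$ mod $4$, and $(1)$ for $4\mid l$. If $\Delta=3$, it is $(3)$ for $3\nmid l$, $(\sqrt{-3})$ for $l\equiv 3$ mod $6$, and $(1)$ for $6\mid l$. -/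

import Mathlib

open NumberField

namespace CMHecke

variable {K : Type*} [Field K] [NumberField K]

/-- `ψ` is a Hecke character of `K` modulo the nonzero ideal `𝔪`, of `∞`-type `l`, with respect to
the embedding `σ` of `K` into the complex numbers. A homomorphism on the group of fractional
ideals prime to `𝔪` is recorded by its restriction to the integral ideals prime to `𝔪` (which
generate that group freely on the primes not dividing `𝔪`), extended by zero. Every `β` in `Kˣ`
with `β ≡ 1` multiplicatively mod `𝔪` is a quotient of two integers that are `≡ 1` mod `𝔪`, so
it is enough to prescribe `ψ` on the latter. -/
structure IsHeckeCharacter (σ : K →+* ℂ) (𝔪 : Ideal (𝓞 K)) (l : ℕ)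
    (ψ : Ideal (𝓞 K) →*₀ ℂ) : Prop where
  modulus_ne_bot : 𝔪 ≠ ⊥
  ne_zero_iff : ∀ 𝔞 : Ideal (𝓞 K), ψ 𝔞 ≠ 0 ↔ 𝔞 ≠ ⊥ ∧ IsCoprime 𝔞 𝔪
  map_principal : ∀ α : 𝓞 K, α ≠ 0 → α - 1 ∈ 𝔪 →
    ψ (Ideal.span {α}) = σ (α : K) ^ l

/-- `ψ` is a Hecke character modulo `𝔣` and `𝔣` is its conductor: whenever `ψ` is defined
modulo `𝔪` (agrees, away from `𝔣 𝔪`, with a Hecke character modulo `𝔪`), then `𝔣 ∣ 𝔪`. -/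
def HasConductor (σ : K →+* ℂ) (𝔣 : Ideal (𝓞 K)) (l : ℕ) (ψ : Ideal (𝓞 K) →*₀ ℂ) : Prop :=
  IsHeckeCharacter σ 𝔣 l ψ ∧
    ∀ (𝔪 : Ideal (𝓞 K)) (ψ' : Ideal (𝓞 K) →*₀ ℂ), IsHeckeCharacter σ 𝔪 l ψ' →
      (∀ 𝔞 : Ideal (𝓞 K), IsCoprime 𝔞 (𝔣 * 𝔪) → 𝔞 ≠ ⊥ → ψ 𝔞 = ψ' 𝔞) → 𝔣 ∣ 𝔪

/-- The `n`-th Fourier coefficient of `f_ψ = ∑ ψ(𝔞) q ^ N(𝔞)`. -/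
noncomputable def coeff (ψ : Ideal (𝓞 K) →*₀ ℂ) (n : ℕ) : ℂ :=
  ∑ 𝔞 ∈ (Ideal.finite_setOfPred_absNorm_eq (S := 𝓞 K) n).toFinset, ψ 𝔞

/-- `ψ` has rational coefficients: the eigenform `f_ψ` has. -/
def HasRationalCoeffs (ψ : Ideal (𝓞 K) →*₀ ℂ) : Prop :=
  ∀ n : ℕ, ∃ q : ℚ, coeff ψ n = (q : ℂ)

/-- The characters by which one twists: `φ ∘ N` for a Dirichlet character `φ` with `φ ^ 2 = 1`
and, for `ℚ(√-1)` and `ℚ(√-3)` only, also the quartic, respectively sextic, Hecke characters of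
finite order. -/
def IsTwistingCharacter (σ : K →+* ℂ) (Ξ : Ideal (𝓞 K) →*₀ ℂ) : Prop :=
  (∃ (n : ℕ) (φ : DirichletCharacter ℂ n), n ≠ 0 ∧ φ ^ 2 = 1 ∧
    ∀ 𝔞 : Ideal (𝓞 K), 𝔞 ≠ ⊥ → Ξ 𝔞 = φ (Ideal.absNorm 𝔞 : ZMod n)) ∨
  (discr K = -4 ∧ (∃ 𝔫 : Ideal (𝓞 K), IsHeckeCharacter σ 𝔫 0 Ξ) ∧
    ∀ 𝔞 : Ideal (𝓞 K), Ξ 𝔞 ≠ 0 → Ξ 𝔞 ^ 4 = 1) ∨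
  (discr K = -3 ∧ (∃ 𝔫 : Ideal (𝓞 K), IsHeckeCharacter σ 𝔫 0 Ξ) ∧
    ∀ 𝔞 : Ideal (𝓞 K), Ξ 𝔞 ≠ 0 → Ξ 𝔞 ^ 6 = 1)

/-- `ψ'` is a twist of `ψ`: it equals `ψ ⊗ Ξ` for a twisting character `Ξ`, at all ideals at
which both `ψ` and `Ξ` are defined. (A primitive `ψ'` is then the primitive Hecke character
attached to `ψ ⊗ Ξ`.) -/
def IsTwist (σ : K →+* ℂ) (ψ ψ' : Ideal (𝓞 K) →*₀ ℂ) : Prop :=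
  ∃ Ξ : Ideal (𝓞 K) →*₀ ℂ, IsTwistingCharacter σ Ξ ∧
    ∀ 𝔞 : Ideal (𝓞 K), ψ 𝔞 ≠ 0 → Ξ 𝔞 ≠ 0 → ψ' 𝔞 = ψ 𝔞 * Ξ 𝔞

variable (K)

/-- The ideal `(√-Δ)`, where `-Δ` is the discriminant of `K` (both roots are generators). -/
def sqrtDiscIdeal : Ideal (𝓞 K) :=
  Ideal.span {s : 𝓞 K | s ^ 2 = (discr K : 𝓞 K)}

/-- The ideal `(2 + 2√-1)` of `ℚ(√-1)`. -/
def twoAddTwoI : Ideal (𝓞 K) :=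
  Ideal.span {x : 𝓞 K | ∃ s : 𝓞 K, s ^ 2 = -4 ∧ x = 2 + s}

/-- For `Δ = 3, 4, 8`, the conductor `(3)`, `(2 + 2√-1)`, `(4√-2)` of the Hecke character of the
elliptic curve over `ℚ` of smallest conductor (27, 32, 256) with complex multiplication by the
ring of integers of `K`. -/
noncomputable def ellipticConductor : Ideal (𝓞 K) :=
  if discr K = -3 then Ideal.span {3}
  else if discr K = -4 then twoAddTwoI K
  else Ideal.span {2} * sqrtDiscIdeal K

/-- The conductor of the canonical Hecke characters of `∞`-type `l`. -/
noncomputable def canonicalConductor (l : ℕ) : Ideal (𝓞 K) :=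
  if discr K = -3 then
    if ¬ 3 ∣ l then Ideal.span {3} else if Odd l then sqrtDiscIdeal K else ⊤
  else if discr K = -4 then
    if Odd l then twoAddTwoI K else if ¬ 4 ∣ l then Ideal.span {2} else ⊤
  else if Even l then ⊤
  else if discr K = -8 then Ideal.span {2} * sqrtDiscIdeal K
  else sqrtDiscIdeal K

variable {K}

/-- `ψ` is a canonical Hecke character of `∞`-type `l` with conductor `𝔣`.

For `Δ = 3, 4, 8` this means that `ψ` is the primitive character attached to the `l`-th power of
the Hecke character `ψ₁` of an elliptic curve over `ℚ` of smallest conductor with complex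
multiplication by `𝓞 K`, that is of a Hecke character of `∞`-type one with rational coefficients
and conductor `ellipticConductor K`.

For all other `Δ` it means that the values of `ψ` at integral ideals lie in `𝓞 K` and that
`ψ (α) = (χ_K (Re α) α) ^ l` at principal ideals. For even `l` this reads `ψ (α) = α ^ l`. For odd
`l`, `Re α` is represented modulo `Δ` by any integer `a` with `α ≡ a` mod `√-Δ`, and `χ_K` is the
Jacobi symbol modulo `Δ`. -/
def IsCanonical (σ : K →+* ℂ) (𝔣 : Ideal (𝓞 K)) (l : ℕ) (ψ : Ideal (𝓞 K) →*₀ ℂ) : Prop :=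
  HasConductor σ 𝔣 l ψ ∧
  ((discr K = -3 ∨ discr K = -4 ∨ discr K = -8) →
    ∃ ψ₁ : Ideal (𝓞 K) →*₀ ℂ, HasConductor σ (ellipticConductor K) 1 ψ₁ ∧
      HasRationalCoeffs ψ₁ ∧ ∀ 𝔞 : Ideal (𝓞 K), ψ₁ 𝔞 ≠ 0 → ψ 𝔞 = ψ₁ 𝔞 ^ l) ∧
  (¬ (discr K = -3 ∨ discr K = -4 ∨ discr K = -8) →
    (∀ 𝔞 : Ideal (𝓞 K), ∃ x : 𝓞 K, ψ 𝔞 = σ (x : K)) ∧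
    (Even l → ∀ α : 𝓞 K, α ≠ 0 → ψ (Ideal.span {α}) = σ (α : K) ^ l) ∧
    (Odd l → ∀ (α : 𝓞 K) (a : ℤ), α - (a : 𝓞 K) ∈ sqrtDiscIdeal K →
      ψ (Ideal.span {α}) = ((jacobiSym a (discr K).natAbs : ℂ) * σ (α : K)) ^ l))

end CMHecke

set_option linter.unusedSectionVars false

/-! Everything rests on a reformulation of rationality: `ψ` has rational coefficients exactly when
it is equivariant, i.e. has values in `𝓞 K` and commutes with complex conjugation
(`isEquivariant_of_hasRationalCoeffs`, `IsEquivariant.hasRationalCoeffs`). The value `ψ 𝔞` then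
generates `𝔞 ^ l` (`IsHeckeCharacter.span_eq_pow`), so two such characters of the same `∞`-type
differ by units. If `Δ = 3, 4`, this quotient is already a twisting character, and any canonical
character will do.

For the other `Δ` the units are `±1`, and the task is to show that a sign on principal ideals is a
quadratic Dirichlet character of the norm. Two facts give this. At rational integers `ψ (a) = (χ(a)
a) ^ l` is forced, by Dirichlet's theorem on primes in progressions (`apply_span_natCast`). At an
`α` of norm `≡ 1`, Hilbert 90 modulo an integer writes `α ≡ β / β̄`, and equivariance determines `ψ
(α)` up to data depending on `α` only (`exists_conjIdeal_eq_and_forall`). So the sign is trivial on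
integers and on norm-one classes, hence factors through the norm (`exists_dirichletCharacter`).

For even `l` the sign is `ψ (α) / α ^ l`. Twisting it away leaves a character with `ψ (α) = α ^ l`,
which extends to modulus one. For odd `l` the class group is annihilated by an odd number, so genus
theory forces `Δ = 8` or `Δ = p ≡ 3 mod 4` (`discr_eq_of_principal`). A canonical character exists
because exactly one generator of `𝔞 ^ l` is a square modulo `√-p`. The sign is now the quotient of
the two characters, and it is controlled at non-principal `𝔞` by passing to `𝔞 ^ l`.

For `Δ = 3, 4, 8` the class number is one, and `ψ₁` is built by choosing generators in a set of
residues. The conductor of `ψ₁ ^ l` is found by testing units, and the element `5` if `Δ = 8`.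
Conductors are unique (`HasConductor.unique`), so exhibiting one primitive character suffices. -/

namespace CMHecke

/-! ### Integral basis, conjugation and discriminant. -/

/-- Coordinates on the ring of integers of an imaginary quadratic field `K` with a complex
embedding `σ`: complex conjugation on `𝓞 K` and an integral basis `1, ω`. -/
structure QuadraticData {K : Type*} [Field K] [NumberField K] (σ : K →+* ℂ) where
  conj : 𝓞 K ≃+* 𝓞 K
  map_conj : ∀ x : 𝓞 K, σ (conj x : K) = starRingEnd ℂ (σ (x : K))
  ω : 𝓞 K
  exists_repr : ∀ x : 𝓞 K, ∃ a b : ℤ, x = a + b * ω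
  eq_zero : ∀ a b : ℤ, (a + b * ω : 𝓞 K) = 0 → a = 0 ∧ b = 0
  sub_conj_sq : (ω - conj ω) ^ 2 = (discr K : 𝓞 K)

variable {K : Type*} [Field K] [NumberField K]

theorem exists_ringOfIntegers_conj [NumberField.IsTotallyComplex K] (hK : Module.finrank ℚ K = 2)
    (σ : K →+* ℂ) : ∃ c : 𝓞 K ≃+* 𝓞 K, ∀ x : 𝓞 K,
      σ (c x : K) = starRingEnd ℂ (σ (x : K)) := by
  have : Algebra.IsQuadraticExtension ℚ K := ⟨hK⟩
  have : IsCMField K := IsCMField.ofCMExtension ℚ K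
  refine ⟨(IsCMField.ringOfIntegersComplexConj K).toRingEquiv, fun x => ?_⟩
  have := IsCMField.complexEmbedding_complexConj K σ (x : K)
  rw [← this]
  rfl

/-- The element `1` is primitive: a common divisor `d` of its coordinates would be a unit of `𝓞 K`,
and its norm `d ^ 2` a unit of `ℤ`. Bézout coefficients then complete `1` to a basis. -/
theorem exists_primitive_basis (hK : Module.finrank ℚ K = 2) :
    ∃ b : Module.Basis (Fin 2) ℤ (𝓞 K), b 0 = 1 := by
  have hr : Module.finrank ℤ (𝓞 K) = 2 := by rw [RingOfIntegers.rank, hK]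
  let e := Module.finBasisOfFinrankEq ℤ (𝓞 K) hr
  set m := e.repr 1 0 with hm
  set n := e.repr 1 1 with hn
  have h1 : (1 : 𝓞 K) = m • e 0 + n • e 1 := by
    have := e.sum_repr 1
    rw [Fin.sum_univ_two] at this
    exact this.symm
  have hcop : IsCoprime m n := by
    rw [Int.isCoprime_iff_gcd_eq_one]
    set d := Int.gcd m n with hd
    obtain ⟨m', hm'⟩ := Int.gcd_dvd_left m n
    obtain ⟨n', hn'⟩ := Int.gcd_dvd_right m n
    have h2 : (1 : 𝓞 K) = (d : 𝓞 K) * (m' • e 0 + n' • e 1) := by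
      have e1 : (m : 𝓞 K) = d * m' := by rw [hm']; push_cast; rfl
      have e2 : (n : 𝓞 K) = d * n' := by rw [hn']; push_cast; rfl
      rw [h1]
      simp only [zsmul_eq_mul]
      rw [e1, e2]; ring
    have h3 : IsUnit (d : 𝓞 K) := IsUnit.of_mul_eq_one _ h2.symm
    have h4 := h3.map (Algebra.norm ℤ)
    have h5 : Algebra.norm ℤ (d : 𝓞 K) = (d : ℤ) ^ 2 := by
      have := Algebra.norm_algebraMap_of_basis e (d : ℤ)
      rw [Fintype.card_fin] at this
      rw [← this]; simp
    rw [h5, isUnit_pow_iff two_ne_zero, Int.isUnit_iff] at h4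
    omega
  obtain ⟨v, u, huv⟩ := hcop
  -- `v * m + u * n = 1`
  let w : 𝓞 K := (-u) • e 0 + v • e 1
  have he0 : e 0 = v • (1 : 𝓞 K) + (-n) • w := by
    simp only [w]
    rw [h1]
    simp only [smul_add, smul_smul, ← add_assoc]
    have : e 0 = (v * m + u * n) • e 0 := by rw [huv, one_smul]
    nth_rewrite 1 [this]
    module
  have he1 : e 1 = u • (1 : 𝓞 K) + m • w := by
    simp only [w]
    rw [h1]
    have : e 1 = (v * m + u * n) • e 1 := by rw [huv, one_smul]
    nth_rewrite 1 [this]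
    module
  have hsp : ⊤ ≤ Submodule.span ℤ (Set.range ![(1 : 𝓞 K), w]) := by
    rw [← e.span_eq, Submodule.span_le]
    rintro _ ⟨i, rfl⟩
    have hm1 : (1 : 𝓞 K) ∈ Submodule.span ℤ (Set.range ![(1 : 𝓞 K), w]) :=
      Submodule.subset_span ⟨0, rfl⟩
    have hmw : w ∈ Submodule.span ℤ (Set.range ![(1 : 𝓞 K), w]) :=
      Submodule.subset_span ⟨1, rfl⟩
    fin_cases i
    · change e 0 ∈ _
      rw [he0]
      exact add_mem (Submodule.smul_mem _ _ hm1) (Submodule.smul_mem _ _ hmw)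
    · change e 1 ∈ _
      rw [he1]
      exact add_mem (Submodule.smul_mem _ _ hm1) (Submodule.smul_mem _ _ hmw)
  have hli : LinearIndependent ℤ ![(1 : 𝓞 K), w] :=
    linearIndependent_of_top_le_span_of_card_eq_finrank hsp (by simp [hr])
  exact ⟨Module.Basis.mk hli hsp, by simp⟩

/-- Conjugation moves `w`, as otherwise `σ` would be real. It thus exchanges the roots of `w ^ 2 = n
+ T w`, and both `(w - w̄) ^ 2` and the discriminant equal `T ^ 2 + 4 n`. -/
theorem exists_quadraticData [NumberField.IsTotallyComplex K] (hK : Module.finrank ℚ K = 2)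
    (σ : K →+* ℂ) : Nonempty (QuadraticData σ) := by
  obtain ⟨c, hc⟩ := exists_ringOfIntegers_conj hK σ
  obtain ⟨b, hb⟩ := exists_primitive_basis hK
  set w := b 1 with hw
  have hrepr : ∀ x : 𝓞 K, x = (b.repr x 0 : 𝓞 K) + (b.repr x 1 : 𝓞 K) * w := by
    intro x
    have := b.sum_repr x
    rw [Fin.sum_univ_two, hb] at this
    nth_rewrite 1 [← this]
    simp [hw]
  have hex : ∀ x : 𝓞 K, ∃ a d : ℤ, x = a + d * w := fun x => ⟨_, _, hrepr x⟩
  have hcw : w ≠ c w := by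
    intro h
    have hx : ∀ x : 𝓞 K, c x = x := by
      intro x
      obtain ⟨a, d, rfl⟩ := hex x
      simp [← h]
    have hreal : ComplexEmbedding.IsReal σ := by
      rw [ComplexEmbedding.isReal_iff]
      ext x
      obtain ⟨p, q, hq, rfl⟩ := IsFractionRing.div_surjective (A := 𝓞 K) x
      have h1 := hc p
      have h2 := hc q
      rw [hx] at h1 h2
      simp only [ComplexEmbedding.conjugate_coe_eq, map_div₀]
      rw [← h1, ← h2]
    exact IsTotallyComplex.complexEmbedding_not_isReal σ hreal
  obtain ⟨n, T, hT⟩ := hex (w * w)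
  have htr : w + c w = T := by
    have h2 : c w * c w = n + T * c w := by rw [← map_mul, hT]; simp
    have h3 : (w - c w) * (w + c w - T) = 0 := by linear_combination hT - h2
    rcases mul_eq_zero.mp h3 with h | h
    · exact absurd (sub_eq_zero.mp h) hcw
    · exact sub_eq_zero.mp h
  refine ⟨⟨c, hc, w, hex, ?_, ?_⟩⟩
  · intro x y h
    have := b.linearIndependent
    rw [Fintype.linearIndependent_iff] at this
    have h2 := this ![x, y] (by simpa [Fin.sum_univ_two, hb] using h)
    exact ⟨h2 0, h2 1⟩
  · have hcw' : c w = T - w := by linear_combination htr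
    have hd : discr K = T ^ 2 + 4 * n := by
      rw [← discr_eq_discr K b, Algebra.discr_def, Matrix.det_fin_two]
      simp only [Algebra.traceMatrix_apply, Algebra.traceForm_apply, hb, ← hw, mul_one, one_mul]
      have t1 : Algebra.trace ℤ (𝓞 K) 1 = 2 := by
        have := Algebra.trace_algebraMap (S := 𝓞 K) (1 : ℤ)
        rw [map_one, RingOfIntegers.rank, hK] at this
        simpa using this
      have hb0 : b.repr 1 = Finsupp.single 0 1 := by rw [← hb, b.repr_self]
      have hbw : b.repr w = Finsupp.single 1 1 := by rw [hw, b.repr_self]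
      have tw : Algebra.trace ℤ (𝓞 K) w = T := by
        rw [Algebra.trace_eq_matrix_trace b, Matrix.trace_fin_two]
        simp only [Algebra.leftMulMatrix_eq_repr_mul, hb, ← hw, mul_one, hbw, hT]
        have : (n + T * w : 𝓞 K) = n • (1 : 𝓞 K) + T • w := by simp
        rw [this, map_add, map_zsmul, map_zsmul, hb0, hbw]
        simp
      have tww : Algebra.trace ℤ (𝓞 K) (w * w) = 2 * n + T * T := by
        have : (w * w : 𝓞 K) = n • (1 : 𝓞 K) + T • w := by simp [hT]
        rw [this, map_add, map_zsmul, map_zsmul, t1, tw]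
        simp; ring
      rw [t1, tw, tww]; ring
    rw [hcw', hd]
    push_cast
    linear_combination 4 * hT

end CMHecke

namespace CMHecke

variable {K : Type*} [Field K] [NumberField K]

theorem embedding_injective (σ : K →+* ℂ) {x y : 𝓞 K} (h : σ (x : K) = σ (y : K)) : x = y :=
  RingOfIntegers.coe_injective (σ.injective h)

theorem embedding_mul (σ : K →+* ℂ) (x y : 𝓞 K) :
    σ ((x * y : 𝓞 K) : K) = σ (x : K) * σ (y : K) := by simp

theorem embedding_pow (σ : K →+* ℂ) (x : 𝓞 K) (n : ℕ) :
    σ ((x ^ n : 𝓞 K) : K) = σ (x : K) ^ n := by simp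

theorem embedding_ne_zero (σ : K →+* ℂ) {x : 𝓞 K} (h : x ≠ 0) : σ (x : K) ≠ 0 := by
  intro h0
  exact h (embedding_injective σ (by simpa using h0))

/-! ### Ideals of a ring of integers -/

theorem ideal_pow_left_injective {I J : Ideal (𝓞 K)} {n : ℕ} (hn : n ≠ 0) (h : I ^ n = J ^ n) :
    I = J :=
  dvd_antisymm_of_normalize_eq (normalize_eq I) (normalize_eq J)
    ((UniqueFactorizationMonoid.pow_dvd_pow_iff_dvd hn).mp h.dvd)
    ((UniqueFactorizationMonoid.pow_dvd_pow_iff_dvd hn).mp h.symm.dvd)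

theorem exists_pow_eq_span (K : Type*) [Field K] [NumberField K] :
    ∃ h : ℕ, h ≠ 0 ∧ ∀ I : Ideal (𝓞 K), ∃ α : 𝓞 K, I ^ h = Ideal.span {α} := by
  classical
  refine ⟨Fintype.card (ClassGroup (𝓞 K)), Fintype.card_ne_zero, fun I => ?_⟩
  by_cases hI : I = ⊥
  · exact ⟨0, by rw [hI, ← Ideal.zero_eq_bot, zero_pow Fintype.card_ne_zero]; simp⟩
  · have hI' : I ∈ nonZeroDivisors (Ideal (𝓞 K)) := mem_nonZeroDivisors_of_ne_zero hI
    have h1 : ClassGroup.mk0 (⟨I, hI'⟩ ^ Fintype.card (ClassGroup (𝓞 K))) = 1 := by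
      rw [map_pow, pow_card_eq_one]
    have h2 := (ClassGroup.mk0_eq_one_iff (pow_mem hI' (Fintype.card (ClassGroup (𝓞 K))))).mp h1
    exact h2.principal

/-- Take `γ` generating `𝔞` modulo `𝔞 * 𝔪`; cancelling `𝔞` from `𝔞 𝔪 + (γ) = 𝔞` leaves `𝔪 + 𝔟 = 1`.
-/
theorem exists_isCoprime_mul_eq_span {𝔞 𝔪 : Ideal (𝓞 K)} (h𝔞 : 𝔞 ≠ ⊥) (h𝔪 : 𝔪 ≠ ⊥) :
    ∃ (𝔟 : Ideal (𝓞 K)) (γ : 𝓞 K), 𝔞 * 𝔟 = Ideal.span {γ} ∧ IsCoprime 𝔟 𝔪 := by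
  obtain ⟨γ, hγ⟩ := IsDedekindDomain.exists_sup_span_eq (I := 𝔞 * 𝔪) (J := 𝔞)
    Ideal.mul_le_left (mul_ne_zero h𝔞 h𝔪)
  have hd : 𝔞 ∣ Ideal.span {γ} := by
    rw [Ideal.dvd_iff_le]
    exact le_sup_right.trans hγ.le
  obtain ⟨𝔟, h𝔟⟩ := hd
  refine ⟨𝔟, γ, h𝔟.symm, ?_⟩
  rw [Ideal.isCoprime_iff_add]
  rw [h𝔟, ← Ideal.add_eq_sup, ← mul_add] at hγ
  have : 𝔞 * (𝔪 + 𝔟) = 𝔞 * 1 := by rw [hγ, mul_one]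
  rw [add_comm]
  exact mul_left_cancel₀ h𝔞 this

/-- `𝔫` collects the prime factors of `𝔪` not dividing `𝔣`. It allows the Chinese remainder theorem
to be used although `𝔪` and `𝔣` may have common factors. -/
theorem exists_isCoprime_and_forall_isCoprime {𝔪 𝔣 : Ideal (𝓞 K)} (h𝔪 : 𝔪 ≠ ⊥) :
    ∃ 𝔫 : Ideal (𝓞 K), IsCoprime 𝔫 𝔣 ∧
      ∀ 𝔡, IsCoprime 𝔡 𝔫 → IsCoprime 𝔡 𝔣 → IsCoprime 𝔡 𝔪 := by
  induction 𝔪 using UniqueFactorizationMonoid.induction_on_prime with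
  | h₁ => exact absurd rfl h𝔪
  | h₂ x hx => exact ⟨1, isCoprime_one_left, fun 𝔡 _ _ => by
      rw [Ideal.isUnit_iff.mp hx, ← Ideal.one_eq_top]; exact isCoprime_one_right⟩
  | h₃ a p ha hp ih =>
    obtain ⟨𝔫, h1, h2⟩ := ih ha
    by_cases hpf : p ∣ 𝔣
    · exact ⟨𝔫, h1, fun 𝔡 hd hf => (hf.of_isCoprime_of_dvd_right hpf).mul_right (h2 𝔡 hd hf)⟩
    · refine ⟨p * 𝔫, IsCoprime.mul_left ?_ h1, fun 𝔡 hd hf =>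
        (IsCoprime.of_mul_right_left hd).mul_right (h2 𝔡 (IsCoprime.of_mul_right_right hd) hf)⟩
      have hpm : p.IsMaximal := (Ideal.isPrime_of_prime hp).isMaximal hp.ne_zero
      rw [Ideal.isCoprime_iff_sup_eq]
      by_contra hne
      have := hpm.eq_of_le hne le_sup_left
      exact hpf (Ideal.dvd_iff_le.mpr (this ▸ le_sup_right))

theorem isCoprime_span_iff {x : 𝓞 K} {𝔪 : Ideal (𝓞 K)} :
    IsCoprime (Ideal.span {x}) 𝔪 ↔ ∃ y, y * x - 1 ∈ 𝔪 := by
  rw [Ideal.isCoprime_iff_exists]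
  constructor
  · rintro ⟨i, hi, j, hj, hij⟩
    obtain ⟨y, rfl⟩ := Ideal.mem_span_singleton'.mp hi
    refine ⟨y, ?_⟩
    have : y * x - 1 = -j := by linear_combination hij
    rw [this]; exact neg_mem hj
  · rintro ⟨y, hy⟩
    exact ⟨y * x, Ideal.mem_span_singleton'.mpr ⟨y, rfl⟩, 1 - y * x, by
      rw [← neg_sub]; exact neg_mem hy, by ring⟩

theorem isCoprime_span_of_sub_one_mem {x : 𝓞 K} {𝔪 : Ideal (𝓞 K)} (h : x - 1 ∈ 𝔪) :
    IsCoprime (Ideal.span {x}) 𝔪 :=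
  isCoprime_span_iff.mpr ⟨1, by simpa using h⟩

theorem isCoprime_span_of_sub_mem {x y : 𝓞 K} {𝔪 : Ideal (𝓞 K)} (h : x - y ∈ 𝔪)
    (hx : IsCoprime (Ideal.span {x}) 𝔪) : IsCoprime (Ideal.span {y}) 𝔪 := by
  obtain ⟨z, hz⟩ := isCoprime_span_iff.mp hx
  refine isCoprime_span_iff.mpr ⟨z, ?_⟩
  have : z * y - 1 = (z * x - 1) - z * (x - y) := by ring
  rw [this]
  exact sub_mem hz (Ideal.mul_mem_left _ _ h)

theorem exists_sub_mem_and_sub_mem {𝔞 𝔟 : Ideal (𝓞 K)} {x y : 𝓞 K} (h : x - y ∈ 𝔞 + 𝔟) :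
    ∃ z, z - x ∈ 𝔞 ∧ z - y ∈ 𝔟 := by
  rw [Ideal.add_eq_sup, Submodule.mem_sup] at h
  obtain ⟨u, hu, v, hv, huv⟩ := h
  refine ⟨x - u, by simpa using hu, ?_⟩
  have : x - u - y = v := by linear_combination -huv
  rwa [this]

/-- Every residue class prime to `𝔣` contains an element prime to `𝔪`. -/
theorem exists_sub_mem_isCoprime {𝔪 𝔣 : Ideal (𝓞 K)} (h𝔪 : 𝔪 ≠ ⊥) {x : 𝓞 K}
    (hx : IsCoprime (Ideal.span {x}) 𝔣) :
    ∃ y, y - x ∈ 𝔣 ∧ IsCoprime (Ideal.span {y}) 𝔣 ∧ IsCoprime (Ideal.span {y}) 𝔪 := by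
  obtain ⟨𝔫, h1, h2⟩ := exists_isCoprime_and_forall_isCoprime (𝔣 := 𝔣) h𝔪
  obtain ⟨y, hy1, hy2⟩ := exists_sub_mem_and_sub_mem (𝔞 := 𝔣) (𝔟 := 𝔫) (x := x) (y := 1)
    (by rw [Ideal.isCoprime_iff_add.mp h1.symm, Ideal.one_eq_top]; trivial)
  have hy3 : IsCoprime (Ideal.span {y}) 𝔣 :=
    isCoprime_span_of_sub_mem (by rw [← neg_sub]; exact neg_mem hy1) hx
  exact ⟨y, hy1, hy3, h2 _ (isCoprime_span_of_sub_one_mem hy2) hy3⟩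

theorem span_ne_bot {x : 𝓞 K} (hx : x ≠ 0) : Ideal.span {x} ≠ ⊥ := by
  simpa [Ideal.span_singleton_eq_bot] using hx

theorem not_isCoprime_bot {𝔪 : Ideal (𝓞 K)} :
    ¬ IsCoprime (⊥ : Ideal (𝓞 K)) (𝔪 * Ideal.span {2}) := by
  intro h
  have h2 := IsCoprime.of_mul_right_right h
  rw [Ideal.isCoprime_iff_sup_eq, bot_sup_eq] at h2
  have h3 := Ideal.absNorm_span_natCast (S := 𝓞 K) 2
  rw [Nat.cast_ofNat, h2, Ideal.absNorm_top] at h3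
  have h4 : 0 < Module.finrank ℤ (𝓞 K) := by
    rw [RingOfIntegers.rank]; exact Module.finrank_pos
  exact absurd h3 (Nat.one_lt_two_pow h4.ne').ne

/-- The moving lemma: a Hecke character modulo `𝔣` is determined at `𝔞` by its value at an ideal `𝔟`
avoiding any prescribed primes. -/
theorem exists_isCoprime_mul_eq_span_sub_one_mem {𝔞 𝔣 𝔪 : Ideal (𝓞 K)} (h𝔞 : 𝔞 ≠ ⊥)
    (h𝔣 : 𝔣 ≠ ⊥) (h𝔪 : 𝔪 ≠ ⊥) (hc : IsCoprime 𝔞 𝔣) :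
    ∃ (𝔟 : Ideal (𝓞 K)) (γ : 𝓞 K), 𝔞 * 𝔟 = Ideal.span {γ} ∧ IsCoprime 𝔟 𝔪 ∧ IsCoprime 𝔟 𝔣 ∧
      γ - 1 ∈ 𝔣 ∧ γ ≠ 0 ∧ 𝔟 ≠ ⊥ := by
  -- The zero ideal is coprime to `⊤`; the factor `2` rules out `𝔟 = ⊥` also when `𝔪 = ⊤`.
  have h2 : 𝔪 * Ideal.span {2} ≠ ⊥ := mul_ne_zero h𝔪 (span_ne_bot two_ne_zero)
  obtain ⟨𝔟, γ, hγ, h𝔟⟩ := exists_isCoprime_mul_eq_span h𝔞 (mul_ne_zero h2 h𝔣)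
  have h𝔟𝔣 : IsCoprime 𝔟 𝔣 := IsCoprime.of_mul_right_right h𝔟
  have hγ𝔣 : IsCoprime (Ideal.span {γ}) 𝔣 := hγ ▸ hc.mul_left h𝔟𝔣
  obtain ⟨δ', hδ'⟩ := isCoprime_span_iff.mp hγ𝔣
  obtain ⟨δ, h1, h3, h4⟩ := exists_sub_mem_isCoprime (𝔪 := 𝔪 * Ideal.span {2}) h2
    (isCoprime_span_iff.mpr ⟨γ, by rwa [mul_comm]⟩ : IsCoprime (Ideal.span {δ'}) 𝔣)
  have hcop : IsCoprime (𝔟 * Ideal.span {δ}) (𝔪 * Ideal.span {2}) :=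
    (IsCoprime.of_mul_right_left h𝔟).mul_left h4
  have hne : 𝔟 * Ideal.span {δ} ≠ ⊥ := by
    intro h
    rw [h] at hcop
    exact not_isCoprime_bot hcop
  have hspan : 𝔞 * (𝔟 * Ideal.span {δ}) = Ideal.span {γ * δ} := by
    rw [← mul_assoc, hγ, Ideal.span_singleton_mul_span_singleton]
  refine ⟨𝔟 * Ideal.span {δ}, γ * δ, hspan, IsCoprime.of_mul_right_left hcop,
    h𝔟𝔣.mul_left h3, ?_, ?_, hne⟩
  · have : γ * δ - 1 = (δ' * γ - 1) + γ * (δ - δ') := by ring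
    rw [this]
    exact add_mem hδ' (Ideal.mul_mem_left _ _ h1)
  · intro h
    rw [h] at hspan
    exact mul_ne_zero h𝔞 hne (by simpa using hspan)

theorem exists_eq_span_of_span_mul_eq {x y : 𝓞 K} {I : Ideal (𝓞 K)} (hx : x ≠ 0)
    (h : Ideal.span {x} * I = Ideal.span {y}) : ∃ z, I = Ideal.span {z} ∧ y = x * z := by
  have hy : y ∈ Ideal.span {x} * I := h ▸ Ideal.mem_span_singleton_self y
  obtain ⟨z, hz, rfl⟩ := Ideal.mem_span_singleton_mul.mp hy
  refine ⟨z, ?_, rfl⟩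
  rw [← Ideal.span_singleton_mul_span_singleton] at h
  exact mul_left_cancel₀ (span_ne_bot hx) h

theorem exists_pow_sub_one_mem {𝔪 : Ideal (𝓞 K)} (h𝔪 : 𝔪 ≠ ⊥) :
    ∃ k : ℕ, k ≠ 0 ∧ ∀ x : 𝓞 K, IsCoprime (Ideal.span {x}) 𝔪 → x ^ k - 1 ∈ 𝔪 := by
  classical
  have : Finite (𝓞 K ⧸ 𝔪) := Ideal.finiteQuotientOfFreeOfNeBot 𝔪 h𝔪
  have : Fintype (𝓞 K ⧸ 𝔪)ˣ := Fintype.ofFinite _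
  refine ⟨Fintype.card (𝓞 K ⧸ 𝔪)ˣ, Fintype.card_ne_zero, fun x hx => ?_⟩
  obtain ⟨y, hy⟩ := isCoprime_span_iff.mp hx
  have hu : IsUnit (Ideal.Quotient.mk 𝔪 x) := by
    refine IsUnit.of_mul_eq_one (Ideal.Quotient.mk 𝔪 y) ?_
    rw [← map_mul, ← map_one (Ideal.Quotient.mk 𝔪), Ideal.Quotient.eq, mul_comm]
    exact hy
  rw [← Ideal.Quotient.eq, map_pow, map_one]
  obtain ⟨u, hu⟩ := hu
  rw [← hu, ← Units.val_pow_eq_pow_val, pow_card_eq_one, Units.val_one]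

theorem exists_pow_eq_span_sub_one_mem {𝔪 : Ideal (𝓞 K)} (h𝔪 : 𝔪 ≠ ⊥) :
    ∃ k : ℕ, k ≠ 0 ∧ ∀ 𝔞 : Ideal (𝓞 K), 𝔞 ≠ ⊥ → IsCoprime 𝔞 𝔪 →
      ∃ α : 𝓞 K, α ≠ 0 ∧ 𝔞 ^ k = Ideal.span {α} ∧ α - 1 ∈ 𝔪 := by
  obtain ⟨h, hh, hp⟩ := exists_pow_eq_span K
  obtain ⟨k, hk, hq⟩ := exists_pow_sub_one_mem h𝔪
  refine ⟨h * k, mul_ne_zero hh hk, fun 𝔞 h0 hc => ?_⟩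
  obtain ⟨α, hα⟩ := hp 𝔞
  refine ⟨α ^ k, ?_, by rw [pow_mul, hα, Ideal.span_singleton_pow], hq α (hα ▸ hc.pow_left)⟩
  intro h
  have : Ideal.span {α} = ⊥ := by
    rw [eq_zero_of_pow_eq_zero h]; simp
  rw [← hα] at this
  exact h0 (eq_zero_of_pow_eq_zero this)

end CMHecke

/-! ### Trace, norm, discriminant and units of an imaginary quadratic field. -/

namespace CMHecke

variable {K : Type*} [Field K] [NumberField K] {σ : K →+* ℂ}

theorem intCast_injective (K : Type*) [Field K] [NumberField K] {a b : ℤ}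
    (h : (a : 𝓞 K) = b) : a = b := by exact_mod_cast h

namespace QuadraticData

variable (Q : QuadraticData σ)

@[simp] theorem conj_conj (x : 𝓞 K) : Q.conj (Q.conj x) = x :=
  embedding_injective σ (by rw [Q.map_conj, Q.map_conj, Complex.conj_conj])

/-- The square root `ω - ω̄` of the discriminant. -/
def s : 𝓞 K := Q.ω - Q.conj Q.ω

theorem s_sq : Q.s ^ 2 = (discr K : 𝓞 K) := Q.sub_conj_sq

theorem conj_s : Q.conj Q.s = -Q.s := by simp [s]

theorem s_ne_zero : Q.s ≠ 0 := by
  intro h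
  have := Q.s_sq
  rw [h, zero_pow two_ne_zero] at this
  exact discr_ne_zero K (by exact_mod_cast this.symm)

theorem sub_conj (a b : ℤ) : (a + b * Q.ω) - Q.conj (a + b * Q.ω) = b * Q.s := by
  simp [s]; ring

theorem eq_intCast_of_conj_eq {x : 𝓞 K} (h : Q.conj x = x) : ∃ a : ℤ, x = a := by
  obtain ⟨a, b, rfl⟩ := Q.exists_repr x
  have h1 := Q.sub_conj a b
  rw [h, sub_self] at h1
  have hb : b = 0 := by
    rcases mul_eq_zero.mp h1.symm with h2 | h2
    · exact_mod_cast h2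
    · exact absurd h2 Q.s_ne_zero
  exact ⟨a, by simp [hb]⟩

theorem exists_trace (x : 𝓞 K) : ∃ t : ℤ, x + Q.conj x = t :=
  Q.eq_intCast_of_conj_eq (by rw [map_add, conj_conj, add_comm])

theorem embedding_mul_conj (x : 𝓞 K) :
    σ ((x * Q.conj x : 𝓞 K) : K) = ((Complex.normSq (σ (x : K)) : ℝ) : ℂ) := by
  rw [show ((x * Q.conj x : 𝓞 K) : K) = (x : K) * (Q.conj x : K) from map_mul _ _ _, map_mul,
    Q.map_conj, Complex.mul_conj]

theorem exists_norm (x : 𝓞 K) : ∃ n : ℕ, x * Q.conj x = n := by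
  obtain ⟨n, hn⟩ := Q.eq_intCast_of_conj_eq (x := x * Q.conj x) (by
    rw [map_mul, conj_conj, mul_comm])
  have h := Q.embedding_mul_conj x
  rw [hn] at h
  have h1 : ((n : ℝ) : ℂ) = ((Complex.normSq (σ (x : K)) : ℝ) : ℂ) := by
    rw [← h]; simp
  have h2 : (0 : ℝ) ≤ n := by
    rw [Complex.ofReal_injective h1]; exact Complex.normSq_nonneg _
  obtain ⟨m, rfl⟩ := Int.eq_ofNat_of_zero_le (by exact_mod_cast h2 : 0 ≤ n)
  exact ⟨m, by rw [hn]; simp⟩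

theorem normSq_embedding {x : 𝓞 K} {n : ℕ} (h : x * Q.conj x = n) :
    Complex.normSq (σ (x : K)) = n := by
  have := Q.embedding_mul_conj x
  rw [h] at this
  have h1 : (((n : ℝ)) : ℂ) = ((Complex.normSq (σ (x : K)) : ℝ) : ℂ) := by rw [← this]; simp
  exact (Complex.ofReal_injective h1).symm

/-- The norm of `s` is `s * (-s) = -discr K`, and norms are nonnegative. -/
theorem discr_neg (Q : QuadraticData σ) : discr K < 0 := by
  by_contra h
  obtain ⟨n, hn⟩ := Q.exists_norm Q.s
  rw [Q.conj_s] at hn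
  have h1 : (-(discr K) : ℤ) = (n : ℤ) := by
    have : ((-(discr K) : ℤ) : 𝓞 K) = ((n : ℤ) : 𝓞 K) := by
      push_cast
      rw [← Q.s_sq, ← hn]; ring
    exact_mod_cast this
  have h2 := discr_ne_zero K
  omega

theorem sq_eq_discr_iff (x : 𝓞 K) : x ^ 2 = (discr K : 𝓞 K) ↔ x = Q.s ∨ x = -Q.s := by
  rw [← Q.s_sq, sq_eq_sq_iff_eq_or_eq_neg]

theorem sqrtDiscIdeal_eq : sqrtDiscIdeal K = Ideal.span {Q.s} := by
  apply le_antisymm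
  · rw [sqrtDiscIdeal, Ideal.span_le]
    intro x hx
    rcases (Q.sq_eq_discr_iff x).mp hx with rfl | rfl
    · exact Ideal.mem_span_singleton_self _
    · exact neg_mem (Ideal.mem_span_singleton_self _)
  · rw [Ideal.span_singleton_le_iff_mem]
    exact Ideal.subset_span Q.s_sq

/-- For `x = a + b ω` of trace `t` and norm `n`, one has `t ^ 2 - b ^ 2 disc = 4 n`. -/
theorem trace_sq_sub {a b t : ℤ} {n : ℕ} (ht : (a + b * Q.ω) + Q.conj (a + b * Q.ω) = t)
    (hn : (a + b * Q.ω) * Q.conj (a + b * Q.ω) = n) : t ^ 2 - b ^ 2 * discr K = 4 * n := by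
  have h := Q.sub_conj a b
  have : ((t ^ 2 - b ^ 2 * discr K : ℤ) : 𝓞 K) = ((4 * n : ℤ) : 𝓞 K) := by
    push_cast
    rw [← ht, ← hn, ← Q.s_sq, ← mul_pow, ← h]
    ring
  exact_mod_cast this

theorem discr_emod_four (Q : QuadraticData σ) : discr K % 4 = 0 ∨ discr K % 4 = 1 := by
  obtain ⟨t, ht⟩ := Q.exists_trace ((0 : ℤ) + (1 : ℤ) * Q.ω)
  obtain ⟨n, hn⟩ := Q.exists_norm ((0 : ℤ) + (1 : ℤ) * Q.ω)
  have h := Q.trace_sq_sub ht hn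
  have h2 : discr K = t * t - 4 * n := by linear_combination -h
  rcases Int.even_or_odd' t with ⟨k, rfl | rfl⟩
  · left
    have : discr K = 4 * (k * k - n) := by rw [h2]; ring
    omega
  · right
    have : discr K = 4 * (k * k + k - n) + 1 := by rw [h2]; ring
    omega

theorem unit_norm (Q : QuadraticData σ) {u : 𝓞 K} (hu : IsUnit u) : u * Q.conj u = 1 := by
  obtain ⟨v, hv⟩ := hu.exists_right_inv
  obtain ⟨n, hn⟩ := Q.exists_norm u
  obtain ⟨m, hm⟩ := Q.exists_norm v
  have h : ((n * m : ℕ) : 𝓞 K) = (1 : ℕ) := by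
    push_cast
    rw [← hn, ← hm]
    calc u * Q.conj u * (v * Q.conj v) = (u * v) * Q.conj (u * v) := by rw [map_mul]; ring
      _ = 1 := by rw [hv]; simp
  have h' : n * m = 1 := by exact_mod_cast h
  rw [hn, Nat.eq_one_of_mul_eq_one_right h']
  simp

/-- A unit has norm `1`, so it is a root of `X ^ 2 - t X + 1` and `t ^ 2 - b ^ 2 disc = 4`; for
discriminants below `-4` this forces `b = 0`. -/
theorem unit_cases (Q : QuadraticData σ) {u : 𝓞 K} (hu : IsUnit u) :
    ∃ t b : ℤ, u ^ 2 - t * u + 1 = 0 ∧ t ^ 2 - b ^ 2 * discr K = 4 ∧ (b = 0 → u = 1 ∨ u = -1) := by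
  have h1 := Q.unit_norm hu
  obtain ⟨a, b, rfl⟩ := Q.exists_repr u
  obtain ⟨t, ht⟩ := Q.exists_trace (a + b * Q.ω)
  have h2 := Q.trace_sq_sub (n := 1) ht (by simpa using h1)
  refine ⟨t, b, ?_, by simpa using h2, ?_⟩
  · rw [← ht]; linear_combination -h1
  · rintro rfl
    have h3 : a * a = 1 := by
      have : ((a * a : ℤ) : 𝓞 K) = (1 : ℤ) := by
        push_cast; simpa using h1
      exact_mod_cast this
    rcases mul_self_eq_one_iff.mp h3 with h | h
    · left; simp [h]
    · right; simp [h]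

theorem unit_eq_one_or_neg_one (Q : QuadraticData σ) (h3 : discr K ≠ -3) (h4 : discr K ≠ -4) {u : 𝓞 K}
    (hu : IsUnit u) : u = 1 ∨ u = -1 := by
  obtain ⟨t, b, -, h2, h⟩ := Q.unit_cases hu
  refine h ?_
  have hneg := Q.discr_neg
  have hmod := Q.discr_emod_four
  by_contra hb
  have hb2 : 1 ≤ b ^ 2 := by have := sq_pos_of_ne_zero hb; omega
  have : discr K ≤ -5 := by omega
  nlinarith [sq_nonneg t]

theorem unit_pow_four (Q : QuadraticData σ) (h4 : discr K = -4) {u : 𝓞 K} (hu : IsUnit u) : u ^ 4 = 1 := by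
  obtain ⟨t, b, h1, h2, h⟩ := Q.unit_cases hu
  rw [h4] at h2
  have hb : b ^ 2 ≤ 1 := by nlinarith [sq_nonneg t]
  rcases (by have := abs_le_one_iff_mul_self_le_one.mpr (by linarith [sq b] : b * b ≤ 1)
             have := abs_le.mp this; omega : b = 0 ∨ b = 1 ∨ b = -1) with hb | hb | hb
  · rcases h hb with rfl | rfl <;> ring
  all_goals
    have ht : t = 0 := by
      have : t ^ 2 = 0 := by rw [hb] at h2; linarith
      exact pow_eq_zero_iff two_ne_zero |>.mp this
    rw [ht] at h1
    push_cast at h1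
    linear_combination (u ^ 2 - 1) * h1

theorem unit_pow_six (Q : QuadraticData σ) (h3 : discr K = -3) {u : 𝓞 K} (hu : IsUnit u) : u ^ 6 = 1 := by
  obtain ⟨t, b, h1, h2, h⟩ := Q.unit_cases hu
  rw [h3] at h2
  have hb : b ^ 2 ≤ 1 := by nlinarith [sq_nonneg t]
  rcases (by have := abs_le_one_iff_mul_self_le_one.mpr (by linarith [sq b] : b * b ≤ 1)
             have := abs_le.mp this; omega : b = 0 ∨ b = 1 ∨ b = -1) with hb | hb | hb
  · rcases h hb with rfl | rfl <;> ring
  all_goals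
    have ht : t * t = 1 := by rw [hb] at h2; linarith
    rcases mul_self_eq_one_iff.mp ht with ht | ht
    all_goals
      rw [ht] at h1
      push_cast at h1
    · linear_combination (u + 1) * (u ^ 3 - 1) * h1
    · linear_combination (u - 1) * (u ^ 3 + 1) * h1

/-! ### Conjugate ideals -/

/-- The conjugate of an ideal. -/
def conjIdeal (𝔞 : Ideal (𝓞 K)) : Ideal (𝓞 K) := 𝔞.map Q.conj

theorem mem_conjIdeal {𝔞 : Ideal (𝓞 K)} {x : 𝓞 K} : x ∈ Q.conjIdeal 𝔞 ↔ Q.conj x ∈ 𝔞 := by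
  rw [conjIdeal, Ideal.mem_map_of_equiv]
  constructor
  · rintro ⟨y, hy, rfl⟩; simpa using hy
  · intro h; exact ⟨_, h, Q.conj_conj x⟩

@[simp] theorem conjIdeal_conjIdeal (𝔞 : Ideal (𝓞 K)) : Q.conjIdeal (Q.conjIdeal 𝔞) = 𝔞 := by
  ext x; simp [mem_conjIdeal]

theorem conjIdeal_mul (𝔞 𝔟 : Ideal (𝓞 K)) :
    Q.conjIdeal (𝔞 * 𝔟) = Q.conjIdeal 𝔞 * Q.conjIdeal 𝔟 := Ideal.map_mul _ _ _

theorem conjIdeal_pow (𝔞 : Ideal (𝓞 K)) (n : ℕ) :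
    Q.conjIdeal (𝔞 ^ n) = Q.conjIdeal 𝔞 ^ n := Ideal.map_pow _ _ _

theorem conjIdeal_add (𝔞 𝔟 : Ideal (𝓞 K)) :
    Q.conjIdeal (𝔞 + 𝔟) = Q.conjIdeal 𝔞 + Q.conjIdeal 𝔟 := Ideal.map_sup _ _ _

@[simp] theorem conjIdeal_span (x : 𝓞 K) :
    Q.conjIdeal (Ideal.span {x}) = Ideal.span {Q.conj x} := by
  rw [conjIdeal, Ideal.map_span, Set.image_singleton]

@[simp] theorem conjIdeal_top : Q.conjIdeal ⊤ = ⊤ := Ideal.map_top _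

@[simp] theorem conjIdeal_eq_bot {𝔞 : Ideal (𝓞 K)} : Q.conjIdeal 𝔞 = ⊥ ↔ 𝔞 = ⊥ := by
  rw [conjIdeal, Ideal.map_eq_bot_iff_of_injective Q.conj.injective]

theorem conjIdeal_inj {𝔞 𝔟 : Ideal (𝓞 K)} : Q.conjIdeal 𝔞 = Q.conjIdeal 𝔟 ↔ 𝔞 = 𝔟 :=
  ⟨fun h => by rw [← Q.conjIdeal_conjIdeal 𝔞, h, conjIdeal_conjIdeal], fun h => h ▸ rfl⟩

theorem isCoprime_conjIdeal {𝔞 𝔟 : Ideal (𝓞 K)} :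
    IsCoprime (Q.conjIdeal 𝔞) (Q.conjIdeal 𝔟) ↔ IsCoprime 𝔞 𝔟 := by
  rw [Ideal.isCoprime_iff_add, Ideal.isCoprime_iff_add, ← conjIdeal_add, Ideal.one_eq_top,
    ← Q.conjIdeal_inj (𝔞 := 𝔞 + 𝔟), conjIdeal_top]

theorem absNorm_conjIdeal (𝔞 : Ideal (𝓞 K)) :
    Ideal.absNorm (Q.conjIdeal 𝔞) = Ideal.absNorm 𝔞 := by
  have h : (Q.conjIdeal 𝔞).toAddSubgroup =
      (𝔞.toAddSubgroup).comap (Q.conj : 𝓞 K →+ 𝓞 K) := by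
    ext x; exact Q.mem_conjIdeal
  rw [Ideal.absNorm_eq_index, Ideal.absNorm_eq_index, h]
  exact AddSubgroup.index_comap_of_surjective _ Q.conj.surjective

theorem finrank_eq (Q : QuadraticData σ) : Module.finrank ℤ (𝓞 K) = 2 := by
  have hsp : ⊤ ≤ Submodule.span ℤ (Set.range ![(1 : 𝓞 K), Q.ω]) := by
    intro x _
    obtain ⟨a, b, rfl⟩ := Q.exists_repr x
    refine add_mem ?_ ?_
    · have := Submodule.smul_mem (Submodule.span ℤ (Set.range ![(1 : 𝓞 K), Q.ω])) a
        (Submodule.subset_span ⟨0, rfl⟩)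
      simpa using this
    · have := Submodule.smul_mem (Submodule.span ℤ (Set.range ![(1 : 𝓞 K), Q.ω])) b
        (Submodule.subset_span ⟨1, rfl⟩)
      simpa using this
  have hli : LinearIndependent ℤ ![(1 : 𝓞 K), Q.ω] := by
    rw [Fintype.linearIndependent_iff]
    intro g hg
    obtain ⟨h0, h1⟩ := Q.eq_zero (g 0) (g 1) (by simpa [Fin.sum_univ_two] using hg)
    intro i; fin_cases i
    · exact h0
    · exact h1
  rw [Module.finrank_eq_card_basis (Module.Basis.mk hli hsp)]
  rfl

theorem absNorm_span_natCast (Q : QuadraticData σ) (n : ℕ) : Ideal.absNorm (Ideal.span {(n : 𝓞 K)}) = n ^ 2 := by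
  rw [Ideal.absNorm_span_natCast, Q.finrank_eq]

theorem absNorm_span_of_mul_conj {x : 𝓞 K} {n : ℕ} (h : x * Q.conj x = n) :
    Ideal.absNorm (Ideal.span {x}) = n := by
  have h1 := Q.absNorm_span_natCast n
  rw [← h, ← Ideal.span_singleton_mul_span_singleton, map_mul, ← conjIdeal_span,
    absNorm_conjIdeal, ← sq] at h1
  exact Nat.pow_left_injective (n := 2) (by norm_num) h1

theorem mul_conj_eq_absNorm (x : 𝓞 K) :
    x * Q.conj x = (Ideal.absNorm (Ideal.span {x}) : 𝓞 K) := by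
  obtain ⟨n, hn⟩ := Q.exists_norm x
  rw [Q.absNorm_span_of_mul_conj hn, hn]

theorem normSq_embedding_eq (Q : QuadraticData σ) (x : 𝓞 K) :
    Complex.normSq (σ (x : K)) = Ideal.absNorm (Ideal.span {x}) :=
  Q.normSq_embedding (Q.mul_conj_eq_absNorm x)

/-- For principal ideals this is `x x̄ = N(x)`. The general case follows by extracting roots, since
some power of `𝔞` is principal. -/
theorem mul_conjIdeal (𝔞 : Ideal (𝓞 K)) :
    𝔞 * Q.conjIdeal 𝔞 = Ideal.span {(Ideal.absNorm 𝔞 : 𝓞 K)} := by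
  obtain ⟨h, hh, hp⟩ := exists_pow_eq_span K
  obtain ⟨α, hα⟩ := hp 𝔞
  refine ideal_pow_left_injective hh ?_
  rw [mul_pow, ← conjIdeal_pow, hα, conjIdeal_span, Ideal.span_singleton_mul_span_singleton,
    Q.mul_conj_eq_absNorm, ← hα, map_pow, Ideal.span_singleton_pow, Nat.cast_pow]

theorem exists_prime_and_absNorm_eq (Q : QuadraticData σ) {𝔮 : Ideal (𝓞 K)} (h𝔮 : Prime 𝔮) {q : ℕ} (hq : q.Prime)
    (hmem : (q : 𝓞 K) ∈ 𝔮) : Ideal.absNorm 𝔮 = q ∨ 𝔮 = Ideal.span {(q : 𝓞 K)} := by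
  obtain ⟨𝔯, h𝔯⟩ := Ideal.dvd_iff_le.mpr ((Ideal.span_singleton_le_iff_mem (I := 𝔮)).mpr hmem)
  have h := Q.absNorm_span_natCast q
  rw [h𝔯, map_mul] at h
  obtain ⟨i, hi, hi'⟩ := (Nat.dvd_prime_pow hq).mp (Dvd.intro _ h)
  have h1 : Ideal.absNorm 𝔮 ≠ 1 := fun h1 =>
    h𝔮.not_isUnit (Ideal.isUnit_iff.mpr (Ideal.absNorm_eq_one_iff.mp h1))
  interval_cases i
  · exact absurd (by simpa using hi') h1
  · left; simpa using hi'
  · right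
    have h2 : Ideal.absNorm 𝔯 = 1 := by
      rw [hi'] at h
      exact Nat.eq_of_mul_eq_mul_left (pow_pos hq.pos 2) (by rw [h, mul_one])
    rw [h𝔯, Ideal.absNorm_eq_one_iff.mp h2, Ideal.mul_top]

end QuadraticData

/-! ### Hecke characters -/

/-- A function that is multiplicative on the ideals prime to `𝔣` and prescribed on the principal
ideals `≡ 1` gives a Hecke character. -/
theorem exists_isHeckeCharacter_of_mul {𝔣 : Ideal (𝓞 K)} (h𝔣 : 𝔣 ≠ ⊥) {l : ℕ}
    (f : Ideal (𝓞 K) → ℂ) (h0 : ∀ 𝔞, 𝔞 ≠ ⊥ → IsCoprime 𝔞 𝔣 → f 𝔞 ≠ 0)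
    (hmul : ∀ 𝔞 𝔟, 𝔞 ≠ ⊥ → IsCoprime 𝔞 𝔣 → 𝔟 ≠ ⊥ → IsCoprime 𝔟 𝔣 → f (𝔞 * 𝔟) = f 𝔞 * f 𝔟)
    (hp : ∀ α : 𝓞 K, α ≠ 0 → α - 1 ∈ 𝔣 → f (Ideal.span {α}) = σ (α : K) ^ l) :
    ∃ ψ : Ideal (𝓞 K) →*₀ ℂ, IsHeckeCharacter σ 𝔣 l ψ ∧
      ∀ 𝔞, 𝔞 ≠ ⊥ → IsCoprime 𝔞 𝔣 → ψ 𝔞 = f 𝔞 := by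
  classical
  let ψ : Ideal (𝓞 K) →*₀ ℂ :=
    { toFun := fun 𝔞 => if 𝔞 ≠ ⊥ ∧ IsCoprime 𝔞 𝔣 then f 𝔞 else 0
      map_zero' := by simp
      map_one' := by
        have : f 1 = 1 := by
          have := hp 1 one_ne_zero (by simp)
          simpa [Ideal.span_singleton_one, ← Ideal.one_eq_top] using this
        rw [if_pos ⟨one_ne_zero, isCoprime_one_left⟩, this]
      map_mul' := by
        intro 𝔞 𝔟
        by_cases ha : 𝔞 ≠ ⊥ ∧ IsCoprime 𝔞 𝔣
        · by_cases hb : 𝔟 ≠ ⊥ ∧ IsCoprime 𝔟 𝔣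
          · rw [if_pos ha, if_pos hb, if_pos ⟨mul_ne_zero ha.1 hb.1, ha.2.mul_left hb.2⟩,
              hmul 𝔞 𝔟 ha.1 ha.2 hb.1 hb.2]
          · rw [if_neg hb, mul_zero, if_neg]
            rintro ⟨h1, h2⟩
            exact hb ⟨right_ne_zero_of_mul h1, IsCoprime.of_mul_left_right h2⟩
        · rw [if_neg ha, zero_mul, if_neg]
          rintro ⟨h1, h2⟩
          exact ha ⟨left_ne_zero_of_mul h1, IsCoprime.of_mul_left_left h2⟩ }
  have hψ : ∀ 𝔞, 𝔞 ≠ ⊥ → IsCoprime 𝔞 𝔣 → ψ 𝔞 = f 𝔞 := fun 𝔞 h1 h2 => if_pos ⟨h1, h2⟩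
  refine ⟨ψ, ⟨h𝔣, fun 𝔞 => ⟨fun h => ?_, fun h => ?_⟩, fun α hα h1 => ?_⟩, hψ⟩
  · by_contra h2
    exact h (if_neg h2)
  · rw [hψ 𝔞 h.1 h.2]; exact h0 𝔞 h.1 h.2
  · rw [hψ _ (span_ne_bot hα) (isCoprime_span_of_sub_one_mem h1), hp α hα h1]

theorem exists_inverse {𝔪 : Ideal (𝓞 K)} {x : 𝓞 K} (h : IsCoprime (Ideal.span {x}) 𝔪) :
    ∃ y, y ≠ 0 ∧ y * x - 1 ∈ 𝔪 := by
  obtain ⟨y, hy⟩ := isCoprime_span_iff.mp h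
  by_cases h0 : y = 0
  · refine ⟨1, one_ne_zero, ?_⟩
    have : 𝔪 = ⊤ := by
      rw [Ideal.eq_top_iff_one]
      simpa [h0] using hy
    rw [this]; trivial
  · exact ⟨y, h0, hy⟩

namespace IsHeckeCharacter

variable {𝔪 : Ideal (𝓞 K)} {l : ℕ} {ψ : Ideal (𝓞 K) →*₀ ℂ}

theorem apply_ne_zero (hψ : IsHeckeCharacter σ 𝔪 l ψ) {𝔞 : Ideal (𝓞 K)} (h0 : 𝔞 ≠ ⊥)
    (hc : IsCoprime 𝔞 𝔪) : ψ 𝔞 ≠ 0 := (hψ.ne_zero_iff 𝔞).mpr ⟨h0, hc⟩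

theorem apply_eq_zero (hψ : IsHeckeCharacter σ 𝔪 l ψ) {𝔞 : Ideal (𝓞 K)}
    (hc : ¬ IsCoprime 𝔞 𝔪) : ψ 𝔞 = 0 := by
  by_contra h
  exact hc ((hψ.ne_zero_iff 𝔞).mp h).2

/-- The quotient `ψ (α) / α ^ l` depends only on `α` modulo `𝔪`: multiply `α` and `β` by a common
inverse to make both `≡ 1`. -/
theorem congr (hψ : IsHeckeCharacter σ 𝔪 l ψ) {α β : 𝓞 K} (hα : α ≠ 0) (hβ : β ≠ 0)
    (hc : IsCoprime (Ideal.span {α}) 𝔪) (h : α - β ∈ 𝔪) :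
    ψ (Ideal.span {α}) * σ (β : K) ^ l = ψ (Ideal.span {β}) * σ (α : K) ^ l := by
  obtain ⟨y, hy, h1⟩ := exists_inverse hc
  have h2 : y * β - 1 ∈ 𝔪 := by
    have : y * β - 1 = (y * α - 1) - y * (α - β) := by ring
    rw [this]; exact sub_mem h1 (Ideal.mul_mem_left _ _ h)
  have e1 := hψ.map_principal _ (mul_ne_zero hy hα) h1
  have e2 := hψ.map_principal _ (mul_ne_zero hy hβ) h2
  rw [← Ideal.span_singleton_mul_span_singleton, map_mul] at e1 e2
  simp only [map_mul, mul_pow] at e1 e2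
  have h3 : ψ (Ideal.span {y}) ≠ 0 := by
    intro h0
    rw [h0, zero_mul] at e1
    exact mul_ne_zero (pow_ne_zero _ (embedding_ne_zero σ hy))
      (pow_ne_zero _ (embedding_ne_zero σ hα)) e1.symm
  apply mul_left_cancel₀ h3
  apply mul_left_cancel₀ (pow_ne_zero l (embedding_ne_zero σ hy))
  linear_combination (σ (y : K) ^ l * σ (β : K) ^ l) * e1 - (σ (y : K) ^ l * σ (α : K) ^ l) * e2

/-- Characters that agree away from the primes of `𝔫` agree wherever both are defined, because every
ideal can be moved away from `𝔫` at the cost of a principal ideal `≡ 1`. -/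
theorem eq_of_eq (hψ : IsHeckeCharacter σ 𝔪 l ψ) {𝔪' 𝔫 : Ideal (𝓞 K)}
    {ψ' : Ideal (𝓞 K) →*₀ ℂ} (hψ' : IsHeckeCharacter σ 𝔪' l ψ') (h𝔫 : 𝔫 ≠ ⊥)
    (h : ∀ 𝔞, 𝔞 ≠ ⊥ → IsCoprime 𝔞 𝔫 → IsCoprime 𝔞 𝔪 → IsCoprime 𝔞 𝔪' → ψ 𝔞 = ψ' 𝔞)
    {𝔞 : Ideal (𝓞 K)} (h0 : 𝔞 ≠ ⊥) (h1 : IsCoprime 𝔞 𝔪) (h2 : IsCoprime 𝔞 𝔪') :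
    ψ 𝔞 = ψ' 𝔞 := by
  obtain ⟨𝔟, γ, hγ, h𝔟, h𝔟', hγ1, hγ0, h𝔟0⟩ := exists_isCoprime_mul_eq_span_sub_one_mem h0
    (mul_ne_zero hψ.modulus_ne_bot hψ'.modulus_ne_bot) h𝔫 (h1.mul_right h2)
  have e1 := hψ.map_principal γ hγ0 (Ideal.mul_le_left hγ1)
  have e2 := hψ'.map_principal γ hγ0 (Ideal.mul_le_right hγ1)
  rw [← hγ, map_mul] at e1 e2
  have hb1 := IsCoprime.of_mul_right_left h𝔟'
  have hb2 := IsCoprime.of_mul_right_right h𝔟'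
  have e3 := h 𝔟 h𝔟0 h𝔟 hb1 hb2
  apply mul_right_cancel₀ (hψ.apply_ne_zero h𝔟0 hb1)
  rw [e1, ← e2, e3]

/-- The value at `𝔞` has to be `γ ^ l / ψ 𝔟` when `𝔞 𝔟 = (γ)`, `γ ≡ 1` mod `𝔣` and `𝔟` is prime to
`𝔪` and `𝔣`. The hypothesis `hp` makes it independent of the choices; this is how characters descend
to smaller moduli. -/
theorem exists_extension {𝔪 𝔣 : Ideal (𝓞 K)} (h𝔪 : 𝔪 ≠ ⊥)
    (hψ : ∀ 𝔞 : Ideal (𝓞 K), ψ 𝔞 ≠ 0 ↔ 𝔞 ≠ ⊥ ∧ IsCoprime 𝔞 𝔪) (h𝔣 : 𝔣 ≠ ⊥)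
    (hp : ∀ α : 𝓞 K, α ≠ 0 → α - 1 ∈ 𝔣 → IsCoprime (Ideal.span {α}) 𝔪 →
      ψ (Ideal.span {α}) = σ (α : K) ^ l) :
    ∃ ψ' : Ideal (𝓞 K) →*₀ ℂ, IsHeckeCharacter σ 𝔣 l ψ' ∧
      ∀ 𝔞, 𝔞 ≠ ⊥ → IsCoprime 𝔞 𝔪 → IsCoprime 𝔞 𝔣 → ψ' 𝔞 = ψ 𝔞 := by
  classical
  let P : Ideal (𝓞 K) → ℂ → Prop := fun 𝔞 z => ∃ (𝔟 : Ideal (𝓞 K)) (γ : 𝓞 K),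
    𝔞 * 𝔟 = Ideal.span {γ} ∧ IsCoprime 𝔟 𝔪 ∧ IsCoprime 𝔟 𝔣 ∧ γ - 1 ∈ 𝔣 ∧ γ ≠ 0 ∧ 𝔟 ≠ ⊥ ∧
      z * ψ 𝔟 = σ (γ : K) ^ l
  have hex : ∀ 𝔞, 𝔞 ≠ ⊥ → IsCoprime 𝔞 𝔣 → ∃ z, P 𝔞 z := by
    intro 𝔞 h0 hc
    obtain ⟨𝔟, γ, h1, h2, h3, h4, h5, h6⟩ :=
      exists_isCoprime_mul_eq_span_sub_one_mem h0 h𝔣 h𝔪 hc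
    exact ⟨σ (γ : K) ^ l / ψ 𝔟, 𝔟, γ, h1, h2, h3, h4, h5, h6,
      div_mul_cancel₀ _ ((hψ 𝔟).mpr ⟨h6, h2⟩)⟩
  have huniq : ∀ 𝔞 z z', P 𝔞 z → P 𝔞 z' → z = z' := by
    rintro 𝔞 z z' ⟨𝔟, γ, h1, h2, h3, h4, h5, h6, h7⟩ ⟨𝔟', γ', h1', h2', h3', h4', h5', h6', h7'⟩
    -- To compare `(𝔟, γ)` with `(𝔟', γ')`, take `𝔟 𝔠 = (δ)` with `δ ≡ 1`. Then `𝔟' 𝔠 = (δ')` with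
    -- `γ δ' = γ' δ`, so `δ' ≡ 1` too and `hp` applies to both.
    obtain ⟨𝔠, δ, hδ, h𝔠, h𝔠', hδ1, hδ0, h𝔠0⟩ :=
      exists_isCoprime_mul_eq_span_sub_one_mem h6 h𝔣 h𝔪 h3
    obtain ⟨δ', hδ', he⟩ := exists_eq_span_of_span_mul_eq (x := γ) (y := γ' * δ) (I := 𝔟' * 𝔠) h5 (by
      rw [← h1, ← Ideal.span_singleton_mul_span_singleton, ← h1', ← hδ]; ring)
    have hδ'1 : δ' - 1 ∈ 𝔣 := by
      have : δ' - 1 = (γ' - 1) * δ + (δ - 1) - (γ - 1) * δ' := by linear_combination -he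
      rw [this]
      exact sub_mem (add_mem (Ideal.mul_mem_right _ _ h4') hδ1) (Ideal.mul_mem_right _ _ h4)
    have hδ'0 : δ' ≠ 0 := by
      rintro rfl
      rw [mul_zero] at he
      exact mul_ne_zero h5' hδ0 he
    have e1 := hp δ hδ0 hδ1 (hδ ▸ h2.mul_left h𝔠)
    have e2 := hp δ' hδ'0 hδ'1 (hδ' ▸ h2'.mul_left h𝔠)
    rw [← hδ, map_mul] at e1
    rw [← hδ', map_mul] at e2
    have e3 : σ (γ' : K) * σ (δ : K) = σ (γ : K) * σ (δ' : K) := by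
      have := congrArg (fun x : 𝓞 K => σ (x : K)) he
      simpa only [map_mul] using this
    have hb := (hψ 𝔟).mpr ⟨h6, h2⟩
    have hb' := (hψ 𝔟').mpr ⟨h6', h2'⟩
    have hc := (hψ 𝔠).mpr ⟨h𝔠0, h𝔠⟩
    apply mul_right_cancel₀ (mul_ne_zero (mul_ne_zero hb hb') hc)
    calc z * (ψ 𝔟 * ψ 𝔟' * ψ 𝔠) = (z * ψ 𝔟) * (ψ 𝔟' * ψ 𝔠) := by ring
      _ = (σ (γ : K) * σ (δ' : K)) ^ l := by rw [h7, e2, mul_pow]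
      _ = (z' * ψ 𝔟') * (ψ 𝔟 * ψ 𝔠) := by rw [h7', e1, ← e3, mul_pow]
      _ = _ := by ring
  let f : Ideal (𝓞 K) → ℂ := fun 𝔞 => if h : ∃ z, P 𝔞 z then h.choose else 0
  have hf : ∀ 𝔞 z, P 𝔞 z → f 𝔞 = z := by
    intro 𝔞 z h
    have h' : ∃ z, P 𝔞 z := ⟨z, h⟩
    simp only [f, dif_pos h']
    exact huniq _ _ _ h'.choose_spec h
  suffices ∃ ψ' : Ideal (𝓞 K) →*₀ ℂ, IsHeckeCharacter σ 𝔣 l ψ' ∧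
      ∀ 𝔞, 𝔞 ≠ ⊥ → IsCoprime 𝔞 𝔣 → ψ' 𝔞 = f 𝔞 by
    obtain ⟨ψ', h1, h2⟩ := this
    refine ⟨ψ', h1, fun 𝔞 h0 hm hf' => ?_⟩
    rw [h2 𝔞 h0 hf']
    obtain ⟨𝔟, γ, h3, h4, h5, h6, h7, h8⟩ :=
      exists_isCoprime_mul_eq_span_sub_one_mem h0 h𝔣 h𝔪 hf'
    refine hf _ _ ⟨𝔟, γ, h3, h4, h5, h6, h7, h8, ?_⟩
    rw [← map_mul, h3]
    exact hp γ h7 h6 (h3 ▸ hm.mul_left h4)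
  refine exists_isHeckeCharacter_of_mul h𝔣 f ?_ ?_ ?_
  · intro 𝔞 h0 hc
    obtain ⟨z, hz⟩ := hex 𝔞 h0 hc
    rw [hf _ _ hz]
    obtain ⟨𝔟, γ, -, -, -, -, h5, -, h7⟩ := hz
    rintro rfl
    rw [zero_mul] at h7
    exact pow_ne_zero l (embedding_ne_zero σ h5) h7.symm
  · intro 𝔞 𝔞' h0 hc h0' hc'
    obtain ⟨z, hz⟩ := hex 𝔞 h0 hc
    obtain ⟨z', hz'⟩ := hex 𝔞' h0' hc'
    rw [hf _ _ hz, hf _ _ hz']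
    apply hf
    obtain ⟨𝔟, γ, h1, h2, h3, h4, h5, h6, h7⟩ := hz
    obtain ⟨𝔟', γ', h1', h2', h3', h4', h5', h6', h7'⟩ := hz'
    refine ⟨𝔟 * 𝔟', γ * γ', ?_, h2.mul_left h2', h3.mul_left h3', ?_, mul_ne_zero h5 h5',
      mul_ne_zero h6 h6', ?_⟩
    · rw [← Ideal.span_singleton_mul_span_singleton, ← h1, ← h1']; ring
    · have : γ * γ' - 1 = (γ - 1) * γ' + (γ' - 1) := by ring
      rw [this]
      exact add_mem (Ideal.mul_mem_right _ _ h4) h4'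
    · rw [map_mul, embedding_mul, mul_pow, ← h7, ← h7']; ring
  · intro α hα h1
    refine hf _ _ ⟨1, α, mul_one _, isCoprime_one_left, isCoprime_one_left, h1, hα, one_ne_zero, ?_⟩
    rw [map_one, mul_one]

end IsHeckeCharacter

/-! ### Conductors -/

theorem HasConductor.dvd {𝔣 𝔪 𝔫 : Ideal (𝓞 K)} {l : ℕ} {ψ ψ' : Ideal (𝓞 K) →*₀ ℂ}
    (h : HasConductor σ 𝔣 l ψ) (h' : IsHeckeCharacter σ 𝔪 l ψ') (h𝔫 : 𝔫 ≠ ⊥)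
    (he : ∀ 𝔞, 𝔞 ≠ ⊥ → IsCoprime 𝔞 𝔫 → IsCoprime 𝔞 𝔣 → IsCoprime 𝔞 𝔪 → ψ 𝔞 = ψ' 𝔞) :
    𝔣 ∣ 𝔪 :=
  h.2 𝔪 ψ' h' fun _ hc h0 => h.1.eq_of_eq h' h𝔫 he h0 (IsCoprime.of_mul_right_left hc)
    (IsCoprime.of_mul_right_right hc)

/-- The conductor is determined by the values away from finitely many primes. -/
theorem HasConductor.unique {𝔣 𝔣' 𝔫 : Ideal (𝓞 K)} {l : ℕ} {ψ ψ' : Ideal (𝓞 K) →*₀ ℂ}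
    (h : HasConductor σ 𝔣 l ψ) (h' : HasConductor σ 𝔣' l ψ') (h𝔫 : 𝔫 ≠ ⊥)
    (he : ∀ 𝔞, 𝔞 ≠ ⊥ → IsCoprime 𝔞 𝔫 → IsCoprime 𝔞 𝔣 → IsCoprime 𝔞 𝔣' → ψ 𝔞 = ψ' 𝔞) :
    𝔣 = 𝔣' :=
  dvd_antisymm_of_normalize_eq (normalize_eq _) (normalize_eq _) (h.dvd h'.1 h𝔫 he)
    (h'.dvd h.1 h𝔫 fun 𝔞 h0 h1 h2 h3 => (he 𝔞 h0 h1 h3 h2).symm)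

theorem hasConductor_top {l : ℕ} {ψ : Ideal (𝓞 K) →*₀ ℂ} (h : IsHeckeCharacter σ ⊤ l ψ) :
    HasConductor σ ⊤ l ψ :=
  ⟨h, fun 𝔪 _ _ _ => by rw [← Ideal.one_eq_top]; exact one_dvd 𝔪⟩

/-- If `𝔭 ^ (k + 1)` did not divide `𝔪`, then `𝔭 ^ k` would lie in `𝔭 ^ (k + 1) + 𝔪`, and some `β`
would be `≡ α` mod `𝔭 ^ (k + 1)` and `≡ 1` mod `𝔪`. Evaluating at `β` in both ways gives `ψ (α) = α
^ l`. -/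
theorem hasConductor_pow {𝔭 : Ideal (𝓞 K)} (h𝔭 : Prime 𝔭) {k l : ℕ} {ψ : Ideal (𝓞 K) →*₀ ℂ}
    (h : IsHeckeCharacter σ (𝔭 ^ (k + 1)) l ψ) {α : 𝓞 K} (hα : α ≠ 0) (hα1 : α - 1 ∈ 𝔭 ^ k)
    (hc : IsCoprime (Ideal.span {α}) 𝔭) (hne : ψ (Ideal.span {α}) ≠ σ (α : K) ^ l) :
    HasConductor σ (𝔭 ^ (k + 1)) l ψ := by
  refine ⟨h, fun 𝔪 ψ' h' he => ?_⟩
  by_contra hd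
  have hle : 𝔭 ^ k ≤ 𝔭 ^ (k + 1) + 𝔪 := by
    have h1 : 𝔭 ^ (k + 1) + 𝔪 ∣ 𝔭 ^ (k + 1) := by
      rw [Ideal.dvd_iff_le]; exact le_sup_left
    obtain ⟨i, hi, hi'⟩ := (dvd_prime_pow h𝔭 _).mp h1
    have hi' := associated_iff_eq.mp hi'
    rcases hi.lt_or_eq with hlt | rfl
    · rw [hi']
      exact Ideal.pow_le_pow_right (by omega)
    · exact absurd (Ideal.dvd_iff_le.mpr (le_sup_right.trans hi'.le)) hd
  obtain ⟨β', hβ1, hβ2⟩ := exists_sub_mem_and_sub_mem (x := α) (y := 1) (hle hα1)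
  have hcα : IsCoprime (Ideal.span {α}) (𝔭 ^ (k + 1)) := hc.pow_right
  have h𝔭k := pow_ne_zero (k + 1) h𝔭.ne_zero
  obtain ⟨β, hβ0, hβα, hβm⟩ : ∃ β : 𝓞 K, β ≠ 0 ∧ β - α ∈ 𝔭 ^ (k + 1) ∧ β - 1 ∈ 𝔪 := by
    by_cases hb : β' = 0
    · subst hb
      have hm : 𝔪 = ⊤ := by
        rw [Ideal.eq_top_iff_one]; simpa using neg_mem hβ2
      exact ⟨α, hα, by simp, by rw [hm]; trivial⟩
    · exact ⟨β', hb, hβ1, hβ2⟩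
  have hcβ : IsCoprime (Ideal.span {β}) (𝔭 ^ (k + 1)) :=
    isCoprime_span_of_sub_mem (by rw [← neg_sub]; exact neg_mem hβα) hcα
  have e1 := h.congr hβ0 hα hcβ hβα
  have e2 := he (Ideal.span {β}) (hcβ.mul_right (isCoprime_span_of_sub_one_mem hβm))
    (span_ne_bot hβ0)
  rw [h'.map_principal β hβ0 hβm] at e2
  rw [e2, mul_comm] at e1
  exact hne (mul_right_cancel₀ (pow_ne_zero l (embedding_ne_zero σ hβ0)) e1).symm

/-! ### Rational coefficients -/

theorem embedding_sum (σ : K →+* ℂ) {ι : Type*} (S : Finset ι) (f : ι → 𝓞 K) :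
    σ ((∑ i ∈ S, f i : 𝓞 K) : K) = ∑ i ∈ S, σ (f i : K) := by
  simp

theorem coeff_eq_sum (ψ : Ideal (𝓞 K) →*₀ ℂ) {n : ℕ} {S : Finset (Ideal (𝓞 K))}
    (h : ∀ 𝔞, Ideal.absNorm 𝔞 = n ↔ 𝔞 ∈ S) : coeff ψ n = ∑ 𝔞 ∈ S, ψ 𝔞 := by
  rw [coeff]
  congr 1
  ext 𝔞
  simp [h]

theorem exists_embedding_eq_of_pow {z : ℂ} {k : K} (hz : z = σ k) {n : ℕ} (hn : n ≠ 0) {x : 𝓞 K}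
    (h : z ^ n = σ (x : K)) : ∃ y : 𝓞 K, z = σ (y : K) := by
  have h1 : k ^ n = (x : K) := σ.injective (by rw [map_pow, ← hz, h])
  have h2 : IsIntegral ℤ k := by
    refine IsIntegral.of_pow (Nat.pos_of_ne_zero hn) ?_
    rw [h1]; exact RingOfIntegers.isIntegral_coe x
  exact ⟨⟨k, h2⟩, hz⟩

theorem IsHeckeCharacter.exists_pow_eq {𝔪 : Ideal (𝓞 K)} {l : ℕ} {ψ : Ideal (𝓞 K) →*₀ ℂ}
    (hψ : IsHeckeCharacter σ 𝔪 l ψ) {𝔞 : Ideal (𝓞 K)} (h0 : ψ 𝔞 ≠ 0) :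
    ∃ (n : ℕ) (α : 𝓞 K), n ≠ 0 ∧ 𝔞 ^ n = Ideal.span {α} ∧ ψ 𝔞 ^ n = σ ((α ^ l : 𝓞 K) : K) := by
  obtain ⟨k, hk, h⟩ := exists_pow_eq_span_sub_one_mem hψ.modulus_ne_bot
  obtain ⟨h1, h2⟩ := (hψ.ne_zero_iff 𝔞).mp h0
  obtain ⟨α, hα, h3, h4⟩ := h 𝔞 h1 h2
  exact ⟨k, α, hk, h3, by rw [← map_pow, h3, hψ.map_principal α hα h4, embedding_pow]⟩

/-- A power `𝔞 ^ n = (α)` with `α ≡ 1` has value `α ^ l`, so `(x) ^ n = 𝔞 ^ (l n)`; unique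
factorization removes the exponent `n`. -/
theorem IsHeckeCharacter.span_eq_pow {𝔪 : Ideal (𝓞 K)} {l : ℕ} {ψ : Ideal (𝓞 K) →*₀ ℂ}
    (hψ : IsHeckeCharacter σ 𝔪 l ψ) {𝔞 : Ideal (𝓞 K)} (h0 : ψ 𝔞 ≠ 0) {x : 𝓞 K}
    (hx : ψ 𝔞 = σ (x : K)) : Ideal.span {x} = 𝔞 ^ l := by
  obtain ⟨n, α, hn, h1, h2⟩ := hψ.exists_pow_eq h0
  rw [hx, ← embedding_pow] at h2
  refine ideal_pow_left_injective hn ?_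
  rw [Ideal.span_singleton_pow, embedding_injective σ h2, ← Ideal.span_singleton_pow, ← h1,
    ← pow_mul, ← pow_mul, mul_comm]

namespace QuadraticData

variable (Q : QuadraticData σ)

/-- Purity of the absolute value, read off from a principal power of `𝔞`. -/
theorem normSq_apply {𝔪 : Ideal (𝓞 K)} {l : ℕ} {ψ : Ideal (𝓞 K) →*₀ ℂ} (Q : QuadraticData σ)
    (hψ : IsHeckeCharacter σ 𝔪 l ψ) {𝔞 : Ideal (𝓞 K)} (h0 : ψ 𝔞 ≠ 0) :
    Complex.normSq (ψ 𝔞) = (Ideal.absNorm 𝔞 : ℝ) ^ l := by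
  obtain ⟨n, α, hn, h1, h2⟩ := hψ.exists_pow_eq h0
  have h3 := congrArg Complex.normSq h2
  rw [map_pow, Q.normSq_embedding_eq, ← Ideal.span_singleton_pow, ← h1, map_pow, map_pow] at h3
  push_cast at h3
  rw [← pow_mul, mul_comm, pow_mul] at h3
  exact (pow_left_inj₀ (Complex.normSq_nonneg _) (by positivity) hn).mp h3

/-- The values of `ψ` lie in the ring of integers of `K`, and `ψ` commutes with complex
conjugation. -/
def IsEquivariant (ψ : Ideal (𝓞 K) →*₀ ℂ) : Prop :=
  ∀ 𝔞 : Ideal (𝓞 K), ∃ x : 𝓞 K, ψ 𝔞 = σ (x : K) ∧ ψ (Q.conjIdeal 𝔞) = σ (Q.conj x : K)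

/-- Conjugation permutes the ideals of norm `n`, so the coefficient is an element of `𝓞 K` fixed by
conjugation. -/
theorem IsEquivariant.hasRationalCoeffs {Q : QuadraticData σ} {ψ : Ideal (𝓞 K) →*₀ ℂ}
    (h : Q.IsEquivariant ψ) : HasRationalCoeffs ψ := by
  classical
  choose f hf1 hf2 using h
  intro n
  set S := (Ideal.finite_setOfPred_absNorm_eq (S := 𝓞 K) n).toFinset with hS
  have h1 : coeff ψ n = σ ((∑ 𝔞 ∈ S, f 𝔞 : 𝓞 K) : K) := by
    rw [coeff, embedding_sum]
    exact Finset.sum_congr rfl fun 𝔞 _ => hf1 𝔞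
  have h2 : coeff ψ n = σ ((Q.conj (∑ 𝔞 ∈ S, f 𝔞) : 𝓞 K) : K) := by
    rw [coeff, map_sum, embedding_sum, ← hS]
    simp_rw [← hf2]
    refine Finset.sum_nbij' Q.conjIdeal Q.conjIdeal ?_ ?_ ?_ ?_ ?_
    · intro 𝔞 h; simpa [hS, Q.absNorm_conjIdeal] using h
    · intro 𝔞 h; simpa [hS, Q.absNorm_conjIdeal] using h
    · simp
    · simp
    · simp
  rw [h1] at h2
  obtain ⟨a, ha⟩ := Q.eq_intCast_of_conj_eq (embedding_injective σ h2).symm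
  refine ⟨a, ?_⟩
  rw [h1, ha]
  simp

/-- A real power of `ψ 𝔞` makes a generator of a power of `𝔞` real. As `l ≠ 0`, that power, and
hence `𝔞` itself, is stable under conjugation. -/
theorem conjIdeal_eq_of_real {𝔪 : Ideal (𝓞 K)} {l : ℕ} (hl : l ≠ 0) {ψ : Ideal (𝓞 K) →*₀ ℂ}
    (hψ : IsHeckeCharacter σ 𝔪 l ψ) {𝔞 : Ideal (𝓞 K)} (h0 : ψ 𝔞 ≠ 0) {n : ℕ} (hn : n ≠ 0)
    (hr : starRingEnd ℂ (ψ 𝔞 ^ n) = ψ 𝔞 ^ n) : Q.conjIdeal 𝔞 = 𝔞 := by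
  obtain ⟨k, α, hk, h1, h2⟩ := hψ.exists_pow_eq h0
  have h3 : starRingEnd ℂ ((ψ 𝔞 ^ k) ^ n) = (ψ 𝔞 ^ k) ^ n := by
    rw [← pow_mul, mul_comm, pow_mul, map_pow, hr]
  rw [h2, ← embedding_pow, ← Q.map_conj] at h3
  have h4 := embedding_injective σ h3
  refine ideal_pow_left_injective (mul_ne_zero hk (mul_ne_zero hl hn)) ?_
  rw [pow_mul, pow_mul, pow_mul, pow_mul, ← conjIdeal_pow, h1, ← conjIdeal_pow, ← conjIdeal_pow,
    Ideal.span_singleton_pow, Ideal.span_singleton_pow, conjIdeal_span, h4]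

theorem prime_conjIdeal {𝔮 : Ideal (𝓞 K)} (h : Prime 𝔮) : Prime (Q.conjIdeal 𝔮) := by
  have h1 := Ideal.isPrime_of_prime h
  refine Ideal.prime_of_isPrime (fun h0 => h.ne_zero (Q.conjIdeal_eq_bot.mp h0)) ?_
  exact Ideal.map_isPrime_of_equiv Q.conj

theorem one_lt_absNorm {𝔮 : Ideal (𝓞 K)} (h : Prime 𝔮) : 1 < Ideal.absNorm 𝔮 := by
  have h0 : Ideal.absNorm 𝔮 ≠ 0 := fun h0 => h.ne_zero (Ideal.absNorm_eq_zero_iff.mp h0)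
  have h1 : Ideal.absNorm 𝔮 ≠ 1 := fun h1 =>
    h.not_isUnit (Ideal.isUnit_iff.mpr (Ideal.absNorm_eq_one_iff.mp h1))
  omega

/-- An ideal divides its norm, here `(𝔮 𝔮̄) ^ k`, so only powers of `𝔮` and `𝔮̄` occur. -/
theorem absNorm_eq_pow_iff {𝔮 : Ideal (𝓞 K)} (h : Prime 𝔮) {𝔞 : Ideal (𝓞 K)} {k : ℕ} :
    Ideal.absNorm 𝔞 = Ideal.absNorm 𝔮 ^ k ↔
      ∃ i j : ℕ, i + j = k ∧ 𝔞 = 𝔮 ^ i * Q.conjIdeal 𝔮 ^ j := by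
  constructor
  · intro hn
    have h1 : 𝔞 ∣ 𝔮 ^ k * Q.conjIdeal 𝔮 ^ k := by
      rw [← mul_pow, Q.mul_conjIdeal, Ideal.span_singleton_pow, ← Nat.cast_pow, ← hn,
        Ideal.dvd_iff_le, Ideal.span_singleton_le_iff_mem]
      exact Ideal.absNorm_mem 𝔞
    obtain ⟨d₁, d₂, h2, h3, rfl⟩ := exists_dvd_and_dvd_of_dvd_mul h1
    obtain ⟨i, hi, hi'⟩ := (dvd_prime_pow h _).mp h2
    obtain ⟨j, hj, hj'⟩ := (dvd_prime_pow (Q.prime_conjIdeal h) _).mp h3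
    rw [associated_iff_eq] at hi' hj'
    subst hi' hj'
    refine ⟨i, j, ?_, rfl⟩
    rw [map_mul, map_pow, map_pow, Q.absNorm_conjIdeal, ← pow_add] at hn
    exact Nat.pow_right_injective (one_lt_absNorm h) hn
  · rintro ⟨i, j, rfl, rfl⟩
    rw [map_mul, map_pow, map_pow, Q.absNorm_conjIdeal, pow_add]

theorem coeff_absNorm_of_conjIdeal_eq {𝔮 : Ideal (𝓞 K)} (h : Prime 𝔮) (hc : Q.conjIdeal 𝔮 = 𝔮)
    (ψ : Ideal (𝓞 K) →*₀ ℂ) : coeff ψ (Ideal.absNorm 𝔮) = ψ 𝔮 := by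
  rw [coeff_eq_sum ψ (S := {𝔮}), Finset.sum_singleton]
  intro 𝔞
  have h1 := Q.absNorm_eq_pow_iff h (𝔞 := 𝔞) (k := 1)
  rw [pow_one] at h1
  rw [h1, Finset.mem_singleton, hc]
  constructor
  · rintro ⟨i, j, hij, rfl⟩
    rw [← pow_add, hij, pow_one]
  · rintro rfl
    exact ⟨1, 0, rfl, by simp⟩

theorem coeff_absNorm {𝔮 : Ideal (𝓞 K)} (h : Prime 𝔮) (hc : Q.conjIdeal 𝔮 ≠ 𝔮)
    (ψ : Ideal (𝓞 K) →*₀ ℂ) : coeff ψ (Ideal.absNorm 𝔮) = ψ 𝔮 + ψ (Q.conjIdeal 𝔮) := by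
  classical
  rw [coeff_eq_sum ψ (S := {𝔮, Q.conjIdeal 𝔮}), Finset.sum_pair hc.symm]
  intro 𝔞
  have h1 := Q.absNorm_eq_pow_iff h (𝔞 := 𝔞) (k := 1)
  rw [pow_one] at h1
  rw [h1, Finset.mem_insert, Finset.mem_singleton]
  constructor
  · rintro ⟨i, j, hij, rfl⟩
    obtain ⟨rfl, rfl⟩ | ⟨rfl, rfl⟩ : (i = 0 ∧ j = 1) ∨ (i = 1 ∧ j = 0) := by omega
    · right; simp
    · left; simp
  · rintro (rfl | rfl)
    · exact ⟨1, 0, rfl, by simp⟩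
    · exact ⟨0, 1, rfl, by simp⟩

theorem coeff_absNorm_sq {𝔮 : Ideal (𝓞 K)} (h : Prime 𝔮) (hc : Q.conjIdeal 𝔮 ≠ 𝔮)
    (ψ : Ideal (𝓞 K) →*₀ ℂ) : coeff ψ (Ideal.absNorm 𝔮 ^ 2) =
      ψ 𝔮 ^ 2 + ψ 𝔮 * ψ (Q.conjIdeal 𝔮) + ψ (Q.conjIdeal 𝔮) ^ 2 := by
  classical
  set 𝔮' := Q.conjIdeal 𝔮 with h𝔮'
  have h0 : 𝔮 ≠ 0 := h.ne_zero
  have h0' : 𝔮' ≠ 0 := (Q.prime_conjIdeal h).ne_zero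
  have n1 : 𝔮 ^ 2 ≠ 𝔮 * 𝔮' := fun e => hc (mul_left_cancel₀ h0 (by rw [← e, sq]))
  have n2 : 𝔮 * 𝔮' ≠ 𝔮' ^ 2 := fun e => hc (mul_right_cancel₀ h0' (by rw [e, sq]))
  have n3 : 𝔮 ^ 2 ≠ 𝔮' ^ 2 := fun e => hc (ideal_pow_left_injective two_ne_zero e).symm
  rw [coeff_eq_sum ψ (S := {𝔮 ^ 2, 𝔮 * 𝔮', 𝔮' ^ 2}), Finset.sum_insert (by simp [n1, n3]),
    Finset.sum_pair n2]
  · simp only [map_mul, map_pow]; ring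
  intro 𝔞
  rw [Q.absNorm_eq_pow_iff h (𝔞 := 𝔞) (k := 2)]
  simp only [Finset.mem_insert, Finset.mem_singleton, ← h𝔮']
  constructor
  · rintro ⟨i, j, hij, rfl⟩
    obtain ⟨rfl, rfl⟩ | ⟨rfl, rfl⟩ | ⟨rfl, rfl⟩ :
      (i = 0 ∧ j = 2) ∨ (i = 1 ∧ j = 1) ∨ (i = 2 ∧ j = 0) := by omega
    · right; right; simp
    · right; left; simp
    · left; simp
  · rintro (rfl | rfl | rfl)
    · exact ⟨2, 0, rfl, by simp⟩
    · exact ⟨1, 1, rfl, by simp⟩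
    · exact ⟨0, 2, rfl, by simp⟩

theorem exists_pow_eq_add_mul {z : ℂ} {a b : ℚ} (h : z ^ 2 = a * z - b) (n : ℕ) :
    ∃ u v : ℚ, z ^ n = u + v * z := by
  induction n with
  | zero => exact ⟨1, 0, by simp⟩
  | succ n ih =>
    obtain ⟨u, v, huv⟩ := ih
    refine ⟨-(v * b), u + v * a, ?_⟩
    rw [pow_succ, huv]
    push_cast
    linear_combination (v : ℂ) * h

/-- Suppose `𝔮 ≠ 𝔮̄` and let `A`, `B` be the values there. The coefficients at `N 𝔮` and `N 𝔮 ^ 2`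
make `A + B` and `A B` rational. Since `|A| = |B|`, this gives `B = ± Ā`; the minus sign would make
`A - Ā` both rational and purely imaginary, so `A` real, which is impossible. Finally `A` is
quadratic over `ℚ` with a power `A ^ n = u + v A` in `K`, and `v ≠ 0` puts `A` in `K`. -/
theorem exists_embedding_eq_of_prime {𝔪 : Ideal (𝓞 K)} {l : ℕ} (hl : l ≠ 0)
    {ψ : Ideal (𝓞 K) →*₀ ℂ} (hψ : IsHeckeCharacter σ 𝔪 l ψ) (hr : HasRationalCoeffs ψ)
    {𝔮 : Ideal (𝓞 K)} (h : Prime 𝔮) (h0 : ψ 𝔮 ≠ 0) :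
    ∃ x : 𝓞 K, ψ 𝔮 = σ (x : K) ∧ ψ (Q.conjIdeal 𝔮) = σ (Q.conj x : K) := by
  obtain ⟨n, α, hn, h1, h2⟩ := hψ.exists_pow_eq h0
  by_cases hc : Q.conjIdeal 𝔮 = 𝔮
  · obtain ⟨q, hq⟩ := hr (Ideal.absNorm 𝔮)
    rw [Q.coeff_absNorm_of_conjIdeal_eq h hc] at hq
    obtain ⟨x, hx⟩ := exists_embedding_eq_of_pow (k := (q : K)) (by simp [hq]) hn h2
    refine ⟨x, hx, ?_⟩
    rw [hc, Q.map_conj, ← hx, hq]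
    simp
  · obtain ⟨a, ha⟩ := hr (Ideal.absNorm 𝔮)
    obtain ⟨c, hc2⟩ := hr (Ideal.absNorm 𝔮 ^ 2)
    rw [Q.coeff_absNorm h hc] at ha
    rw [Q.coeff_absNorm_sq h hc] at hc2
    -- No power of `A` is real, because `𝔮` is not stable under conjugation.
    have hnr : ∀ m : ℕ, m ≠ 0 → starRingEnd ℂ (ψ 𝔮 ^ m) ≠ ψ 𝔮 ^ m := fun m hm e =>
      hc (Q.conjIdeal_eq_of_real hl hψ h0 hm e)
    have h0' : ψ (Q.conjIdeal 𝔮) ≠ 0 := by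
      intro e
      rw [e, add_zero] at ha
      exact hnr 1 one_ne_zero (by rw [pow_one, ha]; simp)
    set A := ψ 𝔮 with hA
    set B := ψ (Q.conjIdeal 𝔮) with hB
    have hAB : A * B = ((a ^ 2 - c : ℚ) : ℂ) := by
      push_cast
      rw [← ha, ← hc2]; ring
    have hN := Q.normSq_apply hψ h0
    have hN' := Q.normSq_apply hψ h0'
    rw [← hA] at hN
    rw [← hB, Q.absNorm_conjIdeal] at hN'
    -- `(A B) ^ 2 = |A B| ^ 2 = (A Ā) ^ 2`
    have hconj : B = starRingEnd ℂ A := by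
      have e1 : A * starRingEnd ℂ A = ((Complex.normSq A : ℝ) : ℂ) := Complex.mul_conj A
      have e2 : starRingEnd ℂ (A * B) = A * B := by rw [hAB]; simp
      have e3 : (A * B) * starRingEnd ℂ (A * B) = ((Complex.normSq (A * B) : ℝ) : ℂ) :=
        Complex.mul_conj _
      rw [e2, map_mul, hN', ← hN, Complex.ofReal_mul, ← e1] at e3
      have e4 : B ^ 2 = (starRingEnd ℂ A) ^ 2 := by
        apply mul_left_cancel₀ (pow_ne_zero 2 h0)
        linear_combination e3
      rcases sq_eq_sq_iff_eq_or_eq_neg.mp e4 with e | e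
      · exact e
      · exfalso
        rw [e] at ha
        have e5 := congrArg (starRingEnd ℂ) ha
        rw [map_add, map_neg, Complex.conj_conj, Rat.cast_def] at e5
        have e6 : starRingEnd ℂ A + -A = a := by simpa [Rat.cast_def] using e5
        apply hnr 1 one_ne_zero
        rw [pow_one]
        linear_combination (e6 - ha) / 2
    have hquad : A ^ 2 = a * A - ((a ^ 2 - c : ℚ) : ℂ) := by
      rw [← hAB, ← ha]; ring
    obtain ⟨u, v, huv⟩ := exists_pow_eq_add_mul hquad n
    have hv : (v : ℂ) ≠ 0 := by
      intro hv
      apply hnr n hn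
      rw [huv, hv]; simp
    have hv' : v ≠ 0 := by exact_mod_cast hv
    obtain ⟨x, hx⟩ := exists_embedding_eq_of_pow
      (k := (((α ^ l : 𝓞 K) : K) - (u : K)) / (v : K)) (z := A) (by
        rw [map_div₀, map_sub, ← h2, huv, map_ratCast, map_ratCast]
        field_simp
        ring) hn h2
    exact ⟨x, hx, by rw [hconj, hx, Q.map_conj]⟩

theorem isEquivariant_of_hasRationalCoeffs {𝔪 : Ideal (𝓞 K)} {l : ℕ} (hl : l ≠ 0)
    {ψ : Ideal (𝓞 K) →*₀ ℂ} (hψ : IsHeckeCharacter σ 𝔪 l ψ) (hr : HasRationalCoeffs ψ) :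
    Q.IsEquivariant ψ := by
  intro 𝔞
  induction 𝔞 using UniqueFactorizationMonoid.induction_on_prime with
  | h₁ =>
    have : Q.conjIdeal 0 = 0 := Q.conjIdeal_eq_bot.mpr rfl
    exact ⟨0, by rw [map_zero]; simp, by rw [this, map_zero]; simp⟩
  | h₂ 𝔞 h =>
    rw [Ideal.isUnit_iff.mp h, conjIdeal_top, ← Ideal.one_eq_top]
    exact ⟨1, by rw [map_one]; simp, by rw [map_one]; simp⟩
  | h₃ 𝔞 𝔮 h h𝔮 ih =>
    obtain ⟨x, hx1, hx2⟩ := ih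
    obtain ⟨y, hy1, hy2⟩ : ∃ y : 𝓞 K, ψ 𝔮 = σ (y : K) ∧ ψ (Q.conjIdeal 𝔮) = σ (Q.conj y : K) := by
      by_cases h0 : ψ 𝔮 = 0
      · by_cases h0' : ψ (Q.conjIdeal 𝔮) = 0
        · exact ⟨0, by simpa using h0, by simpa using h0'⟩
        · obtain ⟨y, hy1, hy2⟩ := Q.exists_embedding_eq_of_prime hl hψ hr (Q.prime_conjIdeal h𝔮) h0'
          exact ⟨Q.conj y, by simpa using hy2, by simpa using hy1⟩
      · exact Q.exists_embedding_eq_of_prime hl hψ hr h𝔮 h0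
    refine ⟨y * x, ?_, ?_⟩
    · rw [map_mul, hx1, hy1, embedding_mul]
    · rw [conjIdeal_mul, map_mul, hx2, hy2, map_mul, embedding_mul]

end QuadraticData

/-! ### Values at rational integers -/

theorem isCoprime_of_dvd_left {I J 𝔪 : Ideal (𝓞 K)} (h : I ∣ J) (hc : IsCoprime J 𝔪) :
    IsCoprime I 𝔪 := hc.of_isCoprime_of_dvd_left h

theorem isCoprime_span_natCast {a M : ℕ} (h : Nat.Coprime a M) {𝔪 : Ideal (𝓞 K)}
    (hM : (M : 𝓞 K) ∈ 𝔪) : IsCoprime (Ideal.span {(a : 𝓞 K)}) 𝔪 := by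
  have h1 : IsCoprime (a : ℤ) M := Nat.isCoprime_iff_coprime.mpr h
  obtain ⟨u, v, huv⟩ := h1
  have h2 : (u * a + v * M : 𝓞 K) = 1 := by exact_mod_cast congrArg (Int.cast : ℤ → 𝓞 K) huv
  refine isCoprime_span_iff.mpr ⟨u, ?_⟩
  have : (u * a - 1 : 𝓞 K) = -v * M := by linear_combination h2
  rw [this]
  exact Ideal.mul_mem_left _ _ hM

theorem embedding_natCast (σ : K →+* ℂ) (n : ℕ) : σ ((n : 𝓞 K) : K) = n := by simp

namespace QuadraticData

variable (Q : QuadraticData σ)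

theorem ext_coord {a b a' b' : ℤ} (h : (a + b * Q.ω : 𝓞 K) = a' + b' * Q.ω) : a = a' ∧ b = b' := by
  obtain ⟨h1, h2⟩ := Q.eq_zero (a - a') (b - b') (by push_cast; linear_combination h)
  exact ⟨by omega, by omega⟩

theorem coord_dvd {q a b : ℤ} (h : (a + b * Q.ω : 𝓞 K) ∈ Ideal.span {(q : 𝓞 K)}) :
    q ∣ a ∧ q ∣ b := by
  obtain ⟨y, hy⟩ := Ideal.mem_span_singleton'.mp h
  obtain ⟨c, d, rfl⟩ := Q.exists_repr y
  obtain ⟨h1, h2⟩ := Q.ext_coord (a := c * q) (b := d * q) (a' := a) (b' := b) (by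
    push_cast; rw [← hy]; ring)
  exact ⟨⟨c, by rw [← h1, mul_comm]⟩, ⟨d, by rw [← h2, mul_comm]⟩⟩

theorem s_eq (Q : QuadraticData σ) : ∃ t : ℤ, Q.s = -t + 2 * Q.ω := by
  obtain ⟨t, ht⟩ := Q.exists_trace Q.ω
  exact ⟨t, by rw [s, ← ht]; ring⟩

theorem exists_prime_dvd_natCast {q : ℕ} (hq : q.Prime) (Q : QuadraticData σ) :
    ∃ 𝔮 : Ideal (𝓞 K), Prime 𝔮 ∧ (q : 𝓞 K) ∈ 𝔮 := by
  have h1 : Ideal.span {(q : 𝓞 K)} ≠ ⊤ := by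
    intro h
    have := Q.absNorm_span_natCast q
    rw [h, Ideal.absNorm_top] at this
    exact hq.one_lt.ne (by nlinarith)
  obtain ⟨𝔮, hm, hle⟩ := Ideal.exists_le_maximal _ h1
  have hmem : (q : 𝓞 K) ∈ 𝔮 := hle (Ideal.mem_span_singleton_self _)
  refine ⟨𝔮, Ideal.prime_of_isPrime ?_ hm.isPrime, hmem⟩
  rintro rfl
  exact hq.ne_zero (by exact_mod_cast (Ideal.mem_bot.mp hmem))

/-- Since `x ^ 2 ≡ disc` mod `q`, the product `(x - s)(x + s)` lies in `𝔮`. If `𝔮 = (q)`, then `q`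
would divide the `ω`-coordinate `± 2` of one factor. -/
theorem exists_absNorm_eq_of_jacobiSym (Q : QuadraticData σ) {q : ℕ} (hq : q.Prime) (hq2 : 2 < q)
    (hJ : jacobiSym (discr K) q = 1) : ∃ 𝔮 : Ideal (𝓞 K), Ideal.absNorm 𝔮 = q := by
  obtain ⟨𝔮, h𝔮, hmem⟩ := Q.exists_prime_dvd_natCast hq
  rcases Q.exists_prime_and_absNorm_eq h𝔮 hq hmem with h | h
  · exact ⟨𝔮, h⟩
  exfalso
  have := Fact.mk hq
  obtain ⟨y, hy⟩ := ZMod.isSquare_of_jacobiSym_eq_one hJ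
  obtain ⟨x, rfl⟩ := ZMod.intCast_surjective y
  have h1 : (q : ℤ) ∣ x * x - discr K := by
    rw [← ZMod.intCast_zmod_eq_zero_iff_dvd]
    push_cast
    rw [hy, sub_self]
  obtain ⟨d, hd⟩ := h1
  have h2 : ((x - Q.s) * (x + Q.s) : 𝓞 K) ∈ 𝔮 := by
    have : ((x - Q.s) * (x + Q.s) : 𝓞 K) = d * q := by
      have h3 : ((x * x - discr K : ℤ) : 𝓞 K) = ((q * d : ℤ) : 𝓞 K) := by rw [hd]
      push_cast at h3
      rw [← Q.s_sq] at h3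
      linear_combination h3
    rw [this]
    exact Ideal.mul_mem_left _ _ hmem
  obtain ⟨t, ht⟩ := Q.s_eq
  have h2q : (q : ℤ) ∣ 2 := by
    rcases (Ideal.isPrime_of_prime h𝔮).mem_or_mem h2 with h3 | h3
    · have h4 : (((x + t : ℤ) : 𝓞 K) + ((-2 : ℤ) : 𝓞 K) * Q.ω) ∈ Ideal.span {((q : ℤ) : 𝓞 K)} := by
        have e : ((x + t : ℤ) : 𝓞 K) + ((-2 : ℤ) : 𝓞 K) * Q.ω = x - Q.s := by
          rw [ht]; push_cast; ring
        rw [e, Int.cast_natCast, ← h]; exact h3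
      exact (dvd_neg.mp (Q.coord_dvd h4).2)
    · have h4 : (((x - t : ℤ) : 𝓞 K) + ((2 : ℤ) : 𝓞 K) * Q.ω) ∈ Ideal.span {((q : ℤ) : 𝓞 K)} := by
        have e : ((x - t : ℤ) : 𝓞 K) + ((2 : ℤ) : 𝓞 K) * Q.ω = x + Q.s := by
          rw [ht]; push_cast; ring
        rw [e, Int.cast_natCast, ← h]; exact h3
      exact (Q.coord_dvd h4).2
  have := Int.le_of_dvd two_pos h2q
  omega

theorem apply_span_absNorm {𝔪 : Ideal (𝓞 K)} {l : ℕ} {ψ : Ideal (𝓞 K) →*₀ ℂ}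
    (hψ : IsHeckeCharacter σ 𝔪 l ψ) (he : Q.IsEquivariant ψ) {𝔮 : Ideal (𝓞 K)} (h0 : ψ 𝔮 ≠ 0) :
    ψ (Ideal.span {(Ideal.absNorm 𝔮 : 𝓞 K)}) = (Ideal.absNorm 𝔮 : ℂ) ^ l := by
  obtain ⟨x, hx1, hx2⟩ := he 𝔮
  rw [← Q.mul_conjIdeal, map_mul, hx2, Q.map_conj, ← hx1, Complex.mul_conj,
    Q.normSq_apply hψ h0]
  push_cast
  rfl

/-- By Dirichlet there is a prime `q ≡ a` modulo `4 M Δ`. It has the same symbol, so it is the norm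
of some `𝔮`, and equivariance gives `ψ (q) = ψ 𝔮 ψ 𝔮̄ = q ^ l`. The congruence carries this to `a`.
-/
theorem apply_span_of_jacobiSym_eq_one {𝔪 : Ideal (𝓞 K)} {l : ℕ} {ψ : Ideal (𝓞 K) →*₀ ℂ}
    (hψ : IsHeckeCharacter σ 𝔪 l ψ) (he : Q.IsEquivariant ψ) {M : ℕ} (hM0 : M ≠ 0)
    (hM : (M : 𝓞 K) ∈ 𝔪) {a : ℕ} (ha : Odd a) (haM : Nat.Coprime a M)
    (hJ : jacobiSym (discr K) a = 1) : ψ (Ideal.span {(a : 𝓞 K)}) = (a : ℂ) ^ l := by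
  set Δ := (discr K).natAbs with hΔ
  have hΔ0 : Δ ≠ 0 := Int.natAbs_ne_zero.mpr (discr_ne_zero K)
  have haΔ : Nat.Coprime a Δ := by
    by_contra h
    have : jacobiSym (discr K) a = 0 :=
      jacobiSym.eq_zero_iff.mpr ⟨ha.pos.ne', by
        rwa [Int.gcd_comm, Int.gcd_eq_natAbs, Int.natAbs_natCast]⟩
    rw [this] at hJ; exact zero_ne_one hJ
  have hP0 : M * (4 * Δ) ≠ 0 := by positivity
  have : NeZero (M * (4 * Δ)) := ⟨hP0⟩
  have hcop : Nat.Coprime a (M * (4 * Δ)) := haM.mul_right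
    (Nat.Coprime.mul_right (Nat.Coprime.pow_right 2 (Nat.coprime_two_right.mpr ha)) haΔ)
  obtain ⟨q, hq2, hq, hqa⟩ := Nat.forall_exists_prime_gt_and_eq_mod
    ((ZMod.isUnit_iff_coprime a (M * (4 * Δ))).mpr hcop) 2
  have hqa' : q ≡ a [MOD M * (4 * Δ)] := (ZMod.natCast_eq_natCast_iff _ _ _).mp hqa
  have hqodd : Odd q := hq.odd_of_ne_two (by omega)
  have hJq : jacobiSym (discr K) q = 1 := by
    rw [jacobiSym.mod_right _ hqodd, ← hΔ, ← hJ, jacobiSym.mod_right _ ha, ← hΔ,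
      (hqa'.of_mul_left M : q % (4 * Δ) = a % (4 * Δ))]
  obtain ⟨𝔮, h𝔮⟩ := Q.exists_absNorm_eq_of_jacobiSym hq hq2 hJq
  have hqM : Nat.Coprime q M := by
    have h1 : q ≡ a [MOD M] := hqa'.of_mul_right (4 * Δ)
    rw [Nat.Coprime, h1.gcd_eq]; exact haM
  have hqc : IsCoprime (Ideal.span {(q : 𝓞 K)}) 𝔪 := isCoprime_span_natCast hqM hM
  have h𝔮0 : ψ 𝔮 ≠ 0 := by
    refine hψ.apply_ne_zero (fun h => ?_) (isCoprime_of_dvd_left ?_ hqc)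
    · rw [h, Ideal.absNorm_bot] at h𝔮; omega
    · rw [← h𝔮, ← Q.mul_conjIdeal]; exact dvd_mul_right _ _
  have h1 := Q.apply_span_absNorm hψ he h𝔮0
  rw [h𝔮] at h1
  have h2 := hψ.congr (α := (q : 𝓞 K)) (β := (a : 𝓞 K)) (by exact_mod_cast hq.ne_zero)
    (by exact_mod_cast ha.pos.ne') hqc (by
      obtain ⟨d, hd⟩ := (Nat.modEq_iff_dvd.mp (hqa'.of_mul_right (4 * Δ)).symm)
      have h3 : ((q : ℤ) - a : 𝓞 K) = ((M * d : ℤ) : 𝓞 K) := by rw [← hd]; push_cast; ring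
      push_cast at h3
      rw [h3]
      exact Ideal.mul_mem_right _ _ hM)
  rw [h1, embedding_natCast, embedding_natCast] at h2
  have h3 : ((q : ℂ) ^ l) ≠ 0 := pow_ne_zero _ (by exact_mod_cast hq.ne_zero)
  exact mul_left_cancel₀ h3 (by rw [h2, mul_comm])

/-- With `n = 4 M ^ 2 Δ - 1`, the symbol `(Δ / n)` equals `((2M) ^ 2 Δ / n) = (1 / n) = 1`, while
`(-1 / n) = -1` because `n ≡ 3` mod `4`. -/
theorem jacobiSym_discr_sub_one (Q : QuadraticData σ) {M : ℕ} (hM0 : M ≠ 0) :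
    jacobiSym (discr K) (4 * M ^ 2 * (discr K).natAbs - 1) = -1 := by
  set Δ := (discr K).natAbs with hΔ
  have hd : discr K = -(Δ : ℤ) := by have := Q.discr_neg; omega
  have hΔ0 : Δ ≠ 0 := Int.natAbs_ne_zero.mpr (discr_ne_zero K)
  have hpos : 0 < M ^ 2 * Δ := by positivity
  obtain ⟨k, hk⟩ : ∃ k, 4 * M ^ 2 * Δ = 4 * k + 4 := ⟨M ^ 2 * Δ - 1, by rw [mul_assoc]; omega⟩
  have hn : 4 * M ^ 2 * Δ - 1 = 4 * k + 3 := by omega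
  rw [hn, hd]
  have hodd : Odd (4 * k + 3) := ⟨2 * k + 1, by ring⟩
  rw [jacobiSym.neg _ hodd, ZMod.χ₄_nat_three_mod_four (by omega)]
  have h1 : jacobiSym ((Δ : ℤ) * ((2 * M : ℕ) : ℤ) ^ 2) (4 * k + 3) = 1 := by
    have : ((Δ : ℤ) * ((2 * M : ℕ) : ℤ) ^ 2) = 4 * k + 4 := by
      have : ((4 * M ^ 2 * Δ : ℕ) : ℤ) = ((4 * k + 4 : ℕ) : ℤ) := by rw [hk]
      push_cast at this ⊢
      linear_combination this
    rw [this, jacobiSym.mod_left' (a₂ := 1), jacobiSym.one_left]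
    push_cast
    rw [show (4 * k + 4 : ℤ) = 1 + (4 * k + 3) by ring, Int.add_emod_right]
  have h2 : Int.gcd ((2 * M : ℕ) : ℤ) ((4 * k + 3 : ℕ) : ℤ) = 1 := by
    rw [Int.gcd_natCast_natCast]
    refine Nat.Coprime.symm ((Nat.coprime_mul_iff_right).mpr ⟨Nat.coprime_two_right.mpr hodd, ?_⟩)
    have : Nat.Coprime (4 * M ^ 2 * Δ - 1) M := by
      rw [Nat.Coprime, Nat.gcd_comm]
      have h3 : Nat.gcd M (4 * M ^ 2 * Δ - 1) ∣ 1 := by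
        have h4 := Nat.gcd_dvd_left M (4 * M ^ 2 * Δ - 1)
        have h5 := Nat.gcd_dvd_right M (4 * M ^ 2 * Δ - 1)
        have h6 : Nat.gcd M (4 * M ^ 2 * Δ - 1) ∣ 4 * M ^ 2 * Δ :=
          h4.trans ⟨4 * M * Δ, by ring⟩
        have h7 := Nat.dvd_sub h6 h5
        rwa [Nat.sub_sub_self (by omega)] at h7
      exact Nat.dvd_one.mp h3
    rwa [hn] at this
  rw [jacobiSym.mul_left, jacobiSym.pow_left, jacobiSym.sq_one h2, mul_one] at h1
  rw [h1]; norm_num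

/-- The value of a Hecke character with rational coefficients at a rational integer. -/
theorem apply_span_natCast {𝔪 : Ideal (𝓞 K)} {l : ℕ} {ψ : Ideal (𝓞 K) →*₀ ℂ}
    (hψ : IsHeckeCharacter σ 𝔪 l ψ) (he : Q.IsEquivariant ψ) {M : ℕ} (hM0 : M ≠ 0)
    (hM : (M : 𝓞 K) ∈ 𝔪) {a : ℕ} (ha : Odd a) (haM : Nat.Coprime a M)
    (haΔ : Nat.Coprime a (discr K).natAbs) :
    ψ (Ideal.span {(a : 𝓞 K)}) = ((jacobiSym (discr K) a : ℂ) * a) ^ l := by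
  have hg : Int.gcd (discr K) a = 1 := by
    rw [Int.gcd_comm, Int.gcd_eq_natAbs, Int.natAbs_natCast]; exact haΔ
  rcases jacobiSym.eq_one_or_neg_one hg with h | h
  · rw [Q.apply_span_of_jacobiSym_eq_one hψ he hM0 hM ha haM h, h]; simp
  -- This `n` has symbol `-1` and is `≡ -1` modulo `M`, so `ψ (n) = (-n) ^ l` is known; `a n` has
  -- symbol `1`, which reduces to the previous case.
  · set n := 4 * M ^ 2 * (discr K).natAbs - 1 with hn
    have hΔ0 : (discr K).natAbs ≠ 0 := Int.natAbs_ne_zero.mpr (discr_ne_zero K)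
    have hn1 : n + 1 = 4 * M ^ 2 * (discr K).natAbs := by
      have : 0 < M ^ 2 * (discr K).natAbs := by positivity
      rw [hn, mul_assoc]; omega
    have hJn : jacobiSym (discr K) n = -1 := Q.jacobiSym_discr_sub_one hM0
    have hnodd : Odd n := by
      rcases Nat.even_or_odd n with h2 | h2
      · exfalso
        obtain ⟨k, hk⟩ := h2
        have : n + 1 = 2 * (2 * M ^ 2 * (discr K).natAbs) := by rw [hn1]; ring
        omega
      · exact h2
    have hn0 : n ≠ 0 := hnodd.pos.ne'
    have hnM : Nat.Coprime n M := by
      refine Nat.Coprime.symm (Nat.Coprime.coprime_dvd_left ?_ (Nat.coprime_self_add_left.mpr ?_ :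
        Nat.Coprime (n + 1) n))
      · rw [hn1]; exact ⟨4 * M * (discr K).natAbs, by ring⟩
      · simp
    have hna := Q.apply_span_of_jacobiSym_eq_one hψ he hM0 hM (ha.mul hnodd)
      (Nat.Coprime.mul_left haM hnM) (by
        rw [jacobiSym.mul_right' _ ha.pos.ne' hn0, h, hJn]; norm_num)
    have h1 : ψ (Ideal.span {(n : 𝓞 K)}) = (-1) ^ l * (n : ℂ) ^ l := by
      have h2 := hψ.congr (α := (n : 𝓞 K)) (β := -1) (by exact_mod_cast hn0) (by simp)
        (isCoprime_span_natCast hnM hM) (by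
          have : (n : 𝓞 K) - -1 = (4 * M * (discr K).natAbs : ℕ) * (M : 𝓞 K) := by
            rw [sub_neg_eq_add]
            have h4 := congrArg (Nat.cast : ℕ → 𝓞 K) hn1
            push_cast at h4 ⊢
            rw [h4]; ring
          rw [this]
          exact Ideal.mul_mem_left _ _ hM)
      have h3 : ψ (Ideal.span {(-1 : 𝓞 K)}) = 1 := by
        rw [Ideal.span_singleton_neg, Ideal.span_singleton_one, ← Ideal.one_eq_top, map_one]
      rw [h3, embedding_natCast, one_mul] at h2
      have h4 : σ ((-1 : 𝓞 K) : K) = -1 := by simp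
      rw [h4] at h2
      have h5 : ((-1 : ℂ) ^ l) * (-1) ^ l = 1 := by rw [← mul_pow]; norm_num
      calc ψ (Ideal.span {(n : 𝓞 K)}) = ψ (Ideal.span {(n : 𝓞 K)}) * (-1) ^ l * (-1) ^ l := by
            rw [mul_assoc, h5, mul_one]
        _ = _ := by rw [h2, mul_comm]
    push_cast at hna
    rw [← Ideal.span_singleton_mul_span_singleton, map_mul, h1] at hna
    have h3 : ((n : ℂ) ^ l) ≠ 0 := pow_ne_zero _ (by exact_mod_cast hn0)
    have h5 : ((-1 : ℂ) ^ l) * (-1) ^ l = 1 := by rw [← mul_pow]; norm_num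
    rw [h]
    push_cast
    rw [mul_pow]
    apply mul_right_cancel₀ h3
    rw [mul_pow] at hna
    linear_combination (-1 : ℂ) ^ l * hna - ψ (Ideal.span {(a : 𝓞 K)}) * (n : ℂ) ^ l * h5

end QuadraticData

end CMHecke

namespace CMHecke

/-- Splitting of a natural number along a set of primes. -/
theorem exists_mul_eq_of_prime_predicate (P : ℕ → Prop) {n : ℕ} (hn : n ≠ 0) :
    ∃ a b : ℕ, a * b = n ∧ Nat.Coprime a b ∧ (∀ p, p.Prime → p ∣ a → P p) ∧
      ∀ p, p.Prime → p ∣ b → ¬ P p := by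
  classical
  set f : ℕ → ℕ := fun p => p ^ n.factorization p
  have key : ∀ (R : ℕ → Prop) [DecidablePred R] (p : ℕ), p.Prime →
      p ∣ ∏ q ∈ n.primeFactors.filter R, f q → R p := by
    intro R _ p hp hd
    obtain ⟨q, hq, hpq⟩ := (Prime.dvd_finsetProd_iff hp.prime f).mp hd
    rw [Finset.mem_filter] at hq
    have := (Nat.prime_dvd_prime_iff_eq hp (Nat.prime_of_mem_primeFactors hq.1)).mp
      (hp.dvd_of_dvd_pow hpq)
    rw [this]; exact hq.2
  refine ⟨∏ q ∈ n.primeFactors.filter P, f q, ∏ q ∈ n.primeFactors.filter (fun q => ¬ P q), f q,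
    ?_, ?_, key P, key _⟩
  · rw [Finset.prod_filter_mul_prod_filter_not]
    exact Nat.prod_factorization_pow_eq_self hn
  · refine Nat.Coprime.symm (Nat.coprime_of_dvd ?_)
    intro p hp h1 h2
    exact key _ p hp h1 (key _ p hp h2)

variable {K : Type*} [Field K] [NumberField K] {σ : K →+* ℂ}

/-! ### Elements of norm one modulo an integer -/

/-- An integral multiple of `z` by integers prime to each prime divisor of `A` lies in `I` only if
`z` does, given that `A` lies in `I`. -/
theorem mem_of_forall_prime {I : Ideal (𝓞 K)} {z : 𝓞 K} {A : ℕ} (hA : (A : 𝓞 K) ∈ I)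
    (h : ∀ p : ℕ, p.Prime → p ∣ A → ∃ m : ℕ, ¬ p ∣ m ∧ (m : 𝓞 K) * z ∈ I) : z ∈ I := by
  -- The integers `m` with `m z ∈ I` form an ideal `(g)`. Here `g` divides `A`, and no prime divisor
  -- of `A` divides `g`, so `g = ± 1`.
  let J : Ideal ℤ := (I.restrictScalars ℤ).comap (LinearMap.toSpanSingleton ℤ (𝓞 K) z)
  have hJ : ∀ m : ℤ, m ∈ J ↔ (m : 𝓞 K) * z ∈ I := by
    intro m
    simp [J, Submodule.mem_comap]
  obtain ⟨g, hg⟩ : ∃ g : ℤ, J = Ideal.span {g} := (IsPrincipalIdealRing.principal J).principal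
  have hgd : ∀ m : ℤ, g ∣ m ↔ (m : 𝓞 K) * z ∈ I := by
    intro m; rw [← hJ, hg, Ideal.mem_span_singleton]
  have hg1 : g.natAbs = 1 := by
    by_contra hne
    obtain ⟨p, hp, hpg⟩ := Nat.exists_prime_and_dvd hne
    have hgA : g ∣ (A : ℤ) := (hgd _).mpr (by
      rw [Int.cast_natCast]; exact Ideal.mul_mem_right _ _ hA)
    have hpA : p ∣ A := hpg.trans (by simpa using Int.natAbs_dvd_natAbs.mpr hgA)
    obtain ⟨m, hm1, hm2⟩ := h p hp hpA
    have : g ∣ (m : ℤ) := (hgd _).mpr (by rwa [Int.cast_natCast])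
    exact hm1 (hpg.trans (by simpa using Int.natAbs_dvd_natAbs.mpr this))
  have := (hgd 1).mp (by rw [← Int.natAbs_dvd, hg1]; simp)
  simpa using this

namespace QuadraticData

variable (Q : QuadraticData σ)

/-- Ideals stable under conjugation satisfy `𝔠 ^ 2 = (N 𝔠)`, so comparing the `p`-parts of their
norms decides divisibility at `p`. Here `m` is the prime-to-`p` part of `N 𝔠₁`, and `𝔠₁ ∣ m 𝔠₂`. -/
theorem exists_natCast_mul_mem {𝔠₁ 𝔠₂ : Ideal (𝓞 K)} (h₁ : Q.conjIdeal 𝔠₁ = 𝔠₁)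
    (h₂ : Q.conjIdeal 𝔠₂ = 𝔠₂) (h0 : 𝔠₁ ≠ ⊥) {z : 𝓞 K} (hz : z ∈ 𝔠₁ + 𝔠₂)
    {p : ℕ} (hp : p.Prime)
    (hle : (Ideal.absNorm 𝔠₁).factorization p ≤ (Ideal.absNorm 𝔠₂).factorization p) :
    ∃ m : ℕ, ¬ p ∣ m ∧ (m : 𝓞 K) * z ∈ 𝔠₁ := by
  set N₁ := Ideal.absNorm 𝔠₁ with hN₁
  set N₂ := Ideal.absNorm 𝔠₂ with hN₂
  have hN0 : N₁ ≠ 0 := fun h => h0 (Ideal.absNorm_eq_zero_iff.mp h)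
  set m := N₁ / p ^ N₁.factorization p with hm
  have hdvd : N₁ ∣ m * N₂ := by
    have e1 : p ^ N₁.factorization p * m = N₁ := Nat.ordProj_mul_ordCompl_eq_self N₁ p
    have e2 : p ^ N₁.factorization p ∣ N₂ :=
      (pow_dvd_pow p hle).trans (Nat.ordProj_dvd N₂ p)
    nth_rewrite 1 [← e1]
    rw [mul_comm]
    exact mul_dvd_mul_left m e2
  refine ⟨m, Nat.not_dvd_ordCompl hp hN0, ?_⟩
  have e1 : 𝔠₁ ^ 2 = Ideal.span {(N₁ : 𝓞 K)} := by
    rw [sq]; nth_rewrite 2 [← h₁]; exact Q.mul_conjIdeal 𝔠₁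
  have e2 : 𝔠₂ ^ 2 = Ideal.span {(N₂ : 𝓞 K)} := by
    rw [sq]; nth_rewrite 2 [← h₂]; exact Q.mul_conjIdeal 𝔠₂
  have e3 : 𝔠₁ ^ 2 ∣ (Ideal.span {(m : 𝓞 K)} * 𝔠₂) ^ 2 := by
    rw [mul_pow, e1, e2, sq, mul_assoc, Ideal.span_singleton_mul_span_singleton, ← Nat.cast_mul]
    refine Dvd.dvd.mul_left ?_ _
    rw [Ideal.dvd_iff_le, Ideal.span_singleton_le_span_singleton]
    exact Nat.cast_dvd_cast hdvd
  have e4 := (UniqueFactorizationMonoid.pow_dvd_pow_iff_dvd two_ne_zero).mp e3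
  rw [Ideal.dvd_iff_le] at e4
  rw [Ideal.add_eq_sup, Submodule.mem_sup] at hz
  obtain ⟨u, hu, v, hv, rfl⟩ := hz
  rw [mul_add]
  exact add_mem (Ideal.mul_mem_left _ _ hu)
    (e4 (Ideal.mul_mem_mul (Ideal.mem_span_singleton_self _) hv))

theorem conjIdeal_span_natCast (n : ℕ) :
    Q.conjIdeal (Ideal.span {(n : 𝓞 K)}) = Ideal.span {(n : 𝓞 K)} := by simp

/-- The congruence puts `β` in `(β̄, M)`, and conjugation gives the reverse inclusion. -/
theorem conjIdeal_add_span {α β : 𝓞 K} {M : ℕ}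
    (h : α * Q.conj β - β ∈ Ideal.span {(M : 𝓞 K)}) :
    Q.conjIdeal (Ideal.span {β} + Ideal.span {(M : 𝓞 K)}) =
      Ideal.span {β} + Ideal.span {(M : 𝓞 K)} := by
  set 𝔠 := Ideal.span {β} + Ideal.span {(M : 𝓞 K)} with h𝔠
  have hle : 𝔠 ≤ Q.conjIdeal 𝔠 := by
    rw [h𝔠, conjIdeal_add, conjIdeal_span, conjIdeal_span_natCast]
    refine sup_le ?_ le_sup_right
    rw [Ideal.span_singleton_le_iff_mem]
    have h1 : α * Q.conj β - (α * Q.conj β - β) ∈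
        Ideal.span {Q.conj β} + Ideal.span {(M : 𝓞 K)} := sub_mem (Ideal.mem_sup_left (Ideal.mul_mem_left _ _ (Ideal.mem_span_singleton_self _)))
      (Ideal.mem_sup_right h)
    rwa [sub_sub_cancel] at h1
  refine le_antisymm ?_ hle
  have := Ideal.map_mono (f := Q.conj) hle
  exact this.trans (Q.conjIdeal_conjIdeal 𝔠).le

/-- Hilbert 90 modulo an integer: an element of norm `≡ 1` is `≡ β / β̄`, and the part of `β` that is
not prime to the modulus divides the discriminant. -/
theorem exists_mul_conj_sub_mem {α : 𝓞 K} {M : ℕ} (hM : M ≠ 0)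
    (hN : α * Q.conj α - 1 ∈ Ideal.span {(M : 𝓞 K)}) :
    ∃ β : 𝓞 K, α * Q.conj β - β ∈ Ideal.span {(M : 𝓞 K)} ∧
      (discr K : 𝓞 K) ∈ Ideal.span {β} + Ideal.span {(M : 𝓞 K)} := by
  have hβ : ∀ γ : 𝓞 K, α * Q.conj (γ + α * Q.conj γ) - (γ + α * Q.conj γ) ∈
      Ideal.span {(M : 𝓞 K)} := by
    intro γ
    have : α * Q.conj (γ + α * Q.conj γ) - (γ + α * Q.conj γ) = γ * (α * Q.conj α - 1) := by
      simp; ring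
    rw [this]
    exact Ideal.mul_mem_left _ _ hN
  -- Two Hilbert 90 candidates `γ + α γ̄`, for `γ = 1` and `γ = ω`. Neither need be good at every
  -- prime, but jointly they generate `s = β₂ - ω̄ β₁`.
  set β₁ := 1 + α * Q.conj 1 with hβ₁
  set β₂ := Q.ω + α * Q.conj Q.ω with hβ₂
  set 𝔠₁ := Ideal.span {β₁} + Ideal.span {(M : 𝓞 K)} with h𝔠₁
  set 𝔠₂ := Ideal.span {β₂} + Ideal.span {(M : 𝓞 K)} with h𝔠₂
  have hc₁ : Q.conjIdeal 𝔠₁ = 𝔠₁ := Q.conjIdeal_add_span (hβ 1)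
  have hc₂ : Q.conjIdeal 𝔠₂ = 𝔠₂ := Q.conjIdeal_add_span (hβ Q.ω)
  have hM0 : (M : 𝓞 K) ≠ 0 := by exact_mod_cast hM
  have hne : ∀ I : Ideal (𝓞 K), I + Ideal.span {(M : 𝓞 K)} ≠ ⊥ := by
    intro I h
    have : (M : 𝓞 K) ∈ I + Ideal.span {(M : 𝓞 K)} :=
      Ideal.mem_sup_right (Ideal.mem_span_singleton_self _)
    rw [h] at this
    exact hM0 (Ideal.mem_bot.mp this)
  have hs : Q.s ∈ 𝔠₁ + 𝔠₂ := by
    have : Q.s = -Q.conj Q.ω * β₁ + β₂ := by rw [hβ₁, hβ₂, s, map_one]; ring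
    rw [this]
    exact add_mem (Ideal.mem_sup_left (Ideal.mem_sup_left (Ideal.mul_mem_left _ _
      (Ideal.mem_span_singleton_self _)))) (Ideal.mem_sup_right (Ideal.mem_sup_left
      (Ideal.mem_span_singleton_self _)))
  -- Split `M = A B` so that `s` lies `p`-locally in `𝔠₁` for `p ∣ A` and in `𝔠₂` for `p ∣ B`. The
  -- combination `B β₁ + A β₂` is a unit multiple of `β₁` modulo `A` and of `β₂` modulo `B`.
  obtain ⟨A, B, hAB, hcop, hA, hB⟩ := exists_mul_eq_of_prime_predicate
    (fun p => (Ideal.absNorm 𝔠₁).factorization p ≤ (Ideal.absNorm 𝔠₂).factorization p) hM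
  obtain ⟨u, v, huv⟩ := Nat.isCoprime_iff_coprime.mpr hcop
  have huv' : (u * A + v * B : 𝓞 K) = 1 := by exact_mod_cast congrArg (Int.cast : ℤ → 𝓞 K) huv
  have hABc : (A : 𝓞 K) * B = M := by exact_mod_cast congrArg (Nat.cast : ℕ → 𝓞 K) hAB
  set β := B * β₁ + A * β₂ with hβdef
  have hsA : Q.s ∈ Ideal.span {β} + Ideal.span {(A : 𝓞 K)} := by
    have hmA : (A : 𝓞 K) ∈ Ideal.span {β} + Ideal.span {(A : 𝓞 K)} :=
      Ideal.mem_sup_right (Ideal.mem_span_singleton_self _)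
    have hle : 𝔠₁ ≤ Ideal.span {β} + Ideal.span {(A : 𝓞 K)} := by
      refine sup_le ?_ ?_
      · rw [Ideal.span_singleton_le_iff_mem]
        have : β₁ = v * β + (u * β₁ - v * β₂) * A := by
          rw [hβdef]; linear_combination -β₁ * huv'
        rw [this]
        exact add_mem (Ideal.mem_sup_left (Ideal.mul_mem_left _ _ (Ideal.mem_span_singleton_self _)))
          (Ideal.mul_mem_left _ _ hmA)
      · rw [Ideal.span_singleton_le_iff_mem, ← hABc]
        exact Ideal.mul_mem_right _ _ hmA
    refine mem_of_forall_prime hmA fun p hp hpA => ?_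
    obtain ⟨m, hm1, hm2⟩ := Q.exists_natCast_mul_mem hc₁ hc₂ (hne _) hs hp (hA p hp hpA)
    exact ⟨m, hm1, hle hm2⟩
  have hsB : Q.s ∈ Ideal.span {β} + Ideal.span {(B : 𝓞 K)} := by
    have hmB : (B : 𝓞 K) ∈ Ideal.span {β} + Ideal.span {(B : 𝓞 K)} :=
      Ideal.mem_sup_right (Ideal.mem_span_singleton_self _)
    have hle : 𝔠₂ ≤ Ideal.span {β} + Ideal.span {(B : 𝓞 K)} := by
      refine sup_le ?_ ?_
      · rw [Ideal.span_singleton_le_iff_mem]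
        have : β₂ = u * β + (v * β₂ - u * β₁) * B := by
          rw [hβdef]; linear_combination -β₂ * huv'
        rw [this]
        exact add_mem (Ideal.mem_sup_left (Ideal.mul_mem_left _ _ (Ideal.mem_span_singleton_self _)))
          (Ideal.mul_mem_left _ _ hmB)
      · rw [Ideal.span_singleton_le_iff_mem, ← hABc]
        exact Ideal.mul_mem_left _ _ hmB
    refine mem_of_forall_prime hmB fun p hp hpB => ?_
    obtain ⟨m, hm1, hm2⟩ := Q.exists_natCast_mul_mem hc₂ hc₁ (hne _)
      (by rw [add_comm]; exact hs) hp (le_of_not_ge (hB p hp hpB))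
    exact ⟨m, hm1, hle hm2⟩
  refine ⟨β, ?_, ?_⟩
  · have : β = (B + A * Q.ω) + α * Q.conj (B + A * Q.ω) := by
      rw [hβdef, hβ₁, hβ₂]; simp; ring
    rw [this]; exact hβ _
  -- Multiply the memberships of `s` modulo `A` and modulo `B`; the product `s ^ 2` is the
  -- discriminant.
  · rw [Ideal.add_eq_sup, Submodule.mem_sup] at hsA hsB ⊢
    obtain ⟨x, hx, y, hy, hxy⟩ := hsA
    obtain ⟨x', hx', y', hy', hxy'⟩ := hsB
    refine ⟨x * Q.s + y * x', add_mem (Ideal.mul_mem_right _ _ hx) (Ideal.mul_mem_left _ _ hx'),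
      y * y', ?_, ?_⟩
    · rw [← hABc, ← Ideal.span_singleton_mul_span_singleton]
      exact Ideal.mul_mem_mul hy hy'
    · rw [← Q.s_sq, sq]
      nth_rewrite 2 [← hxy]
      rw [add_mul, ← hxy']; ring

theorem not_isCoprime_bot_span {M : ℕ} (hM : 2 ≤ M) (Q : QuadraticData σ) :
    ¬ IsCoprime (⊥ : Ideal (𝓞 K)) (Ideal.span {(M : 𝓞 K)}) := by
  intro h
  rw [Ideal.isCoprime_iff_sup_eq, bot_sup_eq] at h
  have := Q.absNorm_span_natCast M
  rw [h, Ideal.absNorm_top] at this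
  nlinarith

/-- The values of Hecke characters with rational coefficients on an element of norm `≡ 1` are
given by an ideal that depends on the element only. -/
theorem exists_conjIdeal_eq_and_forall {M : ℕ} (hM : 2 ≤ M) {α : 𝓞 K} (hα : α ≠ 0)
    (hN : α * Q.conj α - 1 ∈ Ideal.span {((M ^ 2 * (discr K).natAbs : ℕ) : 𝓞 K)}) :
    ∃ 𝔠 : Ideal (𝓞 K), 𝔠 ≠ ⊥ ∧ Q.conjIdeal 𝔠 = 𝔠 ∧
      ∀ (𝔪 : Ideal (𝓞 K)) (l : ℕ) (ψ : Ideal (𝓞 K) →*₀ ℂ), IsHeckeCharacter σ 𝔪 l ψ →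
        (M : 𝓞 K) ∈ 𝔪 → Q.IsEquivariant ψ → ∃ y : 𝓞 K, Ideal.span {y} = 𝔠 ^ l ∧
          ψ (Ideal.span {α}) * σ (y : K) = σ (α : K) ^ l * σ (Q.conj y : K) := by
  set Δ := (discr K).natAbs with hΔ
  have hΔ0 : Δ ≠ 0 := Int.natAbs_ne_zero.mpr (discr_ne_zero K)
  set M' := M ^ 2 * Δ with hM'
  have hM'0 : M' ≠ 0 := by positivity
  have hMK : (M : 𝓞 K) ≠ 0 := by exact_mod_cast (by omega : M ≠ 0)
  have hM'K : (M' : 𝓞 K) ≠ 0 := by exact_mod_cast hM'0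
  obtain ⟨β, hβ1, hβ2⟩ := Q.exists_mul_conj_sub_mem hM'0 hN
  set 𝔠 := Ideal.span {β} + Ideal.span {(M' : 𝓞 K)} with h𝔠
  have hcc : Q.conjIdeal 𝔠 = 𝔠 := Q.conjIdeal_add_span hβ1
  have hc0 : 𝔠 ≠ ⊥ := by
    intro h
    have : (M' : 𝓞 K) ∈ 𝔠 := Ideal.mem_sup_right (Ideal.mem_span_singleton_self _)
    rw [h] at this
    exact hM'K (Ideal.mem_bot.mp this)
  obtain ⟨𝔟, h𝔟⟩ : 𝔠 ∣ Ideal.span {β} := Ideal.dvd_iff_le.mpr le_sup_left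
  obtain ⟨𝔫, h𝔫⟩ : 𝔠 ∣ Ideal.span {(M' : 𝓞 K)} := Ideal.dvd_iff_le.mpr le_sup_right
  -- As `𝔠` divides `Δ`, the quotient of `(M ^ 2 Δ)` by `𝔠` is still divisible by `M`, so `𝔟 = (β) /
  -- 𝔠` is prime to `M`.
  obtain ⟨𝔯, h𝔯⟩ : 𝔠 ∣ Ideal.span {(Δ : 𝓞 K)} := by
    rw [Ideal.dvd_iff_le, Ideal.span_singleton_le_iff_mem]
    have : (Δ : 𝓞 K) = ((Δ : ℤ) : 𝓞 K) := by simp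
    rw [this, hΔ, Int.natCast_natAbs]
    rcases abs_choice (discr K) with h | h
    · rwa [h]
    · rw [h, Int.cast_neg]; exact neg_mem hβ2
  have hM'eq : Ideal.span {(M' : 𝓞 K)} =
      Ideal.span {(M : 𝓞 K)} * (Ideal.span {(M : 𝓞 K)} * Ideal.span {(Δ : 𝓞 K)}) := by
    rw [Ideal.span_singleton_mul_span_singleton, Ideal.span_singleton_mul_span_singleton, hM']
    push_cast; ring_nf
  have h𝔫' : 𝔫 = Ideal.span {(M : 𝓞 K)} * (Ideal.span {(M : 𝓞 K)} * 𝔯) := by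
    apply mul_left_cancel₀ hc0
    rw [← h𝔫, hM'eq, h𝔯]; ring
  have hcop : IsCoprime 𝔟 (Ideal.span {(M : 𝓞 K)}) := by
    have h1 : IsCoprime 𝔟 𝔫 := by
      rw [Ideal.isCoprime_iff_add]
      apply mul_left_cancel₀ hc0
      rw [mul_add, ← h𝔟, ← h𝔫, mul_one]
    rw [h𝔫'] at h1
    exact IsCoprime.of_mul_right_left h1
  have h𝔟0 : 𝔟 ≠ ⊥ := fun h => Q.not_isCoprime_bot_span hM (h ▸ hcop)
  have hβ0 : β ≠ 0 := by
    intro h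
    rw [h, Ideal.span_singleton_zero] at h𝔟
    exact mul_ne_zero hc0 h𝔟0 h𝔟.symm
  have hMbot := span_ne_bot hMK
  -- auxiliary ideals that make everything principal
  obtain ⟨𝔤, δ, hδ, h𝔤⟩ := exists_isCoprime_mul_eq_span hc0 hMbot
  have h𝔤0 : 𝔤 ≠ ⊥ := fun h => Q.not_isCoprime_bot_span hM (h ▸ h𝔤)
  obtain ⟨𝔤', η, hη, h𝔤'⟩ := exists_isCoprime_mul_eq_span h𝔤0 hMbot
  have h𝔤'0 : 𝔤' ≠ ⊥ := fun h => Q.not_isCoprime_bot_span hM (h ▸ h𝔤')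
  have hδ0 : δ ≠ 0 := by
    rintro rfl
    rw [Ideal.span_singleton_zero] at hδ
    exact mul_ne_zero hc0 h𝔤0 hδ
  have hη0 : η ≠ 0 := by
    rintro rfl
    rw [Ideal.span_singleton_zero] at hη
    exact mul_ne_zero h𝔤0 h𝔤'0 hη
  have h𝔟' : Ideal.span {Q.conj β} = 𝔠 * Q.conjIdeal 𝔟 := by
    rw [← conjIdeal_span, h𝔟, conjIdeal_mul, hcc]
  have hcop' : IsCoprime (Q.conjIdeal 𝔟) (Ideal.span {(M : 𝓞 K)}) := by
    rw [← Q.conjIdeal_span_natCast M, isCoprime_conjIdeal]; exact hcop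
  -- `β` and `β̄` need not be prime to `M`. They are replaced by `β₁ = β η / δ` and `β₂ = β̄ η / δ`,
  -- which generate `𝔟 𝔤'` and `𝔟̄ 𝔤'` and satisfy `α β₂ ≡ β₁` mod `M`.
  obtain ⟨β₁, hβ₁, he₁⟩ := exists_eq_span_of_span_mul_eq (x := δ) (y := β * η) (I := 𝔟 * 𝔤') hδ0 (by
    rw [← Ideal.span_singleton_mul_span_singleton, h𝔟, ← hδ, ← hη]; ring)
  obtain ⟨β₂, hβ₂, he₂⟩ := exists_eq_span_of_span_mul_eq (x := δ) (y := Q.conj β * η)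
    (I := Q.conjIdeal 𝔟 * 𝔤') hδ0 (by
      rw [← Ideal.span_singleton_mul_span_singleton, h𝔟', ← hδ, ← hη]; ring)
  have hmod : α * β₂ - β₁ ∈ Ideal.span {(M : 𝓞 K)} := by
    rw [← Ideal.span_singleton_le_iff_mem, ← Ideal.dvd_iff_le]
    apply (mul_dvd_mul_iff_left (span_ne_bot hδ0)).mp
    have e1 : δ * (α * β₂ - β₁) = η * (α * Q.conj β - β) := by
      linear_combination he₁ - α * he₂
    rw [Ideal.span_singleton_mul_span_singleton δ (α * β₂ - β₁), e1,
      ← Ideal.span_singleton_mul_span_singleton η]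
    have e2 : Ideal.span {(M' : 𝓞 K)} ∣ Ideal.span {α * Q.conj β - β} := by
      rw [Ideal.dvd_iff_le, Ideal.span_singleton_le_iff_mem]; exact hβ1
    obtain ⟨𝔨, h𝔨⟩ := e2
    rw [h𝔨, h𝔫, h𝔫', ← hη, ← hδ]
    exact ⟨𝔤' * (Ideal.span {(M : 𝓞 K)} * 𝔯) * 𝔨, by ring⟩
  have hβ₁0 : β₁ ≠ 0 := by
    rintro rfl
    rw [mul_zero] at he₁
    exact mul_ne_zero hβ0 hη0 he₁
  have hβ₂0 : β₂ ≠ 0 := by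
    rintro rfl
    rw [Ideal.span_singleton_zero] at hβ₂
    exact mul_ne_zero (fun h => h𝔟0 (Q.conjIdeal_eq_bot.mp h)) h𝔤'0 hβ₂
  have hαM : IsCoprime (Ideal.span {α}) (Ideal.span {(M : 𝓞 K)}) := by
    refine isCoprime_span_iff.mpr ⟨Q.conj α, ?_⟩
    rw [mul_comm]
    have : Ideal.span {(M' : 𝓞 K)} ≤ Ideal.span {(M : 𝓞 K)} := by
      rw [hM'eq]; exact Ideal.mul_le_left
    exact this hN
  refine ⟨𝔠, hc0, hcc, fun 𝔪 l ψ hψ hm he => ?_⟩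
  have hle : Ideal.span {(M : 𝓞 K)} ≤ 𝔪 := (Ideal.span_singleton_le_iff_mem _).mpr hm
  have hto : ∀ {I : Ideal (𝓞 K)}, IsCoprime I (Ideal.span {(M : 𝓞 K)}) → IsCoprime I 𝔪 :=
    fun h => h.of_isCoprime_of_dvd_right (Ideal.dvd_iff_le.mpr hle)
  have hψ𝔟 := hψ.apply_ne_zero h𝔟0 (hto hcop)
  have hψ𝔤' := hψ.apply_ne_zero h𝔤'0 (hto h𝔤')
  obtain ⟨x, hx1, hx2⟩ := he 𝔟
  have hx0 : x ≠ 0 := by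
    rintro rfl
    rw [hx1] at hψ𝔟; simp at hψ𝔟
  -- As `x = ψ 𝔟` generates `𝔟 ^ l`, the quotient `y = β ^ l / x` generates `𝔠 ^ l`, which does not
  -- involve `ψ`.
  obtain ⟨y, hy, hxy⟩ := exists_eq_span_of_span_mul_eq (x := x) (y := β ^ l) (I := 𝔠 ^ l) hx0 (by
    rw [hψ.span_eq_pow hψ𝔟 hx1, ← Ideal.span_singleton_pow, h𝔟, mul_pow, mul_comm])
  refine ⟨y, hy.symm, ?_⟩
  have hcong := hψ.congr (mul_ne_zero hα hβ₂0) hβ₁0 (by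
    rw [← Ideal.span_singleton_mul_span_singleton, ← hβ₂]
    exact (hto hαM).mul_left ((hto hcop').mul_left (hto h𝔤'))) (hle hmod)
  rw [← Ideal.span_singleton_mul_span_singleton, map_mul, ← hβ₂, ← hβ₁, map_mul, map_mul, hx1,
    hx2, embedding_mul] at hcong
  have c1 : ψ (Ideal.span {α}) * σ (Q.conj x : K) * σ (β₁ : K) ^ l =
      σ (x : K) * (σ (α : K) * σ (β₂ : K)) ^ l := by
    apply mul_left_cancel₀ hψ𝔤'
    linear_combination hcong
  have d1 : σ (β : K) ^ l * σ (η : K) ^ l = σ (δ : K) ^ l * σ (β₁ : K) ^ l := by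
    rw [← mul_pow, ← mul_pow, ← embedding_mul, ← embedding_mul, he₁]
  have d2 : σ (Q.conj β : K) ^ l * σ (η : K) ^ l = σ (δ : K) ^ l * σ (β₂ : K) ^ l := by
    rw [← mul_pow, ← mul_pow, ← embedding_mul, ← embedding_mul, he₂]
  have d3 : σ (β : K) ^ l = σ (x : K) * σ (y : K) := by
    rw [← embedding_pow, hxy, embedding_mul]
  have d4 : σ (Q.conj β : K) ^ l = σ (Q.conj x : K) * σ (Q.conj y : K) := by
    rw [← embedding_pow, ← map_pow, hxy, map_mul, embedding_mul]
  have hxc : σ (Q.conj x : K) ≠ 0 := embedding_ne_zero σ (by simpa using hx0)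
  apply mul_left_cancel₀ (embedding_ne_zero σ hx0)
  apply mul_left_cancel₀ hxc
  apply mul_left_cancel₀ (pow_ne_zero l (embedding_ne_zero σ hη0))
  rw [mul_pow] at c1
  rw [d3] at d1
  rw [d4] at d2
  linear_combination σ (δ : K) ^ l * c1 + ψ (Ideal.span {α}) * σ (Q.conj x : K) * d1 -
    σ (x : K) * σ (α : K) ^ l * d2

end QuadraticData

end CMHecke

namespace CMHecke

variable {K : Type*} [Field K] [NumberField K] {σ : K →+* ℂ}

namespace QuadraticData

variable (Q : QuadraticData σ)

/-! ### Characters that factor through the norm -/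

theorem coprime_absNorm (Q : QuadraticData σ) {n : ℕ} {𝔞 : Ideal (𝓞 K)}
    (h : IsCoprime 𝔞 (Ideal.span {(n : 𝓞 K)})) : Nat.Coprime (Ideal.absNorm 𝔞) n := by
  have h1 : IsCoprime (Q.conjIdeal 𝔞) (Ideal.span {(n : 𝓞 K)}) := by
    rw [← Q.conjIdeal_span_natCast n, isCoprime_conjIdeal]; exact h
  have h2 := h.mul_left h1
  rw [Q.mul_conjIdeal] at h2
  have hpos := h2
  by_contra hne
  obtain ⟨p, hp, hp1, hp2⟩ := Nat.Prime.not_coprime_iff_dvd.mp hne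
  have h3 : Ideal.span {(p : 𝓞 K)} = ⊤ := by
    rw [Ideal.isCoprime_iff_add, Ideal.one_eq_top] at h2
    rw [eq_top_iff, ← h2]
    refine sup_le ?_ ?_ <;> rw [Ideal.span_singleton_le_span_singleton]
    · exact Nat.cast_dvd_cast hp1
    · exact Nat.cast_dvd_cast hp2
  have h4 := Q.absNorm_span_natCast p
  rw [h3, Ideal.absNorm_top] at h4
  have := hp.one_lt
  nlinarith

theorem sub_one_mem_of_natCast_eq {n : ℕ} {α : 𝓞 K}
    (h : ((Ideal.absNorm (Ideal.span {α}) : ℕ) : ZMod n) = 1) :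
    α * Q.conj α - 1 ∈ Ideal.span {(n : 𝓞 K)} := by
  rw [Q.mul_conj_eq_absNorm]
  have h1 : ((Ideal.absNorm (Ideal.span {α}) : ℕ) : ZMod n) = ((1 : ℕ) : ZMod n) := by
    rw [h]; simp
  obtain ⟨d, hd⟩ := Nat.modEq_iff_dvd.mp ((ZMod.natCast_eq_natCast_iff _ _ _).mp h1).symm
  have h3 : ((Ideal.absNorm (Ideal.span {α}) : 𝓞 K) - 1) = ((n * d : ℤ) : 𝓞 K) := by
    rw [← hd]; push_cast; ring
  rw [h3]
  push_cast
  exact Ideal.mul_mem_right _ _ (Ideal.mem_span_singleton_self _)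

/-- The norms of elements with `e = 1`, together with the squares, form a subgroup `W` of `(ℤ/n)ˣ`
whose quotient has exponent dividing two. If `e α₀ = -1`, the norm of `α₀` lies outside `W`, and a
character of the quotient that is nontrivial there is the required `φ`. -/
theorem exists_dirichletCharacter {n : ℕ} [NeZero n] (e : 𝓞 K → ℂ)
    (hmul : ∀ α β : 𝓞 K, IsCoprime (Ideal.span {α}) (Ideal.span {(n : 𝓞 K)}) →
      IsCoprime (Ideal.span {β}) (Ideal.span {(n : 𝓞 K)}) → e (α * β) = e α * e β)
    (hsign : ∀ α : 𝓞 K, IsCoprime (Ideal.span {α}) (Ideal.span {(n : 𝓞 K)}) → e α = 1 ∨ e α = -1)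
    (hnat : ∀ a : ℕ, Nat.Coprime a n → e a = 1)
    (hone : ∀ α : 𝓞 K, α * Q.conj α - 1 ∈ Ideal.span {(n : 𝓞 K)} → e α = 1) :
    ∃ φ : DirichletCharacter ℂ n, φ ^ 2 = 1 ∧ ∀ α : 𝓞 K,
      IsCoprime (Ideal.span {α}) (Ideal.span {(n : 𝓞 K)}) →
        e α = φ (Ideal.absNorm (Ideal.span {α}) : ZMod n) := by
  classical
  set good : 𝓞 K → Prop := fun α => IsCoprime (Ideal.span {α}) (Ideal.span {(n : 𝓞 K)}) with hgood
  set N : 𝓞 K → ℕ := fun α => Ideal.absNorm (Ideal.span {α}) with hNdef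
  have hNmul : ∀ α β, N (α * β) = N α * N β := by
    intro α β
    simp only [hNdef]
    rw [← Ideal.span_singleton_mul_span_singleton, map_mul]
  have hNnat : ∀ a : ℕ, N (a : 𝓞 K) = a ^ 2 := fun a => Q.absNorm_span_natCast a
  have gmul : ∀ {α β}, good α → good β → good (α * β) := by
    intro α β h1 h2
    simp only [hgood] at h1 h2 ⊢
    rw [← Ideal.span_singleton_mul_span_singleton]
    exact h1.mul_left h2
  have gnat : ∀ {a : ℕ}, Nat.Coprime a n → good a := fun h =>
    isCoprime_span_natCast h (Ideal.mem_span_singleton_self _)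
  have hcopN : ∀ {α}, good α → Nat.Coprime (N α) n := fun h => Q.coprime_absNorm h
  by_cases hall : ∀ α, good α → e α = 1
  · refine ⟨1, one_pow 2, fun α hα => ?_⟩
    rw [hall α hα, MulChar.one_apply]
    exact (ZMod.isUnit_iff_coprime _ _).mpr (hcopN hα)
  push Not at hall
  obtain ⟨α₀, hα₀, hne⟩ := hall
  have he₀ : e α₀ = -1 := (hsign α₀ hα₀).resolve_left hne
  let W : Subgroup (ZMod n)ˣ :=
    { carrier := {w | ∃ (a : ℕ) (α : 𝓞 K), Nat.Coprime a n ∧ good α ∧ e α = 1 ∧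
        (w : ZMod n) = (a : ZMod n) ^ 2 * (N α : ZMod n)}
      mul_mem' := by
        rintro w w' ⟨a, α, h1, h2, h3, h4⟩ ⟨a', α', h1', h2', h3', h4'⟩
        refine ⟨a * a', α * α', h1.mul_left h1', gmul h2 h2', ?_, ?_⟩
        · rw [hmul _ _ h2 h2', h3, h3', one_mul]
        · rw [Units.val_mul, h4, h4', hNmul]; push_cast; ring
      one_mem' := ⟨1, 1, Nat.coprime_one_left n, by
        simpa using gnat (Nat.coprime_one_left n), by
        simpa using hnat 1 (Nat.coprime_one_left n), by simp [hNdef]⟩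
      -- Use `w⁻¹ = (w⁻¹) ^ 2 w`, which only changes the integer `a`.
      inv_mem' := by
        rintro w ⟨a, α, h1, h2, h3, h4⟩
        refine ⟨((w⁻¹ : (ZMod n)ˣ) : ZMod n).val * a, α,
          (ZMod.val_coe_unit_coprime w⁻¹).mul_left h1, h2, h3, ?_⟩
        push_cast
        rw [ZMod.natCast_zmod_val, mul_pow, mul_assoc, ← h4, sq, mul_assoc, Units.inv_mul, mul_one] }
  have hWsq : ∀ u : (ZMod n)ˣ, u ^ 2 ∈ W := fun u =>
    ⟨(u : ZMod n).val, 1, ZMod.val_coe_unit_coprime u, by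
      simpa using gnat (Nat.coprime_one_left n), by
      simpa using hnat 1 (Nat.coprime_one_left n), by simp [hNdef]⟩
  let U : ∀ α, good α → (ZMod n)ˣ := fun α h => ZMod.unitOfCoprime (N α) (hcopN h)
  have hU : ∀ α (h : good α), ((U α h : (ZMod n)ˣ) : ZMod n) = N α := fun α h =>
    ZMod.coe_unitOfCoprime _ _
  have hUW : ∀ α (h : good α), e α = 1 → U α h ∈ W := fun α h h1 =>
    ⟨1, α, Nat.coprime_one_left n, h, h1, by rw [hU α h]; simp⟩
  -- If `N α₀ = a ^ 2 N α` with `e α = 1`, let `b` invert `N (a α)` modulo `n`. Then `α₀ (a α) b`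
  -- has norm `≡ 1` but sign `-1`.
  have hv : U α₀ hα₀ ∉ W := by
    rintro ⟨a, α, h1, h2, h3, h4⟩
    rw [hU α₀ hα₀] at h4
    have hg : good (a * α) := gmul (gnat h1) h2
    set b : ℕ := (((U (a * α) hg)⁻¹ : (ZMod n)ˣ) : ZMod n).val with hb
    have hbn : Nat.Coprime b n := ZMod.val_coe_unit_coprime _
    have hb1 : (b : ZMod n) * (N (a * α) : ZMod n) = 1 := by
      rw [hb, ZMod.natCast_zmod_val, ← hU _ hg, Units.inv_mul]
    have h5 : e (α₀ * (a * α) * b) = 1 := by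
      apply hone
      apply Q.sub_one_mem_of_natCast_eq
      change ((N (α₀ * (a * α) * b) : ℕ) : ZMod n) = 1
      rw [hNmul, hNmul, hNnat]
      push_cast
      have : (N α₀ : ZMod n) = (N (a * α) : ZMod n) := by
        rw [h4, hNmul, hNnat]; push_cast; ring
      rw [this]
      linear_combination (b * (N (a * α) : ZMod n) + 1) * hb1
    rw [hmul _ _ (gmul hα₀ hg) (gnat hbn), hmul _ _ hα₀ hg, hmul _ _ (gnat h1) h2, he₀, h3,
      hnat _ h1, hnat _ hbn] at h5
    norm_num at h5
  have hv' : (QuotientGroup.mk (U α₀ hα₀) : (ZMod n)ˣ ⧸ W) ≠ 1 := by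
    rwa [Ne, QuotientGroup.eq_one_iff]
  have : NeZero (Monoid.exponent ((ZMod n)ˣ ⧸ W)) := ⟨Monoid.exponent_ne_zero.mpr
    ⟨2, two_pos, fun x => by
      obtain ⟨u, rfl⟩ := QuotientGroup.mk_surjective x
      rw [← QuotientGroup.mk_pow]
      exact (QuotientGroup.eq_one_iff _).mpr (hWsq u)⟩⟩
  obtain ⟨χ, hχ⟩ := CommGroup.exists_apply_ne_one_of_hasEnoughRootsOfUnity
    ((ZMod n)ˣ ⧸ W) ℂ hv'
  have hχsq : ∀ x, χ x ^ 2 = 1 := by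
    intro x
    obtain ⟨u, rfl⟩ := QuotientGroup.mk_surjective x
    rw [← map_pow, ← QuotientGroup.mk_pow, (QuotientGroup.eq_one_iff _).mpr (hWsq u), map_one]
  have hχv : χ (QuotientGroup.mk (U α₀ hα₀)) = -1 := by
    have h1 := hχsq (QuotientGroup.mk (U α₀ hα₀))
    have h2 : ((χ (QuotientGroup.mk (U α₀ hα₀)) : ℂˣ) : ℂ) ^ 2 = 1 := by
      rw [← Units.val_pow_eq_pow_val, h1]; simp
    rw [sq] at h2
    rcases mul_self_eq_one_iff.mp h2 with h | h
    · exact absurd (Units.ext (by simpa using h)) hχ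
    · exact Units.ext (by simpa using h)
  refine ⟨MulChar.ofUnitHom (χ.comp (QuotientGroup.mk' W)), ?_, fun α hα => ?_⟩
  · ext u
    rw [MulChar.pow_apply_coe, MulChar.ofUnitHom_coe, MulChar.one_apply_coe,
      ← Units.val_pow_eq_pow_val]
    simp only [MonoidHom.comp_apply]
    rw [hχsq, Units.val_one]
  · change _ = MulChar.ofUnitHom (χ.comp (QuotientGroup.mk' W)) (N α : ZMod n)
    rw [← hU α hα, MulChar.ofUnitHom_coe]
    simp only [MonoidHom.comp_apply, QuotientGroup.mk'_apply]
    rcases hsign α hα with h | h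
    · rw [(QuotientGroup.eq_one_iff _).mpr (hUW α hα h), map_one, h, Units.val_one]
    · have h1 : U α hα * U α₀ hα₀ ∈ W := by
        have h2 := hUW (α * α₀) (gmul hα hα₀) (by rw [hmul _ _ hα hα₀, h, he₀]; norm_num)
        have h3 : U (α * α₀) (gmul hα hα₀) = U α hα * U α₀ hα₀ := by
          ext
          rw [Units.val_mul, hU _ (gmul hα hα₀), hU _ hα, hU _ hα₀, hNmul]; push_cast; rfl
        rwa [← h3]
      have h2 : χ (QuotientGroup.mk (U α hα)) * χ (QuotientGroup.mk (U α₀ hα₀)) = 1 := by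
        rw [← map_mul, ← QuotientGroup.mk_mul, (QuotientGroup.eq_one_iff _).mpr h1, map_one]
      rw [hχv] at h2
      have h3 : χ (QuotientGroup.mk (U α hα)) = -1 := by
        rw [mul_eq_one_iff_eq_inv.mp h2]; simp
      rw [h3, h]; simp

/-! ### Ramified primes -/

/-- A prime `𝔭` over `p ∣ disc` contains `s`, so conjugation is trivial modulo `𝔭` and `𝔭 = 𝔭̄`. If
`N 𝔭 = p` this gives `𝔭 ^ 2 = (p)`; the inert case `𝔭 = (p)` is excluded on coordinates. -/
theorem exists_sq_eq_span (Q : QuadraticData σ) {p : ℕ} (hp : p.Prime)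
    (hd : (p : ℤ) ∣ discr K) :
    ∃ 𝔭 : Ideal (𝓞 K), 𝔭 ^ 2 = Ideal.span {(p : 𝓞 K)} ∧ Q.conjIdeal 𝔭 = 𝔭 := by
  obtain ⟨𝔭, h𝔭, hmem⟩ := Q.exists_prime_dvd_natCast hp
  have hprime := Ideal.isPrime_of_prime h𝔭
  have hs : Q.s ∈ 𝔭 := by
    apply hprime.mem_of_pow_mem 2
    obtain ⟨d, hd⟩ := hd
    rw [Q.s_sq, hd]
    push_cast
    exact Ideal.mul_mem_right _ _ hmem
  have hle : 𝔭 ≤ Q.conjIdeal 𝔭 := by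
    intro x hx
    rw [mem_conjIdeal]
    obtain ⟨a, b, rfl⟩ := Q.exists_repr x
    have := Q.sub_conj a b
    have h1 : Q.conj (a + b * Q.ω) = (a + b * Q.ω) - b * Q.s := by rw [← this]; ring
    rw [h1]
    exact sub_mem hx (Ideal.mul_mem_left _ _ hs)
  have hconj : Q.conjIdeal 𝔭 = 𝔭 :=
    le_antisymm ((Ideal.map_mono (f := Q.conj) hle).trans (Q.conjIdeal_conjIdeal 𝔭).le) hle
  refine ⟨𝔭, ?_, hconj⟩
  rcases Q.exists_prime_and_absNorm_eq h𝔭 hp hmem with h | h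
  · rw [sq]; nth_rewrite 2 [← hconj]; rw [Q.mul_conjIdeal, h]
  · exfalso
    obtain ⟨t, ht⟩ := Q.s_eq
    have h1 : (((-t : ℤ) : 𝓞 K) + ((2 : ℤ) : 𝓞 K) * Q.ω) ∈ Ideal.span {((p : ℤ) : 𝓞 K)} := by
      rw [Int.cast_natCast, ← h]
      convert hs using 1
      rw [ht]; push_cast; rfl
    obtain ⟨h2, h3⟩ := Q.coord_dvd h1
    have hp2 : p = 2 := by
      have := Int.le_of_dvd two_pos h3
      have := hp.two_le
      omega
    -- What remains is `p = 2` with even trace: `ω ^ 2 = 2 t' ω - n` makes `(ω - n) ^ 2` congruent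
    -- to `n ^ 2 - n`, so to `0`, mod `2`. Thus `ω - n` would lie in `(2)`.
    obtain ⟨t', rfl⟩ : (2 : ℤ) ∣ t := by rw [hp2] at h2; exact (dvd_neg.mp h2)
    obtain ⟨n, hn⟩ := Q.exists_norm Q.ω
    have hω : Q.conj Q.ω = (2 * t' : ℤ) - Q.ω := by
      have : Q.conj Q.ω = Q.ω - Q.s := by rw [s]; ring
      rw [this, ht]; ring
    rw [hω] at hn
    obtain ⟨k, hk⟩ : (2 : ℤ) ∣ n * n - n := by
      rcases Int.even_mul_pred_self n with ⟨k, hk⟩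
      exact ⟨k, by linear_combination hk⟩
    have hk' : (n * n - n : 𝓞 K) = 2 * k := by exact_mod_cast congrArg (Int.cast : ℤ → 𝓞 K) hk
    have h4 : (Q.ω - n) ^ 2 ∈ 𝔭 := by
      have : (Q.ω - n) ^ 2 = (t' * Q.ω - n * Q.ω + k) * (p : 𝓞 K) := by
        rw [hp2]; push_cast at hn ⊢
        linear_combination -hn + hk'
      rw [this]; exact Ideal.mul_mem_left _ _ hmem
    have h5 := hprime.mem_of_pow_mem 2 h4
    have h6 : (((-n : ℤ) : 𝓞 K) + ((1 : ℤ) : 𝓞 K) * Q.ω) ∈ Ideal.span {((p : ℤ) : 𝓞 K)} := by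
      rw [Int.cast_natCast, ← h]
      convert h5 using 1
      push_cast; ring
    have := Int.le_of_dvd one_pos (Q.coord_dvd h6).2
    have := hp.two_le
    omega

/-- Since `𝔭 ^ 2 = (p)` and `l` is odd, `𝔭` itself is principal, say `(z)`. Both `z ^ 2 / p` and `z̄
/ z` are signs; `z` cannot be rational, so `z̄ = -z`, `p = -z ^ 2` and `2 z = b s`. -/
theorem four_mul_eq_of_principal (Q : QuadraticData σ) (h3 : discr K ≠ -3) (h4 : discr K ≠ -4)
    {l : ℕ} (hl : Odd l)
    (hcl : ∀ 𝔞 : Ideal (𝓞 K), 𝔞 ≠ ⊥ → ∃ x : 𝓞 K, 𝔞 ^ l = Ideal.span {x}) {p : ℕ} (hp : p.Prime)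
    (hd : (p : ℤ) ∣ discr K) : ∃ b : ℤ, -(4 * p : ℤ) = b ^ 2 * discr K := by
  obtain ⟨𝔭, h1, h2⟩ := Q.exists_sq_eq_span hp hd
  have hpK : (p : 𝓞 K) ≠ 0 := by exact_mod_cast hp.ne_zero
  have h𝔭0 : 𝔭 ≠ ⊥ := by
    rintro rfl
    rw [← Ideal.zero_eq_bot, zero_pow two_ne_zero] at h1
    exact span_ne_bot hpK h1.symm
  obtain ⟨x, hx⟩ := hcl 𝔭 h𝔭0
  obtain ⟨k, rfl⟩ := hl
  rw [pow_succ, pow_mul, h1, Ideal.span_singleton_pow] at hx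
  obtain ⟨z, hz, -⟩ := exists_eq_span_of_span_mul_eq (pow_ne_zero k hpK) hx
  have hz0 : z ≠ 0 := by
    rintro rfl
    rw [Ideal.span_singleton_zero] at hz
    exact h𝔭0 hz
  have hunit : ∀ {x y : 𝓞 K}, Ideal.span {x} = Ideal.span {y} → y = x ∨ y = -x := by
    intro x y h
    obtain ⟨u, hu⟩ := Ideal.span_singleton_eq_span_singleton.mp h
    rcases Q.unit_eq_one_or_neg_one h3 h4 u.isUnit with h | h
    · left; rw [← hu, h, mul_one]
    · right; rw [← hu, h]; ring
  have hzp : (p : 𝓞 K) = z ^ 2 ∨ (p : 𝓞 K) = -z ^ 2 := hunit (by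
    rw [← Ideal.span_singleton_pow, ← hz, h1])
  have hzc : Q.conj z = z ∨ Q.conj z = -z := hunit (by rw [← conjIdeal_span, ← hz, h2])
  have hzc' : Q.conj z = -z := by
    refine hzc.resolve_left fun h => ?_
    obtain ⟨a, rfl⟩ := Q.eq_intCast_of_conj_eq h
    have h5 : (p : ℤ) = a ^ 2 ∨ (p : ℤ) = -a ^ 2 := by
      rcases hzp with h | h
      · left; exact_mod_cast h
      · right; exact_mod_cast h
    have h6 : p = a.natAbs ^ 2 := by
      have h7 := Int.natAbs_pow a 2
      rcases h5 with h | h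
      · rw [← h7, ← h]; simp
      · rw [← h7, ← Int.natAbs_neg, ← h]; simp
    exact Nat.Prime.not_prime_pow (le_refl 2) (h6 ▸ hp)
  have hzz : (p : 𝓞 K) = -z ^ 2 := by
    refine hzp.resolve_left fun h => ?_
    obtain ⟨n, hn⟩ := Q.exists_norm z
    rw [hzc'] at hn
    have h5 : ((n + p : ℕ) : 𝓞 K) = 0 := by push_cast; rw [← hn, h]; ring
    have h6 : n + p = 0 := by exact_mod_cast h5
    have := hp.pos
    omega
  obtain ⟨a, b, hab⟩ := Q.exists_repr z
  have h5 : 2 * z = b * Q.s := by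
    rw [← Q.sub_conj a b, ← hab, hzc']; ring
  refine ⟨b, ?_⟩
  have : ((-(4 * p) : ℤ) : 𝓞 K) = ((b ^ 2 * discr K : ℤ) : 𝓞 K) := by
    push_cast
    rw [← Q.s_sq, ← mul_pow, ← h5, hzz]; ring
  exact_mod_cast this

/-- If the class group has odd exponent, the discriminant is `-8` or minus a prime. -/
theorem discr_eq_of_principal (Q : QuadraticData σ) (h3 : discr K ≠ -3) (h4 : discr K ≠ -4)
    {l : ℕ} (hl : Odd l)
    (hcl : ∀ 𝔞 : Ideal (𝓞 K), 𝔞 ≠ ⊥ → ∃ x : 𝓞 K, 𝔞 ^ l = Ideal.span {x}) :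
    discr K = -8 ∨ ∃ p : ℕ, p.Prime ∧ p % 4 = 3 ∧ discr K = -p := by
  have key : ∀ p : ℕ, p.Prime → (p : ℤ) ∣ discr K → discr K = -(4 * p) ∨ discr K = -p := by
    intro p hp hd
    obtain ⟨b, hb⟩ := Q.four_mul_eq_of_principal h3 h4 hl hcl hp hd
    obtain ⟨k, hk⟩ := hd
    have hp0 : (p : ℤ) ≠ 0 := by exact_mod_cast hp.ne_zero
    have h5 : b ^ 2 * k = -4 := by
      apply mul_left_cancel₀ hp0
      rw [hk] at hb
      linear_combination -hb
    have hb2 : 0 ≤ b ^ 2 := sq_nonneg b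
    have hb3 : b ^ 2 ≤ 4 := Int.le_of_dvd (by norm_num) ⟨-k, by linear_combination h5⟩
    have hb4 : b ≤ 2 := by nlinarith
    have hb5 : -2 ≤ b := by nlinarith
    rw [hk]
    interval_cases b
    · right; have : k = -1 := by linarith
      rw [this]; ring
    · left; have : k = -4 := by linarith
      rw [this]; ring
    · norm_num at h5
    · left; have : k = -4 := by linarith
      rw [this]; ring
    · right; have : k = -1 := by linarith
      rw [this]; ring
  have hneg := Q.discr_neg
  have hmod := Q.discr_emod_four
  obtain ⟨p, hp, hpd⟩ := Nat.exists_prime_and_dvd (n := (discr K).natAbs) (by omega)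
  have hpd' : (p : ℤ) ∣ discr K := Int.natCast_dvd.mpr hpd
  rcases key p hp hpd' with h | h
  · left
    -- In the case `disc = -4 p` the prime `2` is ramified as well, and `key` at `2` leaves only
    -- `disc = -8`.
    have := key 2 Nat.prime_two ⟨-(2 * p), by rw [h]; push_cast; ring⟩
    have := hp.two_le
    omega
  · right
    refine ⟨p, hp, ?_, h⟩
    have h5 : p % 4 = 0 ∨ p % 4 = 3 := by omega
    refine h5.resolve_left fun h6 => ?_
    have h7 : 2 ∣ p := by omega
    have := (Nat.prime_dvd_prime_iff_eq Nat.prime_two hp).mp h7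
    omega

end QuadraticData

/-! ### Hecke characters from distinguished generators -/

/-- If the `l`-th powers of the ideals prime to `𝔣` have distinguished generators, closed under
multiplication, then these generators are the values of a Hecke character. -/
theorem exists_isHeckeCharacter_of_generator {𝔣 : Ideal (𝓞 K)} (h𝔣 : 𝔣 ≠ ⊥) {l : ℕ}
    (S : 𝓞 K → Prop) (hmul : ∀ x y, S x → S y → S (x * y))
    (hinj : ∀ x y, x ≠ 0 → S x → S y → Ideal.span {x} = Ideal.span {y} → x = y)
    (hex : ∀ 𝔞, 𝔞 ≠ ⊥ → IsCoprime 𝔞 𝔣 → ∃ x, S x ∧ Ideal.span {x} = 𝔞 ^ l)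
    (hone : ∀ α, α - 1 ∈ 𝔣 → S (α ^ l)) :
    ∃ ψ : Ideal (𝓞 K) →*₀ ℂ, IsHeckeCharacter σ 𝔣 l ψ ∧
      ∀ 𝔞, 𝔞 ≠ ⊥ → IsCoprime 𝔞 𝔣 → ∃ x : 𝓞 K, S x ∧ Ideal.span {x} = 𝔞 ^ l ∧ ψ 𝔞 = σ (x : K) := by
  classical
  choose! g hgS hgs using hex
  have hg0 : ∀ 𝔞, 𝔞 ≠ ⊥ → IsCoprime 𝔞 𝔣 → g 𝔞 ≠ 0 := by
    intro 𝔞 h0 hc h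
    have := hgs 𝔞 h0 hc
    rw [h, Ideal.span_singleton_eq_bot.mpr rfl] at this
    exact pow_ne_zero l h0 this.symm
  obtain ⟨ψ, hψ, hv⟩ := exists_isHeckeCharacter_of_mul (σ := σ) h𝔣 (l := l) (fun 𝔞 => σ (g 𝔞 : K))
    (fun 𝔞 h0 hc => embedding_ne_zero σ (hg0 𝔞 h0 hc))
    (fun 𝔞 𝔟 ha hca hb hcb => by
      have hab : 𝔞 * 𝔟 ≠ ⊥ := mul_ne_zero ha hb
      rw [← embedding_mul]
      refine congrArg (fun x : 𝓞 K => σ (x : K)) (hinj _ _ (hg0 _ hab (hca.mul_left hcb))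
        (hgS _ hab (hca.mul_left hcb)) (hmul _ _ (hgS _ ha hca) (hgS _ hb hcb)) ?_)
      rw [hgs _ hab (hca.mul_left hcb), ← Ideal.span_singleton_mul_span_singleton,
        hgs _ ha hca, hgs _ hb hcb, mul_pow])
    (fun α hα h1 => by
      have hc := isCoprime_span_of_sub_one_mem h1
      have h0 := span_ne_bot hα
      rw [← embedding_pow]
      refine congrArg (fun x : 𝓞 K => σ (x : K)) (hinj _ _ (hg0 _ h0 hc) (hgS _ h0 hc)
        (hone α h1) ?_)
      rw [hgs _ h0 hc, Ideal.span_singleton_pow])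
  exact ⟨ψ, hψ, fun 𝔞 h0 hc => ⟨g 𝔞, hgS _ h0 hc, hgs _ h0 hc, hv _ h0 hc⟩⟩

theorem exists_isUnit_eq_mul {x y : 𝓞 K} (h : Ideal.span {x} = Ideal.span {y}) : ∃ u : 𝓞 K, IsUnit u ∧ y = u * x := by
  obtain ⟨u, hu⟩ := Ideal.span_singleton_eq_span_singleton.mp h
  exact ⟨u, u.isUnit, by rw [← hu, mul_comm]⟩

namespace QuadraticData

variable (Q : QuadraticData σ)

/-- The conjugate of the distinguished generator of `𝔞 ^ l` is a distinguished generator of `𝔞̄ ^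
l`, and there is only one. -/
theorem isEquivariant_of_generator (Q : QuadraticData σ) {𝔣 : Ideal (𝓞 K)} {l : ℕ}
    {ψ : Ideal (𝓞 K) →*₀ ℂ} (hψ : IsHeckeCharacter σ 𝔣 l ψ) (h𝔣 : Q.conjIdeal 𝔣 = 𝔣)
    {S : 𝓞 K → Prop} (hS : ∀ x, S x → S (Q.conj x))
    (hinj : ∀ x y, x ≠ 0 → S x → S y → Ideal.span {x} = Ideal.span {y} → x = y)
    (hv : ∀ 𝔞, 𝔞 ≠ ⊥ → IsCoprime 𝔞 𝔣 → ∃ x : 𝓞 K, S x ∧ Ideal.span {x} = 𝔞 ^ l ∧ ψ 𝔞 = σ (x : K)) :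
    Q.IsEquivariant ψ := by
  intro 𝔞
  have hcc : IsCoprime (Q.conjIdeal 𝔞) 𝔣 ↔ IsCoprime 𝔞 𝔣 := by
    rw [← Q.isCoprime_conjIdeal (𝔞 := 𝔞), h𝔣]
  have hc0 : Q.conjIdeal 𝔞 = ⊥ ↔ 𝔞 = ⊥ := Q.conjIdeal_eq_bot
  by_cases h : 𝔞 ≠ ⊥ ∧ IsCoprime 𝔞 𝔣
  · obtain ⟨x, hx, hxs, hxv⟩ := hv 𝔞 h.1 h.2
    obtain ⟨y, hy, hys, hyv⟩ := hv (Q.conjIdeal 𝔞) (by rw [Ne, hc0]; exact h.1) (hcc.mpr h.2)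
    refine ⟨x, hxv, ?_⟩
    have hy0 : y ≠ 0 := by
      rintro rfl
      have := (hψ.ne_zero_iff (Q.conjIdeal 𝔞)).mpr ⟨by rw [Ne, hc0]; exact h.1, hcc.mpr h.2⟩
      exact this (by rw [hyv]; simp)
    rw [hyv, hinj y (Q.conj x) hy0 hy (hS x hx) (by
      rw [hys, ← Q.conjIdeal_span, hxs, Q.conjIdeal_pow])]
  · have h1 : ψ 𝔞 = 0 := by
      by_contra hne
      exact h ((hψ.ne_zero_iff _).mp hne)
    have h2 : ψ (Q.conjIdeal 𝔞) = 0 := by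
      by_contra hne
      have := (hψ.ne_zero_iff _).mp hne
      exact h ⟨fun h' => this.1 (hc0.mpr h'), hcc.mp this.2⟩
    exact ⟨0, by rw [h1]; simp, by rw [h2]; simp⟩

/-! ### The fields of discriminant `-3`, `-4` and `-8` -/

/-- For an imaginary quadratic field the Minkowski criterion reads `|disc| < π ^ 2`, and `π > 3`. -/
theorem isPrincipalIdealRing [IsTotallyComplex K] (Q : QuadraticData σ) (h : |discr K| < 9) :
    IsPrincipalIdealRing (𝓞 K) := by
  apply RingOfIntegers.isPrincipalIdealRing_of_abs_discr_lt
  have h1 := InfinitePlace.card_add_two_mul_card_eq_rank K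
  have hr : Module.finrank ℚ K = 2 := by rw [← RingOfIntegers.rank, Q.finrank_eq]
  rw [hr, nrRealPlaces_eq_zero_iff.mpr inferInstance] at h1
  have h2 : InfinitePlace.nrComplexPlaces K = 1 := by omega
  rw [h2, hr]
  have h3 := Real.pi_gt_three
  have h4 : ((|discr K| : ℤ) : ℝ) < 9 := by exact_mod_cast h
  have h5 : ((2 : ℕ).factorial : ℝ) = 2 := by norm_num [Nat.factorial]
  push_cast
  rw [h5]
  push_cast at h4
  nlinarith

/-- The integral basis may be chosen as `1, (s - e) / 2`. -/
theorem exists_two_mul_eq_s_sub (Q : QuadraticData σ) {e : ℤ} (he : 2 ∣ discr K - e) :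
    ∃ θ : 𝓞 K, 2 * θ = Q.s - e ∧ (∀ x : 𝓞 K, ∃ a b : ℤ, x = a + b * θ) ∧
      ∀ q a b : ℤ, (a + b * θ : 𝓞 K) ∈ Ideal.span {(q : 𝓞 K)} → q ∣ a ∧ q ∣ b := by
  obtain ⟨t, ht⟩ := Q.exists_trace ((0 : ℤ) + (1 : ℤ) * Q.ω)
  obtain ⟨n, hn⟩ := Q.exists_norm ((0 : ℤ) + (1 : ℤ) * Q.ω)
  have h := Q.trace_sq_sub ht hn
  have hs : Q.s = -t + 2 * Q.ω := by
    rw [← ht, s]; push_cast; rw [zero_add, one_mul]; ring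
  have ht2 : 2 ∣ t + e := by
    have h1 : (2 : ℤ) ∣ t ^ 2 + e := by
      obtain ⟨c, hc⟩ := he
      exact ⟨2 * n + c + e, by linear_combination h + hc⟩
    have h2 := Int.emod_two_eq_zero_or_one t
    have h3 : t ^ 2 % 2 = t % 2 := by
      rcases h2 with h2 | h2 <;> simp [pow_two, Int.mul_emod, h2]
    omega
  obtain ⟨k, hk⟩ := ht2
  have hk' : (t : 𝓞 K) = 2 * k - e := by
    have : t = 2 * k - e := by omega
    rw [this]; push_cast; ring
  refine ⟨Q.ω - k, by rw [hs, hk']; ring, fun x => ?_, fun q a b hq => ?_⟩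
  · obtain ⟨a, b, rfl⟩ := Q.exists_repr x
    exact ⟨a + b * k, b, by push_cast; ring⟩
  · obtain ⟨h1, h2⟩ := Q.coord_dvd (q := q) (a := a - b * k) (b := b) (by
      convert hq using 1; push_cast; ring)
    exact ⟨by have := dvd_add h1 (h2.mul_right k); simpa using this, h2⟩

theorem prime_span_of_mul_conj (Q : QuadraticData σ) {x : 𝓞 K} {p : ℕ} (hp : p.Prime)
    (h : x * Q.conj x = p) : Prime (Ideal.span {x}) := by
  have h1 := Q.absNorm_span_of_mul_conj h
  rw [Ideal.prime_iff_isPrime]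
  · exact Ideal.isPrime_of_irreducible_absNorm (by rw [h1]; exact hp)
  · intro h2
    rw [h2, Ideal.absNorm_bot] at h1
    exact hp.ne_zero h1.symm

/-- A unit congruent to one modulo an ideal of norm greater than four is equal to one. -/
theorem eq_one_of_isUnit_of_sub_one_mem (Q : QuadraticData σ) {u : 𝓞 K} (hu : IsUnit u)
    {𝔣 : Ideal (𝓞 K)} (h𝔣 : 4 < Ideal.absNorm 𝔣) (h : u - 1 ∈ 𝔣) : u = 1 := by
  have h1 : Complex.normSq (σ (u : K)) = 1 := by
    have := Q.normSq_embedding (x := u) (n := 1) (by rw [Q.unit_norm hu]; simp)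
    simpa using this
  have h2 : Complex.normSq (σ ((u - 1 : 𝓞 K) : K)) ≤ 4 := by
    have h3 : ‖σ (u : K)‖ = 1 := by
      rw [Complex.normSq_eq_norm_sq] at h1
      nlinarith [norm_nonneg (σ (u : K))]
    have h4 : ‖σ ((u - 1 : 𝓞 K) : K)‖ ≤ 2 := by
      have : σ ((u - 1 : 𝓞 K) : K) = σ (u : K) - 1 := by simp
      rw [this]
      refine (norm_sub_le _ _).trans ?_
      rw [h3, norm_one]; norm_num
    rw [Complex.normSq_eq_norm_sq]
    nlinarith [norm_nonneg (σ ((u - 1 : 𝓞 K) : K))]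
  rw [Q.normSq_embedding_eq] at h2
  have h3 : Ideal.absNorm 𝔣 ∣ Ideal.absNorm (Ideal.span {u - 1}) :=
    Ideal.absNorm_dvd_absNorm_of_le ((Ideal.span_singleton_le_iff_mem _).mpr h)
  have h4 : Ideal.absNorm (Ideal.span {u - 1}) ≤ 4 := by exact_mod_cast h2
  have h5 := Nat.eq_zero_of_dvd_of_lt h3 (by omega)
  rw [Ideal.absNorm_eq_zero_iff, Ideal.span_singleton_eq_bot] at h5
  exact sub_eq_zero.mp h5

end QuadraticData

theorem notMem_of_isCoprime_span {𝔭 : Ideal (𝓞 K)} (h𝔭 : Prime 𝔭) {x : 𝓞 K}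
    (h : IsCoprime (Ideal.span {x}) 𝔭) : x ∉ 𝔭 := by
  intro hx
  obtain ⟨y, hy⟩ := isCoprime_span_iff.mp h
  apply h𝔭.not_isUnit
  rw [Ideal.isUnit_iff, Ideal.eq_top_iff_one]
  simpa using sub_mem (𝔭.mul_mem_left y hx) hy

/-- A power of a Hecke character of `∞`-type one extends to any modulus for which it is
defined. -/
theorem IsHeckeCharacter.exists_extension_pow {𝔪 𝔣 : Ideal (𝓞 K)} {ψ₁ : Ideal (𝓞 K) →*₀ ℂ}
    (hψ₁ : IsHeckeCharacter σ 𝔪 1 ψ₁) (h𝔣 : 𝔣 ≠ ⊥) {l : ℕ} (hl : l ≠ 0)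
    (hp : ∀ α : 𝓞 K, α ≠ 0 → α - 1 ∈ 𝔣 → IsCoprime (Ideal.span {α}) 𝔪 →
      ψ₁ (Ideal.span {α}) ^ l = σ (α : K) ^ l) :
    ∃ ψ : Ideal (𝓞 K) →*₀ ℂ, IsHeckeCharacter σ 𝔣 l ψ ∧
      ∀ 𝔞, 𝔞 ≠ ⊥ → IsCoprime 𝔞 𝔪 → IsCoprime 𝔞 𝔣 → ψ 𝔞 = ψ₁ 𝔞 ^ l :=
  IsHeckeCharacter.exists_extension (ψ := (powMonoidWithZeroHom hl).comp ψ₁) hψ₁.modulus_ne_bot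
    (fun 𝔞 => by
      rw [← hψ₁.ne_zero_iff 𝔞]
      exact pow_ne_zero_iff hl) h𝔣 hp

namespace QuadraticData

variable (Q : QuadraticData σ)

/-- Hecke characters of `∞`-type one for moduli all of whose residues are represented by a unique
unit. -/
theorem exists_isHeckeCharacter_of_units [IsPrincipalIdealRing (𝓞 K)] (Q : QuadraticData σ)
    {𝔣 : Ideal (𝓞 K)} (h4 : 4 < Ideal.absNorm 𝔣) (hc : Q.conjIdeal 𝔣 = 𝔣)
    (hrep : ∀ x, IsCoprime (Ideal.span {x}) 𝔣 → ∃ v, IsUnit v ∧ x - v ∈ 𝔣) :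
    ∃ ψ : Ideal (𝓞 K) →*₀ ℂ, IsHeckeCharacter σ 𝔣 1 ψ ∧ Q.IsEquivariant ψ := by
  have h𝔣 : 𝔣 ≠ ⊥ := by rintro rfl; simp at h4
  have hinj : ∀ x y : 𝓞 K, x ≠ 0 → x - 1 ∈ 𝔣 → y - 1 ∈ 𝔣 → Ideal.span {x} = Ideal.span {y} →
      x = y := by
    intro x y _ hx hy hxy
    obtain ⟨u, hu, rfl⟩ := exists_isUnit_eq_mul hxy
    rw [Q.eq_one_of_isUnit_of_sub_one_mem hu h4 (by
      convert sub_mem hy (𝔣.mul_mem_left u hx) using 1; ring), one_mul]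
  obtain ⟨ψ, hψ, hv⟩ := exists_isHeckeCharacter_of_generator (σ := σ) h𝔣 (l := 1)
    (fun x => x - 1 ∈ 𝔣)
    (fun x y hx hy => by convert add_mem (𝔣.mul_mem_left y hx) hy using 1; ring) hinj
    (fun 𝔞 h0 hc => by
      obtain ⟨x, rfl⟩ := IsPrincipalIdealRing.principal 𝔞
      obtain ⟨v, hv, hxv⟩ := hrep x hc
      obtain ⟨w, hw⟩ := hv.exists_left_inv
      refine ⟨w * x, ?_, ?_⟩
      · convert 𝔣.mul_mem_left w hxv using 1; rw [mul_sub, hw]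
      · rw [pow_one]
        exact Ideal.span_singleton_mul_left_unit (IsUnit.of_mul_eq_one _ hw) x)
    (fun α hα => by rwa [pow_one])
  refine ⟨ψ, hψ, Q.isEquivariant_of_generator hψ hc (fun x hx => ?_) hinj hv⟩
  rw [← hc, mem_conjIdeal]
  simpa using hx

/-- As `ψ (v) = 1`, the value at `α ≡ v` is `α / v`. -/
theorem apply_span_mul_of_sub_unit_mem {𝔣 : Ideal (𝓞 K)} {ψ : Ideal (𝓞 K) →*₀ ℂ}
    (hψ : IsHeckeCharacter σ 𝔣 1 ψ) {α v : 𝓞 K} (hα : α ≠ 0) (hv : IsUnit v) (h : α - v ∈ 𝔣) :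
    ψ (Ideal.span {α}) * σ (v : K) = σ (α : K) := by
  have h1 : Ideal.span {v} = 1 := by rw [Ideal.one_eq_top, Ideal.span_singleton_eq_top.mpr hv]
  have := hψ.congr hα hv.ne_zero
    (isCoprime_span_of_sub_mem (by rw [← neg_sub]; exact neg_mem h)
      (by rw [h1]; exact isCoprime_one_left)) h
  rwa [h1, map_one, one_mul, pow_one, pow_one] at this

/-! ### Discriminant `-3` -/

theorem exists_zeta (Q : QuadraticData σ) (h : discr K = -3) : ∃ ζ : 𝓞 K, ζ ^ 2 + ζ + 1 = 0 ∧
    Q.s = 2 * ζ + 1 ∧ ∀ x : 𝓞 K, ∃ a b : ℤ, x = a + b * ζ := by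
  obtain ⟨θ, h1, h2, -⟩ := Q.exists_two_mul_eq_s_sub (e := 1) (by rw [h]; norm_num)
  push_cast at h1
  have hs : Q.s = 2 * θ + 1 := by rw [h1]; ring
  refine ⟨θ, ?_, hs, h2⟩
  have h3 := Q.s_sq
  rw [h, hs] at h3
  push_cast at h3
  have h4 : (4 : 𝓞 K) * (θ ^ 2 + θ + 1) = 0 := by linear_combination h3
  simpa using h4

theorem prime_span_s (Q : QuadraticData σ) {p : ℕ} (hp : p.Prime) (h : discr K = -p) :
    Prime (Ideal.span {Q.s}) := by
  apply Q.prime_span_of_mul_conj hp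
  have := Q.s_sq
  rw [h] at this
  rw [conj_s]
  push_cast at this
  linear_combination -this

theorem span_s_sq (Q : QuadraticData σ) {p : ℕ} (h : discr K = -p) :
    Ideal.span {Q.s} ^ 2 = Ideal.span {(p : 𝓞 K)} := by
  rw [Ideal.span_singleton_pow, Q.s_sq, h]
  push_cast
  rw [Ideal.span_singleton_neg]

/-- Since `ζ ≡ 1` modulo `√-3`, primality to `3` means `3 ∤ a + b`. This leaves six classes modulo
`3`: those of `±1`, `±ζ`, `±(1 + ζ)`. -/
theorem exists_unit_sub_mem_of_discr_eq_neg_three (Q : QuadraticData σ) (h : discr K = -3) {x : 𝓞 K}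
    (hx : IsCoprime (Ideal.span {x}) (Ideal.span {3})) :
    ∃ v, IsUnit v ∧ x - v ∈ Ideal.span {(3 : 𝓞 K)} := by
  obtain ⟨ζ, hζ, hs, hrep⟩ := Q.exists_zeta h
  have hx' : x ∉ Ideal.span {Q.s} := by
    refine notMem_of_isCoprime_span (Q.prime_span_s Nat.prime_three (by simpa using h)) ?_
    have := Q.span_s_sq (p := 3) (by simpa using h)
    push_cast at this
    rw [← this] at hx
    exact (IsCoprime.pow_right_iff two_pos).mp hx
  obtain ⟨a, b, rfl⟩ := hrep x
  have hab : ¬ (3 : ℤ) ∣ a + b := by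
    rintro ⟨k, hk⟩
    apply hx'
    rw [Ideal.mem_span_singleton']
    refine ⟨(b - k : ℤ) + (k - a : ℤ) * ζ, ?_⟩
    have hk' : (a : 𝓞 K) + b = 3 * k := by exact_mod_cast hk
    rw [hs]; push_cast
    linear_combination (2 * (k : 𝓞 K) - 2 * a) * hζ + (1 + ζ) * hk'
  have hmem : ∀ i j : ℤ, 3 ∣ a - i → 3 ∣ b - j →
      (a + b * ζ : 𝓞 K) - (i + j * ζ) ∈ Ideal.span {(3 : 𝓞 K)} := by
    rintro i j ⟨p, hp⟩ ⟨q, hq⟩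
    rw [Ideal.mem_span_singleton']
    have hp' : (a : 𝓞 K) - i = 3 * p := by exact_mod_cast hp
    have hq' : (b : 𝓞 K) - j = 3 * q := by exact_mod_cast hq
    exact ⟨p + q * ζ, by linear_combination -hp' - ζ * hq'⟩
  have u1 : IsUnit ζ := isUnit_iff_exists_inv.mpr ⟨-1 - ζ, by linear_combination -hζ⟩
  have u2 : IsUnit (1 + ζ) := isUnit_iff_exists_inv.mpr ⟨-ζ, by linear_combination -hζ⟩
  rcases (by omega : (3 ∣ a - 1 ∧ 3 ∣ b - 0) ∨ (3 ∣ a - (-1) ∧ 3 ∣ b - 0) ∨ (3 ∣ a - 0 ∧ 3 ∣ b - 1) ∨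
    (3 ∣ a - 0 ∧ 3 ∣ b - (-1)) ∨ (3 ∣ a - 1 ∧ 3 ∣ b - 1) ∨ (3 ∣ a - (-1) ∧ 3 ∣ b - (-1)))
    with h | h | h | h | h | h
  all_goals refine ⟨_, ?_, hmem _ _ h.1 h.2⟩
  · simp
  · simp
  · simpa using u1
  · simpa using u1
  · simpa using u2
  · have := u2.neg
    push_cast
    convert this using 1; ring

/-! ### Discriminant `-4` -/

theorem exists_sqrt_neg_one (Q : QuadraticData σ) (h : discr K = -4) : ∃ i : 𝓞 K, i ^ 2 = -1 ∧
    Q.s = 2 * i ∧ Q.conj i = -i ∧ ∀ x : 𝓞 K, ∃ a b : ℤ, x = a + b * i := by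
  obtain ⟨θ, h1, h2, -⟩ := Q.exists_two_mul_eq_s_sub (e := 0) (by rw [h]; norm_num)
  push_cast at h1
  have hs : Q.s = 2 * θ := by rw [h1]; ring
  refine ⟨θ, ?_, hs, ?_, h2⟩
  · have h3 := Q.s_sq
    rw [h, hs] at h3
    push_cast at h3
    have h4 : (4 : 𝓞 K) * (θ ^ 2 + 1) = 0 := by linear_combination h3
    have : θ ^ 2 + 1 = 0 := by simpa using h4
    linear_combination this
  · have h3 := Q.conj_s
    rw [hs, map_mul, map_ofNat] at h3
    have h4 : (2 : 𝓞 K) * (Q.conj θ + θ) = 0 := by linear_combination h3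
    have : Q.conj θ + θ = 0 := by simpa using h4
    linear_combination this

theorem twoAddTwoI_eq (Q : QuadraticData σ) (h : discr K = -4) {i : 𝓞 K} (hi : i ^ 2 = -1)
    (hs : Q.s = 2 * i) : twoAddTwoI K = Ideal.span {1 + i} ^ 3 := by
  have h1 : Ideal.span {1 + i} ^ 3 = Ideal.span {2 + 2 * i} := by
    rw [Ideal.span_singleton_pow,
      ← Ideal.span_singleton_mul_left_unit (a := i) (isUnit_iff_exists_inv.mpr
        ⟨-i, by linear_combination -hi⟩) (2 + 2 * i)]
    congr 2
    linear_combination (i + 1) * hi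
  rw [h1, twoAddTwoI]
  apply le_antisymm
  · rw [Ideal.span_le]
    rintro x ⟨s, hs', rfl⟩
    rw [SetLike.mem_coe, Ideal.mem_span_singleton']
    rcases (Q.sq_eq_discr_iff s).mp (by rw [hs', h]; push_cast; rfl) with rfl | rfl
    · exact ⟨1, by rw [hs]; ring⟩
    · exact ⟨-i, by rw [hs]; linear_combination -2 * hi⟩
  · rw [Ideal.span_singleton_le_iff_mem]
    exact Ideal.subset_span ⟨Q.s, by rw [Q.s_sq, h]; push_cast; rfl, by rw [hs]⟩

theorem prime_span_one_add_i (Q : QuadraticData σ) {i : 𝓞 K} (hi : i ^ 2 = -1)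
    (hci : Q.conj i = -i) : Prime (Ideal.span {1 + i}) := by
  apply Q.prime_span_of_mul_conj Nat.prime_two
  rw [map_add, map_one, hci]; push_cast
  linear_combination -hi

/-- Primality to `1 + i` means `a + b` odd, and `x + y i` lies in `(1 + i) ^ 3` when `2 ∣ x` and `4
∣ x + y`; the four classes are those of `±1`, `±i`. -/
theorem exists_unit_sub_mem_of_discr_eq_neg_four (Q : QuadraticData σ) (h : discr K = -4) {x : 𝓞 K}
    (hx : IsCoprime (Ideal.span {x}) (twoAddTwoI K)) :
    ∃ v, IsUnit v ∧ x - v ∈ twoAddTwoI K := by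
  obtain ⟨i, hi, hs, hci, hrep⟩ := Q.exists_sqrt_neg_one h
  rw [Q.twoAddTwoI_eq h hi hs] at hx ⊢
  have hx' : x ∉ Ideal.span {1 + i} :=
    notMem_of_isCoprime_span (Q.prime_span_one_add_i hi hci)
      ((IsCoprime.pow_right_iff three_pos).mp hx)
  obtain ⟨a, b, rfl⟩ := hrep x
  have hab : ¬ (2 : ℤ) ∣ a + b := by
    rintro ⟨k, hk⟩
    apply hx'
    rw [Ideal.mem_span_singleton']
    refine ⟨(k : ℤ) + (k - a : ℤ) * i, ?_⟩
    have hk' : (a : 𝓞 K) + b = 2 * k := by exact_mod_cast hk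
    push_cast
    linear_combination ((k : 𝓞 K) - a) * hi - i * hk'
  have hmem : ∀ c d : ℤ, 2 ∣ a - c → 4 ∣ a - c + (b - d) →
      (a + b * i : 𝓞 K) - (c + d * i) ∈ Ideal.span {1 + i} ^ 3 := by
    rintro c d ⟨p, hp⟩ ⟨q, hq⟩
    rw [Ideal.span_singleton_pow, Ideal.mem_span_singleton']
    have hp' : (a : 𝓞 K) - c = 2 * p := by exact_mod_cast hp
    have hq' : (a : 𝓞 K) - c + (b - d) = 4 * q := by exact_mod_cast hq
    exact ⟨(q - p : ℤ) - q * i, by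
      push_cast
      linear_combination (-(i : 𝓞 K) ^ 2 * q - i * (p + 2 * q) - 3 * p + q) * hi
        + (i - 1) * hp' - i * hq'⟩
  have u1 : IsUnit i := isUnit_iff_exists_inv.mpr ⟨-i, by linear_combination -hi⟩
  rcases (by omega : (2 ∣ a - 1 ∧ 4 ∣ a - 1 + (b - 0)) ∨ (2 ∣ a - (-1) ∧ 4 ∣ a - (-1) + (b - 0)) ∨
      (2 ∣ a - 0 ∧ 4 ∣ a - 0 + (b - 1)) ∨ (2 ∣ a - 0 ∧ 4 ∣ a - 0 + (b - (-1))))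
    with h | h | h | h
  all_goals refine ⟨_, ?_, hmem _ _ h.1 h.2⟩
  · simp
  · simp
  · simpa using u1
  · simpa using u1

end QuadraticData

/-! ### Signs modulo `4√-2` and conductors of powers. -/

/-- The residues modulo `4√-2` of the distinguished generators for `ℚ(√-2)`. -/
def signResidues (a b : ZMod 8) : Bool :=
  if b = 2 ∨ b = 6 then a = 5 ∨ a = 7 else a = 1 ∨ a = 3

/-- This and the next four checks say that the chosen residues form a subgroup, stable under
conjugation, of the units modulo `4√-2` that is complementary to `{±1}`. -/
theorem signResidues_mul : ∀ a b c d : ZMod 8, signResidues a b → signResidues c d →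
    signResidues (a * c - 2 * b * d) (a * d + b * c) := by decide

theorem signResidues_or : ∀ a b : ZMod 8,
    signResidues (2 * a + 1) b ∨ signResidues (-(2 * a + 1)) (-b) := by decide

theorem not_signResidues_neg : ∀ a b : ZMod 8,
    signResidues a b → ¬ signResidues (-a) (-b) := by decide

theorem signResidues_conj : ∀ a b : ZMod 8, signResidues a b → signResidues a (-b) := by decide

theorem signResidues_one : ∀ a b : ZMod 8, signResidues (1 - 8 * a) (4 * b) := by decide

/-- A power of a Hecke character of `∞`-type one modulo a power of a prime `𝔭` is defined modulo
`𝔭 ^ (k + 1)`, and this is its conductor, if it is trivial on `α ≡ 1` there but not modulo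
`𝔭 ^ k`. -/
theorem exists_hasConductor_pow {𝔭 : Ideal (𝓞 K)} (h𝔭 : Prime 𝔭) {m k l : ℕ} (hl : l ≠ 0)
    (hm : 0 < m) {ψ₁ : Ideal (𝓞 K) →*₀ ℂ} (hψ₁ : IsHeckeCharacter σ (𝔭 ^ m) 1 ψ₁)
    (hp : ∀ α : 𝓞 K, α ≠ 0 → α - 1 ∈ 𝔭 ^ (k + 1) → IsCoprime (Ideal.span {α}) (𝔭 ^ m) →
      ψ₁ (Ideal.span {α}) ^ l = σ (α : K) ^ l)
    {α : 𝓞 K} (hα : α ≠ 0) (hα1 : α - 1 ∈ 𝔭 ^ k) (hc : IsCoprime (Ideal.span {α}) 𝔭)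
    (hne : ψ₁ (Ideal.span {α}) ^ l ≠ σ (α : K) ^ l) :
    ∃ ψ : Ideal (𝓞 K) →*₀ ℂ, HasConductor σ (𝔭 ^ (k + 1)) l ψ ∧
      (∀ 𝔞, 𝔞 ≠ ⊥ → IsCoprime 𝔞 (𝔭 ^ m) → ψ 𝔞 = ψ₁ 𝔞 ^ l) ∧
      ((𝔭 ^ (k + 1) : Ideal (𝓞 K)) = ⊤ ∨ ∀ 𝔞, IsCoprime 𝔞 (𝔭 ^ (k + 1)) → IsCoprime 𝔞 (𝔭 ^ m)) := by
  obtain ⟨ψ, hψ, hv⟩ := hψ₁.exists_extension_pow (pow_ne_zero (k + 1) h𝔭.ne_zero) hl hp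
  have hiff : ∀ {𝔞 : Ideal (𝓞 K)} {i j : ℕ}, 0 < i → IsCoprime 𝔞 (𝔭 ^ i) → IsCoprime 𝔞 (𝔭 ^ j) :=
    fun hi h => ((IsCoprime.pow_right_iff hi).mp h).pow_right
  have hv' : ∀ 𝔞, 𝔞 ≠ ⊥ → IsCoprime 𝔞 (𝔭 ^ m) → ψ 𝔞 = ψ₁ 𝔞 ^ l :=
    fun 𝔞 h0 h => hv 𝔞 h0 h (hiff hm h)
  refine ⟨ψ, hasConductor_pow h𝔭 hψ hα hα1 hc ?_, hv', Or.inr fun 𝔞 h => hiff k.succ_pos h⟩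
  rwa [hv' _ (span_ne_bot hα) hc.pow_right]

theorem exists_hasConductor_top {𝔪 : Ideal (𝓞 K)} {l : ℕ} (hl : l ≠ 0)
    {ψ₁ : Ideal (𝓞 K) →*₀ ℂ} (hψ₁ : IsHeckeCharacter σ 𝔪 1 ψ₁)
    (hp : ∀ α : 𝓞 K, α ≠ 0 → IsCoprime (Ideal.span {α}) 𝔪 →
      ψ₁ (Ideal.span {α}) ^ l = σ (α : K) ^ l) :
    ∃ ψ : Ideal (𝓞 K) →*₀ ℂ, HasConductor σ ⊤ l ψ ∧
      (∀ 𝔞, 𝔞 ≠ ⊥ → IsCoprime 𝔞 𝔪 → ψ 𝔞 = ψ₁ 𝔞 ^ l) ∧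
      ((⊤ : Ideal (𝓞 K)) = ⊤ ∨ ∀ 𝔞, IsCoprime 𝔞 ⊤ → IsCoprime 𝔞 𝔪) := by
  obtain ⟨ψ, hψ, hv⟩ := hψ₁.exists_extension_pow (𝔣 := ⊤) top_ne_bot hl fun α h0 _ h => hp α h0 h
  refine ⟨ψ, hasConductor_top hψ, fun 𝔞 h0 h => hv 𝔞 h0 h ?_, Or.inl rfl⟩
  rw [← Ideal.one_eq_top]
  exact isCoprime_one_right

namespace QuadraticData

variable (Q : QuadraticData σ)

/-! ### Discriminant `-8` -/

theorem exists_sqrt_neg_two (Q : QuadraticData σ) (h : discr K = -8) : ∃ r : 𝓞 K, r ^ 2 = -2 ∧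
    Q.s = 2 * r ∧ Q.conj r = -r ∧ (∀ x : 𝓞 K, ∃ a b : ℤ, x = a + b * r) ∧
    ∀ a b a' b' : ℤ, (a + b * r : 𝓞 K) = a' + b' * r → a = a' ∧ b = b' := by
  obtain ⟨θ, h1, h2, h0⟩ := Q.exists_two_mul_eq_s_sub (e := 0) (by rw [h]; norm_num)
  push_cast at h1
  have hs : Q.s = 2 * θ := by rw [h1]; ring
  refine ⟨θ, ?_, hs, ?_, h2, fun a b a' b' hab => ?_⟩
  · have h3 := Q.s_sq
    rw [h, hs] at h3
    push_cast at h3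
    have h4 : (4 : 𝓞 K) * (θ ^ 2 + 2) = 0 := by linear_combination h3
    have : θ ^ 2 + 2 = 0 := by simpa using h4
    linear_combination this
  · have h3 := Q.conj_s
    rw [hs, map_mul, map_ofNat] at h3
    have h4 : (2 : 𝓞 K) * (Q.conj θ + θ) = 0 := by linear_combination h3
    have : Q.conj θ + θ = 0 := by simpa using h4
    linear_combination this
  · obtain ⟨h3, h4⟩ := h0 0 (a - a') (b - b') (by
      have : ((a - a' : ℤ) + (b - b' : ℤ) * θ : 𝓞 K) = 0 := by push_cast; linear_combination hab
      rw [this]; exact zero_mem _)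
    exact ⟨by have := zero_dvd_iff.mp h3; omega, by have := zero_dvd_iff.mp h4; omega⟩

theorem prime_span_sqrt_neg_two (Q : QuadraticData σ) {r : 𝓞 K} (hr : r ^ 2 = -2)
    (hcr : Q.conj r = -r) : Prime (Ideal.span {r}) := by
  apply Q.prime_span_of_mul_conj Nat.prime_two
  rw [hcr]; push_cast
  linear_combination -hr

theorem ellipticConductor_of_discr_eq_neg_eight (Q : QuadraticData σ) (h : discr K = -8) {r : 𝓞 K}
    (hr : r ^ 2 = -2) (hs : Q.s = 2 * r) : ellipticConductor K = Ideal.span {r} ^ 5 := by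
  rw [ellipticConductor, if_neg (by rw [h]; norm_num), if_neg (by rw [h]; norm_num),
    Q.sqrtDiscIdeal_eq, Ideal.span_singleton_mul_span_singleton, Ideal.span_singleton_pow, hs]
  congr 2
  linear_combination -(r ^ 3 - 2 * r) * hr

/-- The units `±1` do not represent all residues modulo `4√-2`, so being `≡ 1` cannot single out a
generator as for `Δ = 3, 4`; membership in the sign subgroup does. -/
theorem exists_isHeckeCharacter_of_discr_eq_neg_eight [IsTotallyComplex K] (Q : QuadraticData σ)
    (h : discr K = -8) :
    ∃ ψ : Ideal (𝓞 K) →*₀ ℂ, IsHeckeCharacter σ (ellipticConductor K) 1 ψ ∧ Q.IsEquivariant ψ := by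
  have := Q.isPrincipalIdealRing (by rw [h]; norm_num)
  obtain ⟨r, hr, hs, hcr, hrep, hext⟩ := Q.exists_sqrt_neg_two h
  rw [Q.ellipticConductor_of_discr_eq_neg_eight h hr hs]
  have h𝔭 := Q.prime_span_sqrt_neg_two hr hcr
  let S : 𝓞 K → Prop := fun x => ∃ a b : ℤ, x = a + b * r ∧ signResidues a b
  have hinj : ∀ x y : 𝓞 K, x ≠ 0 → S x → S y → Ideal.span {x} = Ideal.span {y} → x = y := by
    rintro x y _ ⟨a, b, rfl, h1⟩ ⟨c, d, hy, h2⟩ hxy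
    obtain ⟨u, hu, rfl⟩ := exists_isUnit_eq_mul hxy
    rcases Q.unit_eq_one_or_neg_one (by rw [h]; norm_num) (by rw [h]; norm_num) hu with rfl | rfl
    · rw [one_mul]
    · obtain ⟨rfl, rfl⟩ := hext (-a) (-b) c d (by rw [← hy]; push_cast; ring)
      push_cast at h2
      exact absurd h2 (not_signResidues_neg _ _ h1)
  have hc : Q.conjIdeal (Ideal.span {r} ^ 5) = Ideal.span {r} ^ 5 := by
    rw [conjIdeal_pow, conjIdeal_span, hcr, Ideal.span_singleton_neg]
  obtain ⟨ψ, hψ, hv⟩ := exists_isHeckeCharacter_of_generator (σ := σ)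
    (pow_ne_zero 5 h𝔭.ne_zero) (l := 1) S
    (by
      rintro x y ⟨a, b, rfl, h1⟩ ⟨c, d, rfl, h2⟩
      refine ⟨a * c - 2 * b * d, a * d + b * c, ?_, ?_⟩
      · push_cast; linear_combination (b * d : 𝓞 K) * hr
      · push_cast; exact signResidues_mul _ _ _ _ h1 h2) hinj
    (fun 𝔞 h0 hc => by
      obtain ⟨x, rfl⟩ := IsPrincipalIdealRing.principal 𝔞
      have hx : x ∉ Ideal.span {r} := notMem_of_isCoprime_span h𝔭
        ((IsCoprime.pow_right_iff (by norm_num)).mp hc)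
      obtain ⟨a, b, rfl⟩ := hrep x
      have ha : Odd a := by
        by_contra ha
        obtain ⟨k, hk⟩ := even_iff_two_dvd.mp (Int.not_odd_iff_even.mp ha)
        apply hx
        rw [Ideal.mem_span_singleton', hk]
        exact ⟨b - k * r, by push_cast; linear_combination (-k : 𝓞 K) * hr⟩
      obtain ⟨c, rfl⟩ := ha
      rw [pow_one]
      rcases signResidues_or c b with h1 | h1
      · exact ⟨_, ⟨2 * c + 1, b, rfl, by push_cast; exact h1⟩, rfl⟩
      · refine ⟨-(((2 * c + 1 : ℤ) : 𝓞 K) + b * r), ⟨-(2 * c + 1), -b, by push_cast; ring, ?_⟩, ?_⟩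
        · push_cast; exact h1
        · rw [Ideal.span_singleton_neg])
    (fun α hα => by
      rw [Ideal.span_singleton_pow, Ideal.mem_span_singleton'] at hα
      obtain ⟨y, hy⟩ := hα
      obtain ⟨c, d, rfl⟩ := hrep y
      refine ⟨1 - 8 * d, 4 * c, ?_, ?_⟩
      · push_cast
        rw [pow_one]
        linear_combination -hy + ((c : 𝓞 K) + d * r) * (r ^ 3 - 2 * r) * hr + 4 * (d : 𝓞 K) * hr
      · push_cast; exact signResidues_one _ _)
  refine ⟨ψ, hψ, Q.isEquivariant_of_generator hψ hc ?_ hinj hv⟩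
  rintro x ⟨a, b, rfl, h1⟩
  refine ⟨a, -b, by simp [hcr], ?_⟩
  push_cast
  exact signResidues_conj _ _ h1

/-! ### Primitive characters attached to powers of elliptic Hecke characters -/

theorem pow_eq_of_unit {ψ : Ideal (𝓞 K) →*₀ ℂ} {α v : 𝓞 K} {l : ℕ}
    (h : ψ (Ideal.span {α}) * σ (v : K) = σ (α : K)) (hv : v ^ l = 1) :
    ψ (Ideal.span {α}) ^ l = σ (α : K) ^ l := by
  rw [← h, mul_pow, ← embedding_pow, hv]
  simp

/-- The ideal `(u)` is trivial, so a unit `u ≡ 1` with `u ^ l ≠ 1` obstructs a smaller modulus. -/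
theorem apply_span_unit_pow_ne {ψ : Ideal (𝓞 K) →*₀ ℂ} {u : 𝓞 K} (hu : IsUnit u) {l : ℕ}
    (h : u ^ l ≠ 1) : ψ (Ideal.span {u}) ^ l ≠ σ (u : K) ^ l := by
  rw [Ideal.span_singleton_eq_top.mpr hu, ← Ideal.one_eq_top, map_one, one_pow, ← embedding_pow]
  intro h1
  exact h (embedding_injective σ (by rw [← h1]; simp))

theorem isCoprime_span_unit {u : 𝓞 K} (hu : IsUnit u) (𝔪 : Ideal (𝓞 K)) :
    IsCoprime (Ideal.span {u}) 𝔪 := by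
  rw [Ideal.span_singleton_eq_top.mpr hu, ← Ideal.one_eq_top]
  exact isCoprime_one_left

/-- If `α ≡ v` mod `3` for a unit `v`, then `ψ₁ (α) = α / v`, so everything depends on `v ^ l`.
Units `≡ 1` mod `√-3` have `v ^ 3 = 1`. The obstructions are `-1` when `l ≡ 3` mod `6`, and `ζ ≡ 1`
mod `√-3` when `3 ∤ l`. -/
theorem exists_primitive_pow_of_discr_eq_neg_three (Q : QuadraticData σ) (h : discr K = -3) {l : ℕ}
    (hl : l ≠ 0) {ψ₁ : Ideal (𝓞 K) →*₀ ℂ} (hψ₁ : IsHeckeCharacter σ (ellipticConductor K) 1 ψ₁) :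
    ∃ ψ : Ideal (𝓞 K) →*₀ ℂ, HasConductor σ (canonicalConductor K l) l ψ ∧
      (∀ 𝔞, 𝔞 ≠ ⊥ → IsCoprime 𝔞 (ellipticConductor K) → ψ 𝔞 = ψ₁ 𝔞 ^ l) ∧
      (canonicalConductor K l = ⊤ ∨ ∀ 𝔞, IsCoprime 𝔞 (canonicalConductor K l) →
        IsCoprime 𝔞 (ellipticConductor K)) := by
  have h3 : Ideal.span {(3 : 𝓞 K)} = Ideal.span {Q.s} ^ 2 := by
    have := Q.span_s_sq (p := 3) (by simpa using h)
    rw [this]; rfl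
  have hE : ellipticConductor K = Ideal.span {Q.s} ^ 2 := by
    rw [ellipticConductor, if_pos h, h3]
  have h𝔭 := Q.prime_span_s Nat.prime_three (by simpa using h)
  have h𝔭N : Ideal.absNorm (Ideal.span {Q.s}) = 3 :=
    Q.absNorm_span_of_mul_conj (by
      have := Q.s_sq
      rw [h] at this
      rw [conj_s]; push_cast at this ⊢; linear_combination -this)
  have h2 : (2 : 𝓞 K) ∉ Ideal.span {Q.s} := by
    intro hm
    have h1 := Ideal.absNorm_dvd_absNorm_of_le ((Ideal.span_singleton_le_iff_mem _).mpr hm)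
    have h4 := Q.absNorm_span_natCast 2
    push_cast at h4
    rw [h𝔭N, h4] at h1
    norm_num at h1
  rw [hE] at hψ₁ ⊢
  have key : ∀ α : 𝓞 K, α ≠ 0 → IsCoprime (Ideal.span {α}) (Ideal.span {Q.s} ^ 2) →
      ∃ v, v ^ 6 = 1 ∧ α - v ∈ Ideal.span {Q.s} ∧ ψ₁ (Ideal.span {α}) * σ (v : K) = σ (α : K) := by
    intro α hα hc
    obtain ⟨v, hv, hm⟩ := Q.exists_unit_sub_mem_of_discr_eq_neg_three h (x := α) (by rwa [h3])
    rw [h3] at hm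
    exact ⟨v, Q.unit_pow_six h hv, Ideal.pow_le_self two_ne_zero hm,
      apply_span_mul_of_sub_unit_mem hψ₁ hα hv hm⟩
  rw [canonicalConductor, if_pos h]
  obtain ⟨ζ, hζ, hsζ, -⟩ := Q.exists_zeta h
  have hζ3 : ζ ^ 3 = 1 := by linear_combination (ζ - 1) * hζ
  have hζu : IsUnit ζ := isUnit_iff_exists_inv.mpr ⟨-1 - ζ, by linear_combination -hζ⟩
  by_cases hd : 3 ∣ l
  · rw [if_neg (not_not.mpr hd)]
    obtain ⟨m, rfl⟩ := hd
    by_cases ho : Odd (3 * m)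
    · rw [if_pos ho, Q.sqrtDiscIdeal_eq]
      have hneg : (-1 : 𝓞 K) ^ (3 * m) ≠ 1 := by
        rw [ho.neg_one_pow]
        intro h1
        have : (2 : 𝓞 K) = 0 := by linear_combination -h1
        exact two_ne_zero this
      have := exists_hasConductor_pow (k := 0) h𝔭 hl two_pos hψ₁ (fun α hα h1 hc => by
        obtain ⟨v, hv6, hm, hval⟩ := key α hα hc
        refine pow_eq_of_unit hval ?_
        rw [zero_add, pow_one] at h1
        have hv1 : v - 1 ∈ Ideal.span {Q.s} := by convert sub_mem h1 hm using 1; ring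
        have hv3 : v ^ 3 - 1 ∈ Ideal.span {Q.s} := by
          convert Ideal.mul_mem_left _ (v ^ 2 + v + 1) hv1 using 1; ring
        have : v ^ 3 = 1 := by
          rcases mul_self_eq_one_iff.mp (show v ^ 3 * v ^ 3 = 1 by rw [← hv6]; ring) with h4 | h4
          · exact h4
          · rw [h4] at hv3
            exact absurd (by convert neg_mem hv3 using 1; ring) h2
        rw [pow_mul, this, one_pow]) (α := -1) (by simp) (by simp)
        (isCoprime_span_unit (by simp) _) (apply_span_unit_pow_ne (by simp) hneg)
      simpa using this
    · rw [if_neg ho]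
      refine exists_hasConductor_top hl hψ₁ fun α hα hc => ?_
      obtain ⟨v, hv6, -, hval⟩ := key α hα hc
      refine pow_eq_of_unit hval ?_
      obtain ⟨k, hk⟩ : 6 ∣ 3 * m := by
        rw [Nat.not_odd_iff_even] at ho
        have := even_iff_two_dvd.mp ho
        omega
      rw [hk, pow_mul, hv6, one_pow]
  · rw [if_pos hd, h3]
    refine exists_hasConductor_pow (k := 1) h𝔭 hl two_pos hψ₁ (fun α hα h1 hc => by
      rw [hψ₁.map_principal α hα h1, pow_one]) (α := ζ) hζu.ne_zero ?_
      (isCoprime_span_unit hζu _) (apply_span_unit_pow_ne hζu ?_)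
    · rw [pow_one, Ideal.mem_span_singleton']
      exact ⟨1 + ζ, by rw [hsζ]; linear_combination 2 * hζ⟩
    · intro h1
      have hg : ζ ^ Nat.gcd 3 l = 1 := pow_gcd_eq_one.mpr ⟨hζ3, h1⟩
      rw [(Nat.Prime.coprime_iff_not_dvd Nat.prime_three).mpr hd, pow_one] at hg
      rw [hg] at hζ
      norm_num at hζ

/-- Again `ψ₁ (α) = α / v` for a unit `v`. The obstructions are `-1 ≡ 1` mod `2` for odd `l`, and `i
≡ 1` mod `1 + i` for `l ≡ 2` mod `4`. -/
theorem exists_primitive_pow_of_discr_eq_neg_four (Q : QuadraticData σ) (h : discr K = -4) {l : ℕ}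
    (hl : l ≠ 0) {ψ₁ : Ideal (𝓞 K) →*₀ ℂ} (hψ₁ : IsHeckeCharacter σ (ellipticConductor K) 1 ψ₁) :
    ∃ ψ : Ideal (𝓞 K) →*₀ ℂ, HasConductor σ (canonicalConductor K l) l ψ ∧
      (∀ 𝔞, 𝔞 ≠ ⊥ → IsCoprime 𝔞 (ellipticConductor K) → ψ 𝔞 = ψ₁ 𝔞 ^ l) ∧
      (canonicalConductor K l = ⊤ ∨ ∀ 𝔞, IsCoprime 𝔞 (canonicalConductor K l) →
        IsCoprime 𝔞 (ellipticConductor K)) := by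
  have h3 : discr K ≠ -3 := by rw [h]; norm_num
  obtain ⟨i, hi, hs, hci, -⟩ := Q.exists_sqrt_neg_one h
  have hT := Q.twoAddTwoI_eq h hi hs
  have hE : ellipticConductor K = Ideal.span {1 + i} ^ 3 := by
    rw [ellipticConductor, if_neg h3, if_pos h, hT]
  have h𝔭 := Q.prime_span_one_add_i hi hci
  have hiu : IsUnit i := isUnit_iff_exists_inv.mpr ⟨-i, by linear_combination -hi⟩
  have h22 : Ideal.span {(2 : 𝓞 K)} = Ideal.span {1 + i} ^ 2 := by
    rw [Ideal.span_singleton_pow, ← Ideal.span_singleton_mul_left_unit hiu 2]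
    congr 2
    linear_combination -hi
  have hne2 : (-1 : 𝓞 K) ≠ 1 := fun h1 => two_ne_zero (by linear_combination -h1 : (2 : 𝓞 K) = 0)
  rw [hE] at hψ₁ ⊢
  have key : ∀ α : 𝓞 K, α ≠ 0 → IsCoprime (Ideal.span {α}) (Ideal.span {1 + i} ^ 3) →
      ∃ v, v ^ 4 = 1 ∧ α - v ∈ Ideal.span {1 + i} ^ 2 ∧
        ψ₁ (Ideal.span {α}) * σ (v : K) = σ (α : K) := by
    intro α hα hc
    obtain ⟨v, hv, hm⟩ := Q.exists_unit_sub_mem_of_discr_eq_neg_four h (by rwa [hT])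
    rw [hT] at hm
    exact ⟨v, Q.unit_pow_four h hv, Ideal.pow_le_pow_right (by norm_num) hm,
      apply_span_mul_of_sub_unit_mem hψ₁ hα hv hm⟩
  rw [canonicalConductor, if_neg h3, if_pos h]
  by_cases ho : Odd l
  · rw [if_pos ho, hT]
    refine exists_hasConductor_pow (k := 2) h𝔭 hl three_pos hψ₁ (fun α hα h1 hc => by
      rw [hψ₁.map_principal α hα h1, pow_one]) (α := -1) (by simp) ?_
      (isCoprime_span_unit (by simp) _) (apply_span_unit_pow_ne (by simp) ?_)
    · rw [← h22, Ideal.mem_span_singleton']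
      exact ⟨-1, by ring⟩
    · rw [ho.neg_one_pow]; exact hne2
  · rw [if_neg ho]
    obtain ⟨m, rfl⟩ := even_iff_two_dvd.mp (Nat.not_odd_iff_even.mp ho)
    by_cases h4 : 4 ∣ 2 * m
    · rw [if_neg (not_not.mpr h4)]
      refine exists_hasConductor_top hl hψ₁ fun α hα hc => ?_
      obtain ⟨v, hv4, -, hval⟩ := key α hα hc
      refine pow_eq_of_unit hval ?_
      obtain ⟨k, hk⟩ := h4
      rw [hk, pow_mul, hv4, one_pow]
    · rw [if_pos h4, h22]
      refine exists_hasConductor_pow (k := 1) h𝔭 hl three_pos hψ₁ (fun α hα h1 hc => ?_)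
        (α := i) hiu.ne_zero ?_ (isCoprime_span_unit hiu _) (apply_span_unit_pow_ne hiu ?_)
      · obtain ⟨v, hv4, hm, hval⟩ := key α hα hc
        refine pow_eq_of_unit hval ?_
        have hv1 : v - 1 ∈ Ideal.span {1 + i} ^ 2 := by convert sub_mem h1 hm using 1; ring
        rw [← h22, Ideal.mem_span_singleton'] at hv1
        obtain ⟨z, hz⟩ := hv1
        have hv2 : v ^ 2 = 1 := by
          rcases mul_self_eq_one_iff.mp (show v ^ 2 * v ^ 2 = 1 by rw [← hv4]; ring) with h5 | h5
          · exact h5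
          -- With `v = 1 + 2 z`, the equation `v ^ 2 = -1` becomes `2 (z ^ 2 + z) = -1`, making `2`
          -- a unit.
          · exfalso
            have h6 : 2 * (z * z + z) = -1 := by
              have : (2 : 𝓞 K) * (2 * (z * z + z) + 1) = 0 := by
                linear_combination h5 + (v + 1 + 2 * z) * hz
              have := (mul_eq_zero.mp this).resolve_left two_ne_zero
              linear_combination this
            have h7 : IsUnit (2 : 𝓞 K) := isUnit_iff_exists_inv.mpr
              ⟨-(z * z + z), by linear_combination -h6⟩
            have h8 := Q.unit_norm h7
            rw [map_ofNat] at h8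
            norm_num at h8
        rw [pow_mul, hv2, one_pow]
      · rw [pow_one, Ideal.mem_span_singleton']
        exact ⟨i, by linear_combination hi⟩
      · have hm : Odd m := by
          rw [← Nat.not_even_iff_odd]
          rintro ⟨k, rfl⟩
          exact h4 ⟨k, by ring⟩
        rw [pow_mul, hi, hm.neg_one_pow]
        exact hne2

/-- For even `l` the sign in `ψ₁ (α) = ± α` disappears. For odd `l` the obstruction is `5 ≡ 1` mod
`(√-2) ^ 4`: equivariance gives `ψ₁ (5) = (-8/5) 5 = -5`. -/
theorem exists_primitive_pow_of_discr_eq_neg_eight (Q : QuadraticData σ) (h : discr K = -8) {l : ℕ}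
    (hl : l ≠ 0) {ψ₁ : Ideal (𝓞 K) →*₀ ℂ} (hψ₁ : IsHeckeCharacter σ (ellipticConductor K) 1 ψ₁)
    (he : Q.IsEquivariant ψ₁) :
    ∃ ψ : Ideal (𝓞 K) →*₀ ℂ, HasConductor σ (canonicalConductor K l) l ψ ∧
      (∀ 𝔞, 𝔞 ≠ ⊥ → IsCoprime 𝔞 (ellipticConductor K) → ψ 𝔞 = ψ₁ 𝔞 ^ l) ∧
      (canonicalConductor K l = ⊤ ∨ ∀ 𝔞, IsCoprime 𝔞 (canonicalConductor K l) →
        IsCoprime 𝔞 (ellipticConductor K)) := by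
  have h3 : discr K ≠ -3 := by rw [h]; norm_num
  have h4 : discr K ≠ -4 := by rw [h]; norm_num
  obtain ⟨r, hr, hs, hcr, -, -⟩ := Q.exists_sqrt_neg_two h
  have hE := Q.ellipticConductor_of_discr_eq_neg_eight h hr hs
  have h𝔭 := Q.prime_span_sqrt_neg_two hr hcr
  rw [canonicalConductor, if_neg h3, if_neg h4]
  by_cases hev : Even l
  · rw [if_pos hev]
    refine exists_hasConductor_top hl hψ₁ fun α hα hc => ?_
    obtain ⟨x, hx, -⟩ := he (Ideal.span {α})
    have h1 := hψ₁.span_eq_pow (hψ₁.apply_ne_zero (span_ne_bot hα) hc) hx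
    rw [pow_one] at h1
    obtain ⟨u, hu, rfl⟩ := exists_isUnit_eq_mul h1.symm
    rw [hx]
    rcases Q.unit_eq_one_or_neg_one h3 h4 hu with rfl | rfl
    · simp
    · rw [embedding_mul, mul_pow]; simp [hev.neg_one_pow]
  · have hE' : Ideal.span {2} * sqrtDiscIdeal K = ellipticConductor K := by
      rw [ellipticConductor, if_neg h3, if_neg h4]
    rw [if_neg hev, if_pos h, hE', hE]
    have ho := Nat.not_even_iff_odd.mp hev
    have h8 : ((8 : ℕ) : 𝓞 K) ∈ Ideal.span {r} ^ 5 := by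
      rw [Ideal.span_singleton_pow, Ideal.mem_span_singleton']
      exact ⟨-r, by push_cast; linear_combination -(r ^ 4 - 2 * r ^ 2 + 4) * hr⟩
    rw [hE] at hψ₁
    have h5 := Q.apply_span_natCast hψ₁ he (by norm_num) h8 (a := 5) (by decide) (by norm_num)
      (by rw [h]; norm_num)
    have hJ : jacobiSym (discr K) 5 = -1 := by rw [h]; norm_num
    rw [hJ, pow_one] at h5
    push_cast at h5
    refine exists_hasConductor_pow (k := 4) h𝔭 hl (by norm_num) hψ₁ (fun α hα h1 hc => by
      rw [hψ₁.map_principal α hα h1, pow_one]) (α := 5) (by norm_num) ?_ ?_ ?_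
    · rw [Ideal.span_singleton_pow, Ideal.mem_span_singleton']
      exact ⟨1, by linear_combination (r ^ 2 - 2) * hr⟩
    · refine isCoprime_span_iff.mpr ⟨1, ?_⟩
      rw [Ideal.mem_span_singleton']
      exact ⟨-2 * r, by linear_combination -2 * hr⟩
    · rw [h5, neg_mul, one_mul, ho.neg_pow]
      have : σ ((5 : 𝓞 K) : K) = 5 := map_ofNat σ 5
      rw [this]
      intro h6
      have h7 : (5 : ℂ) ^ l ≠ 0 := pow_ne_zero l (by norm_num)
      exact h7 (by linear_combination -(1 / 2) * h6)

end QuadraticData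

theorem IsHeckeCharacter.ext {𝔪 : Ideal (𝓞 K)} {l : ℕ} {ψ ψ' : Ideal (𝓞 K) →*₀ ℂ}
    (hψ : IsHeckeCharacter σ 𝔪 l ψ) (hψ' : IsHeckeCharacter σ 𝔪 l ψ')
    (h : ∀ 𝔞, 𝔞 ≠ ⊥ → IsCoprime 𝔞 𝔪 → ψ 𝔞 = ψ' 𝔞) (𝔞 : Ideal (𝓞 K)) : ψ 𝔞 = ψ' 𝔞 := by
  by_cases h0 : 𝔞 ≠ ⊥ ∧ IsCoprime 𝔞 𝔪
  · exact h 𝔞 h0.1 h0.2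
  · rw [not_not.mp (mt (hψ.ne_zero_iff 𝔞).mp h0), not_not.mp (mt (hψ'.ne_zero_iff 𝔞).mp h0)]

/-- The ideals prime to the modulus represent all ideal classes, so if `ψ` takes integral values,
then `l` annihilates the class group. -/
theorem IsHeckeCharacter.exists_pow_eq_span {𝔪 : Ideal (𝓞 K)} {l : ℕ} {ψ : Ideal (𝓞 K) →*₀ ℂ}
    (hψ : IsHeckeCharacter σ 𝔪 l ψ) (hv : ∀ 𝔞, ∃ x : 𝓞 K, ψ 𝔞 = σ (x : K)) {𝔞 : Ideal (𝓞 K)}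
    (h0 : 𝔞 ≠ ⊥) : ∃ x : 𝓞 K, 𝔞 ^ l = Ideal.span {x} := by
  obtain ⟨𝔟, γ, h1, h2⟩ := exists_isCoprime_mul_eq_span (𝔪 := 𝔪 * Ideal.span {2}) h0
    (mul_ne_zero hψ.modulus_ne_bot (span_ne_bot two_ne_zero))
  have hb : 𝔟 ≠ ⊥ := by
    rintro rfl
    exact not_isCoprime_bot h2
  replace h2 := IsCoprime.of_mul_right_left h2
  have hb0 := hψ.apply_ne_zero hb h2
  obtain ⟨y, hy⟩ := hv 𝔟
  have h3 := hψ.span_eq_pow hb0 hy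
  have hy0 : y ≠ 0 := by
    rintro rfl
    rw [hy] at hb0
    simp at hb0
  obtain ⟨z, hz, -⟩ := exists_eq_span_of_span_mul_eq (I := 𝔞 ^ l) (y := γ ^ l) hy0 (by
    rw [h3, ← mul_pow, mul_comm, h1, Ideal.span_singleton_pow])
  exact ⟨z, hz⟩

namespace QuadraticData

variable (Q : QuadraticData σ)

/-! ### Canonical characters for the discriminants `-3`, `-4` and `-8` -/

/-- The last alternative controls the ideals where `ψ₁` vanishes: either `ψ` is unramified
everywhere or it vanishes there too. -/
theorem exists_primitive_pow (Q : QuadraticData σ)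
    (h : discr K = -3 ∨ discr K = -4 ∨ discr K = -8) {l : ℕ}
    (hl : l ≠ 0) {ψ₁ : Ideal (𝓞 K) →*₀ ℂ} (hψ₁ : IsHeckeCharacter σ (ellipticConductor K) 1 ψ₁)
    (he : Q.IsEquivariant ψ₁) :
    ∃ ψ : Ideal (𝓞 K) →*₀ ℂ, HasConductor σ (canonicalConductor K l) l ψ ∧
      (∀ 𝔞, 𝔞 ≠ ⊥ → IsCoprime 𝔞 (ellipticConductor K) → ψ 𝔞 = ψ₁ 𝔞 ^ l) ∧
      (canonicalConductor K l = ⊤ ∨ ∀ 𝔞, IsCoprime 𝔞 (canonicalConductor K l) →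
        IsCoprime 𝔞 (ellipticConductor K)) := by
  rcases h with h | h | h
  · exact Q.exists_primitive_pow_of_discr_eq_neg_three h hl hψ₁
  · exact Q.exists_primitive_pow_of_discr_eq_neg_four h hl hψ₁
  · exact Q.exists_primitive_pow_of_discr_eq_neg_eight h hl hψ₁ he

theorem canonicalConductor_one (h : discr K = -3 ∨ discr K = -4 ∨ discr K = -8) :
    canonicalConductor K 1 = ellipticConductor K := by
  rcases h with h | h | h <;> simp [canonicalConductor, ellipticConductor, h]

/-- The power statement for `l = 1` returns the same character, now with its modulus known to be the
conductor. -/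
theorem exists_elliptic [IsTotallyComplex K] (Q : QuadraticData σ)
    (h : discr K = -3 ∨ discr K = -4 ∨ discr K = -8) :
    ∃ ψ₁ : Ideal (𝓞 K) →*₀ ℂ, HasConductor σ (ellipticConductor K) 1 ψ₁ ∧ Q.IsEquivariant ψ₁ := by
  obtain ⟨ψ₁, hψ₁, he⟩ : ∃ ψ : Ideal (𝓞 K) →*₀ ℂ,
      IsHeckeCharacter σ (ellipticConductor K) 1 ψ ∧ Q.IsEquivariant ψ := by
    have := Q.isPrincipalIdealRing (by rcases h with h | h | h <;> rw [h] <;> norm_num)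
    rcases h with h | h | h
    · have hE : ellipticConductor K = Ideal.span {(3 : 𝓞 K)} := by rw [ellipticConductor, if_pos h]
      rw [hE]
      refine Q.exists_isHeckeCharacter_of_units ?_ (by rw [conjIdeal_span, map_ofNat])
        fun x hx => Q.exists_unit_sub_mem_of_discr_eq_neg_three h hx
      have := Q.absNorm_span_natCast 3
      push_cast at this
      rw [this]; norm_num
    · have hE : ellipticConductor K = twoAddTwoI K := by
        rw [ellipticConductor, if_neg (by rw [h]; norm_num), if_pos h]
      rw [hE]
      obtain ⟨i, hi, hs, hci, -⟩ := Q.exists_sqrt_neg_one h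
      refine Q.exists_isHeckeCharacter_of_units ?_ ?_
        fun x hx => Q.exists_unit_sub_mem_of_discr_eq_neg_four h hx
      · rw [Q.twoAddTwoI_eq h hi hs, map_pow, Q.absNorm_span_of_mul_conj (n := 2) (by
          rw [map_add, map_one, hci]; push_cast; linear_combination -hi)]
        norm_num
      · rw [Q.twoAddTwoI_eq h hi hs, conjIdeal_pow, conjIdeal_span, map_add, map_one, hci]
        congr 1
        rw [← Ideal.span_singleton_mul_left_unit (a := -i) (isUnit_iff_exists_inv.mpr
          ⟨i, by linear_combination -hi⟩) (1 + i)]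
        congr 2
        linear_combination hi
    · exact Q.exists_isHeckeCharacter_of_discr_eq_neg_eight h
  obtain ⟨ψ, hψ, hv, -⟩ := Q.exists_primitive_pow h one_ne_zero hψ₁ he
  rw [canonicalConductor_one h] at hψ
  refine ⟨ψ, hψ, fun 𝔞 => ?_⟩
  have hext := hψ.1.ext hψ₁ fun 𝔞 h0 hc => by rw [hv 𝔞 h0 hc, pow_one]
  rw [hext, hext]
  exact he 𝔞

theorem IsEquivariant.apply_conjIdeal_ne_zero {Q : QuadraticData σ} {ψ : Ideal (𝓞 K) →*₀ ℂ}
    (he : Q.IsEquivariant ψ) {𝔞 : Ideal (𝓞 K)} (h : ψ 𝔞 ≠ 0) : ψ (Q.conjIdeal 𝔞) ≠ 0 := by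
  obtain ⟨x, h1, h2⟩ := he 𝔞
  rw [h2]
  refine embedding_ne_zero σ fun h3 => h ?_
  rw [h1, (EmbeddingLike.map_eq_zero_iff (f := Q.conj)).mp h3]
  simp

theorem IsEquivariant.apply_conjIdeal_eq_zero {Q : QuadraticData σ} {ψ : Ideal (𝓞 K) →*₀ ℂ}
    (he : Q.IsEquivariant ψ) {𝔞 : Ideal (𝓞 K)} (h : ψ 𝔞 = 0) : ψ (Q.conjIdeal 𝔞) = 0 := by
  by_contra h1
  have := he.apply_conjIdeal_ne_zero h1
  rw [Q.conjIdeal_conjIdeal] at this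
  exact this h

/-- Uniqueness identifies `𝔣`. Equivariance is inherited from `ψ₁` where it is nonzero; elsewhere
`ψ` vanishes, or `𝔣 = ⊤` and every value is `ψ (x) = x ^ l`. -/
theorem isEquivariant_and_eq_of_elliptic [IsTotallyComplex K] (Q : QuadraticData σ)
    (h : discr K = -3 ∨ discr K = -4 ∨ discr K = -8) {l : ℕ}
    (hl : l ≠ 0) {ψ₁ ψ : Ideal (𝓞 K) →*₀ ℂ} {𝔣 : Ideal (𝓞 K)}
    (hψ₁ : IsHeckeCharacter σ (ellipticConductor K) 1 ψ₁)
    (he : Q.IsEquivariant ψ₁) (hψ : HasConductor σ 𝔣 l ψ)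
    (hv : ∀ 𝔞, ψ₁ 𝔞 ≠ 0 → ψ 𝔞 = ψ₁ 𝔞 ^ l) :
    Q.IsEquivariant ψ ∧ 𝔣 = canonicalConductor K l := by
  obtain ⟨ψ', hψ', hv', htop⟩ := Q.exists_primitive_pow h hl hψ₁ he
  obtain rfl := hψ.unique hψ' hψ₁.modulus_ne_bot fun 𝔞 h0 hc _ _ => by
    rw [hv' 𝔞 h0 hc, hv 𝔞 (hψ₁.apply_ne_zero h0 hc)]
  refine ⟨fun 𝔞 => ?_, rfl⟩
  by_cases h1 : ψ₁ 𝔞 = 0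
  · have h2 := he.apply_conjIdeal_eq_zero h1
    rcases htop with htop | hE
    · have := Q.isPrincipalIdealRing (by rcases h with h | h | h <;> rw [h] <;> norm_num)
      obtain ⟨x, rfl⟩ := IsPrincipalIdealRing.principal 𝔞
      have hx : ∀ x : 𝓞 K, ψ (Ideal.span {x}) = σ ((x ^ l : 𝓞 K) : K) := by
        intro x
        by_cases hx : x = 0
        · subst hx
          rw [Ideal.span_singleton_eq_bot.mpr rfl, zero_pow hl, ← Ideal.zero_eq_bot, map_zero]
          simp
        · rw [hψ.1.map_principal x hx (by rw [htop]; trivial), embedding_pow]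
      refine ⟨x ^ l, hx x, ?_⟩
      rw [map_pow, ← hx, ← Q.conjIdeal_span]
    · have h0 : ∀ 𝔟, ψ₁ 𝔟 = 0 → ψ 𝔟 = 0 := by
        intro 𝔟 hb
        by_contra hne
        obtain ⟨hb0, hbc⟩ := (hψ.1.ne_zero_iff 𝔟).mp hne
        exact hψ₁.apply_ne_zero hb0 (hE 𝔟 hbc) hb
      exact ⟨0, by rw [h0 _ h1]; simp, by rw [h0 _ h2]; simp⟩
  · obtain ⟨x, hx, hx'⟩ := he 𝔞
    refine ⟨x ^ l, by rw [hv 𝔞 h1, hx, embedding_pow], ?_⟩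
    rw [hv _ (he.apply_conjIdeal_ne_zero h1), hx', map_pow, embedding_pow]

/-! ### Prime discriminants -/

/-- Every integer is congruent to a rational one modulo the square root of an odd discriminant. -/
theorem exists_intCast_sub_mem (Q : QuadraticData σ) (h : Odd (discr K)) (x : 𝓞 K) :
    ∃ a : ℤ, x - a ∈ Ideal.span {Q.s} := by
  obtain ⟨t, ht⟩ := Q.s_eq
  obtain ⟨c, hc⟩ := h
  obtain ⟨a, b, rfl⟩ := Q.exists_repr x
  have hd := Q.s_sq
  rw [hc] at hd
  push_cast at hd
  refine ⟨a - b * c * t, Ideal.mem_span_singleton'.mpr ⟨b * (Q.ω * Q.s - c), ?_⟩⟩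
  push_cast
  linear_combination (b : 𝓞 K) * Q.ω * hd - (b : 𝓞 K) * c * ht

variable {p : ℕ}

theorem intCast_mem_span_s (Q : QuadraticData σ) (hp : p.Prime) (h : discr K = -p) {a : ℤ} :
    (a : 𝓞 K) ∈ Ideal.span {Q.s} ↔ (p : ℤ) ∣ a := by
  have hs := Q.s_sq
  rw [h] at hs
  push_cast at hs
  constructor
  · intro hm
    obtain ⟨y, hy⟩ := Ideal.mem_span_singleton'.mp hm
    obtain ⟨n, hn⟩ := Q.exists_norm y
    have h1 : ((a ^ 2 : ℤ) : 𝓞 K) = ((p * n : ℤ) : 𝓞 K) := by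
      have h2 := congrArg Q.conj hy
      rw [map_mul, conj_s, map_intCast] at h2
      push_cast
      rw [sq]
      nth_rewrite 2 [← h2]
      rw [← hy, ← hn]
      linear_combination -(y * Q.conj y) * hs
    exact (Nat.prime_iff_prime_int.mp hp).dvd_of_dvd_pow ⟨n, intCast_injective K h1⟩
  · rintro ⟨k, rfl⟩
    exact Ideal.mem_span_singleton'.mpr ⟨-(k * Q.s), by push_cast; linear_combination -(k : 𝓞 K) * hs⟩

theorem jacobiSym_eq_of_sub_mem (Q : QuadraticData σ) (hp : p.Prime) (h : discr K = -p) {x : 𝓞 K}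
    {a b : ℤ} (ha : x - a ∈ Ideal.span {Q.s}) (hb : x - b ∈ Ideal.span {Q.s}) :
    jacobiSym a p = jacobiSym b p := by
  apply jacobiSym.mod_left'
  rw [← Int.ModEq, Int.modEq_iff_dvd, ← Q.intCast_mem_span_s hp h]
  convert sub_mem ha hb using 1
  push_cast; ring

theorem isCoprime_span_s_iff (Q : QuadraticData σ) (hp : p.Prime) (h : discr K = -p) {x : 𝓞 K}
    {a : ℤ} (ha : x - a ∈ Ideal.span {Q.s}) :
    IsCoprime (Ideal.span {x}) (Ideal.span {Q.s}) ↔ jacobiSym a p ≠ 0 := by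
  have : NeZero p := ⟨hp.ne_zero⟩
  rw [Ne, jacobiSym.eq_zero_iff_not_coprime, not_not]
  constructor
  · intro hc
    have hx := notMem_of_isCoprime_span (Q.prime_span_s hp h) hc
    rw [Int.gcd_comm, ← Int.isCoprime_iff_gcd_eq_one,
      (Nat.prime_iff_prime_int.mp hp).coprime_iff_not_dvd, ← Q.intCast_mem_span_s hp h]
    intro hm
    exact hx (by convert add_mem ha hm using 1; ring)
  · intro hc
    obtain ⟨u, v, huv⟩ := Int.isCoprime_iff_gcd_eq_one.mpr hc
    refine isCoprime_span_iff.mpr ⟨u, ?_⟩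
    have h1 := (Q.intCast_mem_span_s hp h).mpr (dvd_mul_left (p : ℤ) v)
    have huv' : (u : 𝓞 K) * a + v * p = 1 := by exact_mod_cast huv
    convert sub_mem (Ideal.mul_mem_left _ (u : 𝓞 K) ha) h1 using 1
    push_cast
    linear_combination huv'

/-- For odd `l` modulus one is impossible, as `ψ (-1) = 1` is not `(-1) ^ l`. -/
theorem hasConductor_span_s (Q : QuadraticData σ) (hp : p.Prime) (h : discr K = -p) {l : ℕ}
    (hl : Odd l) {ψ : Ideal (𝓞 K) →*₀ ℂ} (hψ : IsHeckeCharacter σ (Ideal.span {Q.s}) l ψ) :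
    HasConductor σ (Ideal.span {Q.s}) l ψ := by
  have := hasConductor_pow (k := 0) (Q.prime_span_s hp h) (ψ := ψ) (l := l) (α := -1)
    (by simpa using hψ) (by simp) (by simp) (isCoprime_span_unit (by simp) _) (by
      rw [Ideal.span_singleton_neg, Ideal.span_singleton_one, ← Ideal.one_eq_top, map_one]
      have h1 : σ ((-1 : 𝓞 K) : K) = -1 := by simp
      rw [h1, hl.neg_one_pow]
      norm_num)
  simpa using this

/-! ### Canonical characters for the other discriminants -/

/-- From `ψ 𝔞 ψ 𝔞̄ = N 𝔞 ^ l = |ψ 𝔞| ^ 2` one gets that `ψ 𝔞̄` is the complex conjugate of `ψ 𝔞`. -/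
theorem isEquivariant_of_apply_span_natCast (Q : QuadraticData σ) {𝔣 : Ideal (𝓞 K)} {l : ℕ}
    {ψ : Ideal (𝓞 K) →*₀ ℂ} (hψ : IsHeckeCharacter σ 𝔣 l ψ) (h𝔣 : Q.conjIdeal 𝔣 = 𝔣)
    (hv : ∀ 𝔞, ∃ x : 𝓞 K, ψ 𝔞 = σ (x : K))
    (hN : ∀ 𝔞, ψ 𝔞 ≠ 0 → ψ (Ideal.span {(Ideal.absNorm 𝔞 : 𝓞 K)}) = (Ideal.absNorm 𝔞 : ℂ) ^ l) :
    Q.IsEquivariant ψ := by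
  intro 𝔞
  obtain ⟨x, hx⟩ := hv 𝔞
  refine ⟨x, hx, ?_⟩
  by_cases h0 : ψ 𝔞 = 0
  · have h1 : ψ (Q.conjIdeal 𝔞) = 0 := by
      by_contra hne
      obtain ⟨h2, h3⟩ := (hψ.ne_zero_iff _).mp hne
      rw [← h𝔣, isCoprime_conjIdeal] at h3
      exact hψ.apply_ne_zero (fun h => h2 (Q.conjIdeal_eq_bot.mpr h)) h3 h0
    have hx0 : x = 0 := by
      by_contra hne
      exact embedding_ne_zero σ hne (by rw [← hx, h0])
    rw [h1, hx0, map_zero]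
    simp
  · have h1 := hN 𝔞 h0
    rw [← Q.mul_conjIdeal, map_mul] at h1
    have h2 := Q.normSq_apply hψ h0
    rw [Q.map_conj, ← hx]
    apply mul_left_cancel₀ h0
    rw [h1, Complex.mul_conj, h2]
    push_cast; rfl

/-- Some power of each nonzero ideal is principal, so `ψ` vanishes at none of them and is a Hecke
character modulo `⊤`. -/
theorem isEquivariant_and_eq_top (Q : QuadraticData σ) {𝔣 : Ideal (𝓞 K)} {l : ℕ}
    {ψ : Ideal (𝓞 K) →*₀ ℂ} (hψ : HasConductor σ 𝔣 l ψ)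
    (hv : ∀ 𝔞, ∃ x : 𝓞 K, ψ 𝔞 = σ (x : K))
    (hp : ∀ α : 𝓞 K, α ≠ 0 → ψ (Ideal.span {α}) = σ (α : K) ^ l) :
    Q.IsEquivariant ψ ∧ 𝔣 = ⊤ := by
  have h0 : ∀ 𝔞, 𝔞 ≠ ⊥ → ψ 𝔞 ≠ 0 := by
    intro 𝔞 ha hz
    obtain ⟨k, hk, hk'⟩ := CMHecke.exists_pow_eq_span K
    obtain ⟨α, hα⟩ := hk' 𝔞
    have hα0 : α ≠ 0 := by
      rintro rfl
      rw [Ideal.span_singleton_eq_bot.mpr rfl] at hα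
      exact pow_ne_zero k ha hα
    have h1 := hp α hα0
    rw [← hα, map_pow, hz, zero_pow hk] at h1
    exact pow_ne_zero l (embedding_ne_zero σ hα0) h1.symm
  have hψ' : IsHeckeCharacter σ ⊤ l ψ := ⟨top_ne_bot, fun 𝔞 => ⟨fun h => ⟨by
    rintro rfl
    rw [← Ideal.zero_eq_bot, map_zero] at h
    exact h rfl, by rw [← Ideal.one_eq_top]; exact isCoprime_one_right⟩, fun h => h0 𝔞 h.1⟩,
    fun α hα _ => hp α hα⟩
  refine ⟨Q.isEquivariant_of_apply_span_natCast hψ' Q.conjIdeal_top hv fun 𝔞 ha => ?_,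
    hψ.unique (hasConductor_top hψ') top_ne_bot fun _ _ _ _ _ => rfl⟩
  rw [hp, embedding_natCast]
  have h1 : Ideal.absNorm 𝔞 ≠ 0 := by
    rw [Ne, Ideal.absNorm_eq_zero_iff]
    exact ((hψ'.ne_zero_iff 𝔞).mp ha).1
  exact_mod_cast h1

/-- The formula at principal ideals determines where `ψ` vanishes and makes it a Hecke character
modulo `√-p`. For equivariance one needs that norms of ideals prime to `p` are squares modulo `p`.
-/
theorem isEquivariant_and_eq_span_s (Q : QuadraticData σ) (hp : p.Prime) (hp2 : p ≠ 2)
    (h : discr K = -p) {𝔣 : Ideal (𝓞 K)} {l : ℕ} (hl : Odd l)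
    {ψ : Ideal (𝓞 K) →*₀ ℂ} (hψ : HasConductor σ 𝔣 l ψ)
    (hv : ∀ 𝔞, ∃ x : 𝓞 K, ψ 𝔞 = σ (x : K))
    (hval : ∀ (α : 𝓞 K) (a : ℤ), α - a ∈ Ideal.span {Q.s} →
      ψ (Ideal.span {α}) = ((jacobiSym a p : ℂ) * σ (α : K)) ^ l) :
    Q.IsEquivariant ψ ∧ 𝔣 = Ideal.span {Q.s} := by
  have hodd : Odd (discr K) := by
    rw [h, odd_neg]; exact_mod_cast hp.odd_of_ne_two hp2
  have hl0 : l ≠ 0 := hl.pos.ne'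
  have h0 : ∀ 𝔞, ψ 𝔞 ≠ 0 ↔ 𝔞 ≠ ⊥ ∧ IsCoprime 𝔞 (Ideal.span {Q.s}) := by
    intro 𝔞
    obtain ⟨k, hk, hk'⟩ := CMHecke.exists_pow_eq_span K
    obtain ⟨α, hα⟩ := hk' 𝔞
    obtain ⟨a, ha⟩ := Q.exists_intCast_sub_mem hodd α
    have h1 : ψ 𝔞 ≠ 0 ↔ ψ (Ideal.span {α}) ≠ 0 := by
      rw [← hα, map_pow]; exact (pow_ne_zero_iff hk).symm
    have h2 : IsCoprime 𝔞 (Ideal.span {Q.s}) ↔ IsCoprime (Ideal.span {α}) (Ideal.span {Q.s}) := by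
      rw [← hα]; exact (IsCoprime.pow_left_iff (Nat.pos_of_ne_zero hk)).symm
    have h3 : 𝔞 ≠ ⊥ ↔ α ≠ 0 := by
      rw [Ne, Ne, ← Ideal.span_singleton_eq_bot, ← hα, ← Ideal.zero_eq_bot, pow_eq_zero_iff hk]
    rw [h1, h2, h3, hval α a ha, Q.isCoprime_span_s_iff hp h ha, pow_ne_zero_iff hl0,
      mul_ne_zero_iff, and_comm]
    refine and_congr ⟨fun h4 h5 => h4 (by rw [h5]; simp), embedding_ne_zero σ⟩ ?_
    rw [Int.cast_ne_zero]
  have hψ' : IsHeckeCharacter σ (Ideal.span {Q.s}) l ψ := ⟨span_ne_bot Q.s_ne_zero, h0,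
    fun α hα h1 => by
      rw [hval α 1 (by simpa using h1), jacobiSym.one_left]; simp⟩
  have h𝔣 := hψ.unique (Q.hasConductor_span_s hp h hl hψ') hψ.1.modulus_ne_bot fun _ _ _ _ _ => rfl
  refine ⟨Q.isEquivariant_of_apply_span_natCast hψ' (by
    rw [conjIdeal_span, conj_s, Ideal.span_singleton_neg]) hv fun 𝔞 ha => ?_, h𝔣⟩
  obtain ⟨x, hx⟩ := hv 𝔞
  have hxs := hψ'.span_eq_pow ha hx
  obtain ⟨a, ha'⟩ := Q.exists_intCast_sub_mem hodd x
  have hcx : IsCoprime (Ideal.span {x}) (Ideal.span {Q.s}) := by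
    rw [hxs]; exact ((h0 𝔞).mp ha).2.pow_left
  have hN : (Ideal.absNorm 𝔞 : 𝓞 K) ^ l - ((a ^ 2 : ℤ) : 𝓞 K) ∈ Ideal.span {Q.s} := by
    have h1 := Q.mul_conj_eq_absNorm x
    rw [hxs, map_pow] at h1
    push_cast at h1 ⊢
    rw [← h1]
    have h2 : Q.conj x - a ∈ Ideal.span {Q.s} := by
      have h3 : Q.conjIdeal (Ideal.span {Q.s}) = Ideal.span {Q.s} := by
        rw [conjIdeal_span, conj_s, Ideal.span_singleton_neg]
      rw [← h3, mem_conjIdeal]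
      simpa using ha'
    convert add_mem (Ideal.mul_mem_left _ (Q.conj x) ha') (Ideal.mul_mem_left _ (a : 𝓞 K) h2)
      using 1
    ring
  -- A generator `x ≡ a` of `𝔞 ^ l` gives `N 𝔞 ^ l ≡ a ^ 2`, so the symbol has `l`-th power `1`, and
  -- `l` is odd.
  have hJ : jacobiSym (Ideal.absNorm 𝔞) p = 1 := by
    have h1 := Q.jacobiSym_eq_of_sub_mem hp h (a := (Ideal.absNorm 𝔞 : ℤ) ^ l) (by simp) (b := a ^ 2)
      (x := (Ideal.absNorm 𝔞 : 𝓞 K) ^ l) hN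
    have : NeZero p := ⟨hp.ne_zero⟩
    rw [jacobiSym.pow_left, jacobiSym.sq_one' (by
      have := (Q.isCoprime_span_s_iff hp h ha').mp hcx
      rwa [Ne, jacobiSym.eq_zero_iff_not_coprime, not_not] at this)] at h1
    rcases jacobiSym.trichotomy (Ideal.absNorm 𝔞) p with h2 | h2 | h2
    · rw [h2, zero_pow hl0] at h1; norm_num at h1
    · exact h2
    · rw [h2, hl.neg_one_pow] at h1; norm_num at h1
  rw [hval _ (Ideal.absNorm 𝔞) (by simp), hJ, embedding_natCast]
  simp

end QuadraticData

namespace QuadraticData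

variable (Q : QuadraticData σ)

/-- Canonical Hecke characters have rational coefficients and the expected conductor. -/
theorem isEquivariant_and_eq_of_isCanonical [IsTotallyComplex K] (Q : QuadraticData σ)
    {𝔣 : Ideal (𝓞 K)} {l : ℕ} (hl : l ≠ 0) {ψ : Ideal (𝓞 K) →*₀ ℂ} (h : IsCanonical σ 𝔣 l ψ) :
    Q.IsEquivariant ψ ∧ 𝔣 = canonicalConductor K l := by
  obtain ⟨hψ, hs, hg⟩ := h
  by_cases hd : discr K = -3 ∨ discr K = -4 ∨ discr K = -8
  · obtain ⟨ψ₁, hψ₁, hr, hv⟩ := hs hd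
    exact Q.isEquivariant_and_eq_of_elliptic hd hl hψ₁.1
      (Q.isEquivariant_of_hasRationalCoeffs one_ne_zero hψ₁.1 hr) hψ hv
  · obtain ⟨hv, he, ho⟩ := hg hd
    push Not at hd
    obtain ⟨h3, h4, h8⟩ := hd
    rw [canonicalConductor, if_neg h3, if_neg h4]
    rcases Nat.even_or_odd l with hev | hodd
    · rw [if_pos hev]
      exact Q.isEquivariant_and_eq_top hψ hv (he hev)
    · rw [if_neg (Nat.not_even_iff_odd.mpr hodd), if_neg h8, Q.sqrtDiscIdeal_eq]
      -- Integral values make `l` annihilate the class group, whence a prime discriminant.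
      obtain ⟨p, hp, hp4, hd⟩ := (Q.discr_eq_of_principal h3 h4 hodd fun 𝔞 h0 =>
        hψ.1.exists_pow_eq_span hv h0).resolve_left h8
      refine Q.isEquivariant_and_eq_span_s hp (by omega) hd hodd hψ hv fun α a ha => ?_
      have := ho hodd α a (by rwa [Q.sqrtDiscIdeal_eq])
      rwa [hd, Int.natAbs_neg, Int.natAbs_natCast] at this

/-! ### Existence of canonical characters -/

/-- For `p ≡ 3` mod `4` the class of `-1` is not a square, so exactly one of the two generators of
`𝔞 ^ l` is a square modulo `√-p`; this one is the value. -/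
theorem exists_isHeckeCharacter_span_s (Q : QuadraticData σ) (h3 : discr K ≠ -3) {p : ℕ}
    (hp : p.Prime) (hp4 : p % 4 = 3) (h : discr K = -p) {l : ℕ} (hl : Odd l)
    (hcl : ∀ 𝔞 : Ideal (𝓞 K), 𝔞 ≠ ⊥ → ∃ x : 𝓞 K, 𝔞 ^ l = Ideal.span {x}) :
    ∃ ψ : Ideal (𝓞 K) →*₀ ℂ, IsHeckeCharacter σ (Ideal.span {Q.s}) l ψ ∧ Q.IsEquivariant ψ ∧
      ∀ (α : 𝓞 K) (a : ℤ), α - a ∈ Ideal.span {Q.s} →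
        ψ (Ideal.span {α}) = ((jacobiSym a p : ℂ) * σ (α : K)) ^ l := by
  have h4 : discr K ≠ -4 := by rw [h]; omega
  have hoddp : Odd p := Nat.odd_iff.mpr (by omega)
  have hodd : Odd (discr K) := by rw [h, odd_neg]; exact_mod_cast hoddp
  have hneg : ∀ a : ℤ, jacobiSym (-a) p = -jacobiSym a p := by
    intro a
    rw [jacobiSym.neg _ hoddp, ZMod.χ₄_nat_three_mod_four hp4, neg_one_mul]
  have hconj : Q.conjIdeal (Ideal.span {Q.s}) = Ideal.span {Q.s} := by
    rw [conjIdeal_span, conj_s, Ideal.span_singleton_neg]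
  let S : 𝓞 K → Prop := fun x => ∃ a : ℤ, x - a ∈ Ideal.span {Q.s} ∧ jacobiSym a p = 1
  have hinj : ∀ x y : 𝓞 K, x ≠ 0 → S x → S y → Ideal.span {x} = Ideal.span {y} → x = y := by
    rintro x y _ ⟨a, ha, ha1⟩ ⟨b, hb, hb1⟩ hxy
    obtain ⟨u, hu, rfl⟩ := exists_isUnit_eq_mul hxy
    rcases Q.unit_eq_one_or_neg_one h3 h4 hu with rfl | rfl
    · rw [one_mul]
    · have := Q.jacobiSym_eq_of_sub_mem hp h (a := -a) (by
        push_cast; convert neg_mem ha using 1; ring) hb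
      rw [hneg, ha1, hb1] at this
      norm_num at this
  have hpow : ∀ {x : 𝓞 K} {a : ℤ}, x - a ∈ Ideal.span {Q.s} →
      x ^ l - ((a ^ l : ℤ) : 𝓞 K) ∈ Ideal.span {Q.s} := by
    intro x a hx
    push_cast
    exact Ideal.mem_of_dvd _ (sub_dvd_pow_sub_pow x a l) hx
  obtain ⟨ψ, hψ, hv⟩ := exists_isHeckeCharacter_of_generator (σ := σ) (span_ne_bot Q.s_ne_zero)
    (l := l) S
    (by
      rintro x y ⟨a, ha, ha1⟩ ⟨b, hb, hb1⟩
      refine ⟨a * b, ?_, by rw [jacobiSym.mul_left, ha1, hb1, one_mul]⟩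
      push_cast
      convert add_mem (Ideal.mul_mem_left _ y ha) (Ideal.mul_mem_left _ (a : 𝓞 K) hb) using 1
      ring) hinj
    (fun 𝔞 h0 hc => by
      obtain ⟨x, hx⟩ := hcl 𝔞 h0
      obtain ⟨a, ha⟩ := Q.exists_intCast_sub_mem hodd x
      have hJ := (Q.isCoprime_span_s_iff hp h ha).mp (by rw [← hx]; exact hc.pow_left)
      rcases (jacobiSym.trichotomy a p).resolve_left hJ with h1 | h1
      · exact ⟨x, ⟨a, ha, h1⟩, hx.symm⟩
      · refine ⟨-x, ⟨-a, ?_, by rw [hneg, h1, neg_neg]⟩, by rw [Ideal.span_singleton_neg, hx]⟩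
        push_cast; convert neg_mem ha using 1; ring)
    (fun α hα => ⟨1, by simpa using hpow (a := 1) (by simpa using hα), jacobiSym.one_left p⟩)
  refine ⟨ψ, hψ, Q.isEquivariant_of_generator hψ hconj ?_ hinj hv, fun α a ha => ?_⟩
  · rintro x ⟨a, ha, ha1⟩
    refine ⟨a, ?_, ha1⟩
    rw [← hconj, mem_conjIdeal]
    simpa using ha
  · by_cases hJ : jacobiSym a p = 0
    · rw [hJ, hψ.apply_eq_zero (fun hc => (Q.isCoprime_span_s_iff hp h ha).mp hc hJ)]
      simp [hl.pos.ne']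
    · have hc := (Q.isCoprime_span_s_iff hp h ha).mpr hJ
      have hα : α ≠ 0 := by
        rintro rfl
        exact notMem_of_isCoprime_span (Q.prime_span_s hp h) hc (zero_mem _)
      have hJ2 := (jacobiSym.trichotomy a p).resolve_left hJ
      obtain ⟨x, hx, hxs, hxv⟩ := hv _ (span_ne_bot hα) hc
      have hx0 : x ≠ 0 := by
        rintro rfl
        rw [Ideal.span_singleton_eq_bot.mpr rfl] at hxs
        exact pow_ne_zero l (span_ne_bot hα) hxs.symm
      -- Both sides generate `(α) ^ l`, and `χ(a) a` has symbol `1` because `χ(-1) = -1`.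
      have hy : x = (((jacobiSym a p : ℤ) : 𝓞 K) * α) ^ l := by
        refine hinj x _ hx0 hx ⟨(jacobiSym a p * a) ^ l, hpow ?_, ?_⟩ ?_
        · push_cast
          rw [← mul_sub]
          exact Ideal.mul_mem_left _ _ ha
        · rw [jacobiSym.pow_left]
          rcases hJ2 with h1 | h1
          · rw [h1, one_mul, h1, one_pow]
          · rw [h1, neg_one_mul, hneg, h1, neg_neg, one_pow]
        · rw [hxs, Ideal.span_singleton_pow]
          rcases hJ2 with h1 | h1
          · rw [h1]; simp
          · rw [h1, mul_pow, Int.cast_neg, Int.cast_one, hl.neg_one_pow, neg_one_mul,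
              Ideal.span_singleton_neg]
      rw [hxv, hy, embedding_pow, embedding_mul]
      simp

theorem isCanonical_of_elliptic (Q : QuadraticData σ)
    (h : discr K = -3 ∨ discr K = -4 ∨ discr K = -8) {l : ℕ} {𝔣 : Ideal (𝓞 K)}
    {ψ ψ₁ : Ideal (𝓞 K) →*₀ ℂ} (hψ : HasConductor σ 𝔣 l ψ)
    (hψ₁ : HasConductor σ (ellipticConductor K) 1 ψ₁) (he : Q.IsEquivariant ψ₁)
    (hv : ∀ 𝔞, 𝔞 ≠ ⊥ → IsCoprime 𝔞 (ellipticConductor K) → ψ 𝔞 = ψ₁ 𝔞 ^ l) :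
    IsCanonical σ 𝔣 l ψ :=
  ⟨hψ, fun _ => ⟨ψ₁, hψ₁, he.hasRationalCoeffs, fun 𝔞 h0 =>
    hv 𝔞 ((hψ₁.1.ne_zero_iff 𝔞).mp h0).1 ((hψ₁.1.ne_zero_iff 𝔞).mp h0).2⟩, fun h' => absurd h h'⟩

theorem exists_isCanonical_of_elliptic [IsTotallyComplex K] (Q : QuadraticData σ)
    (h : discr K = -3 ∨ discr K = -4 ∨ discr K = -8) {l : ℕ} (hl : l ≠ 0) :
    ∃ (𝔣 : Ideal (𝓞 K)) (ψ : Ideal (𝓞 K) →*₀ ℂ), IsCanonical σ 𝔣 l ψ := by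
  obtain ⟨ψ₁, hψ₁, he⟩ := Q.exists_elliptic h
  obtain ⟨ψ, hψ, hv, -⟩ := Q.exists_primitive_pow h hl hψ₁.1 he
  exact ⟨_, ψ, Q.isCanonical_of_elliptic h hψ hψ₁ he hv⟩

theorem exists_isCanonical_of_odd [IsTotallyComplex K] (Q : QuadraticData σ) (h3 : discr K ≠ -3)
    (h4 : discr K ≠ -4) {l : ℕ} (hl : Odd l)
    (hcl : ∀ 𝔞 : Ideal (𝓞 K), 𝔞 ≠ ⊥ → ∃ x : 𝓞 K, 𝔞 ^ l = Ideal.span {x}) :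
    ∃ (𝔣 : Ideal (𝓞 K)) (ψ : Ideal (𝓞 K) →*₀ ℂ), IsCanonical σ 𝔣 l ψ := by
  rcases Q.discr_eq_of_principal h3 h4 hl hcl with h8 | ⟨p, hp, hp4, h⟩
  · exact Q.exists_isCanonical_of_elliptic (Or.inr (Or.inr h8)) hl.pos.ne'
  · obtain ⟨ψ, hψ, he, hv⟩ := Q.exists_isHeckeCharacter_span_s h3 hp hp4 h hl hcl
    refine ⟨_, ψ, Q.hasConductor_span_s hp h hl hψ, ?_, fun _ =>
      ⟨fun 𝔞 => ?_, fun hev => absurd hl (Nat.not_odd_iff_even.mpr hev), fun _ α a ha => ?_⟩⟩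
    · intro h'
      have : p = 8 := by omega
      omega
    · obtain ⟨x, hx, -⟩ := he 𝔞
      exact ⟨x, hx⟩
    · rw [Q.sqrtDiscIdeal_eq] at ha
      rw [hv α a ha, h, Int.natAbs_neg, Int.natAbs_natCast]

/-! ### Twists -/

/-- Both values generate `𝔞 ^ l`. -/
theorem exists_isUnit_of_apply_ne_zero {𝔪 𝔪' : Ideal (𝓞 K)} {l : ℕ} {ψ ψ' : Ideal (𝓞 K) →*₀ ℂ}
    (Q : QuadraticData σ) (hψ : IsHeckeCharacter σ 𝔪 l ψ) (hψ' : IsHeckeCharacter σ 𝔪' l ψ')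
    (he : Q.IsEquivariant ψ) (he' : Q.IsEquivariant ψ') {𝔞 : Ideal (𝓞 K)} (h : ψ 𝔞 ≠ 0)
    (h' : ψ' 𝔞 ≠ 0) : ∃ u : 𝓞 K, IsUnit u ∧ ψ' 𝔞 = ψ 𝔞 * σ (u : K) := by
  obtain ⟨x, hx, -⟩ := he 𝔞
  obtain ⟨y, hy, -⟩ := he' 𝔞
  obtain ⟨u, hu, rfl⟩ := exists_isUnit_eq_mul
    ((hψ.span_eq_pow h hx).trans (hψ'.span_eq_pow h' hy).symm)
  exact ⟨u, hu, by rw [hx, hy, embedding_mul, mul_comm]⟩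

/-- For `ℚ(√-1)` and `ℚ(√-3)`, the quotient of two Hecke characters of the same `∞`-type with
rational coefficients is a twisting character. -/
theorem isTwist_of_units (Q : QuadraticData σ) (h : discr K = -3 ∨ discr K = -4)
    {𝔪 𝔪' : Ideal (𝓞 K)} {l : ℕ} {ψ ψ' : Ideal (𝓞 K) →*₀ ℂ}
    (hψ : IsHeckeCharacter σ 𝔪 l ψ) (hψ' : IsHeckeCharacter σ 𝔪' l ψ')
    (he : Q.IsEquivariant ψ) (he' : Q.IsEquivariant ψ') : IsTwist σ ψ ψ' := by
  have hz : ∀ 𝔞, 𝔞 ≠ ⊥ → IsCoprime 𝔞 (𝔪 * 𝔪') → ψ 𝔞 ≠ 0 ∧ ψ' 𝔞 ≠ 0 := fun 𝔞 h0 hc =>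
    ⟨hψ.apply_ne_zero h0 (IsCoprime.of_mul_right_left hc),
      hψ'.apply_ne_zero h0 (IsCoprime.of_mul_right_right hc)⟩
  obtain ⟨Ξ, hΞ, hv⟩ := exists_isHeckeCharacter_of_mul (σ := σ) (l := 0)
    (mul_ne_zero hψ.modulus_ne_bot hψ'.modulus_ne_bot) (fun 𝔞 => ψ' 𝔞 / ψ 𝔞)
    (fun 𝔞 h0 hc => div_ne_zero (hz 𝔞 h0 hc).2 (hz 𝔞 h0 hc).1)
    (fun 𝔞 𝔟 _ _ _ _ => by rw [map_mul, map_mul, mul_div_mul_comm])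
    (fun α hα h1 => by
      have h2 : α - 1 ∈ 𝔪 := (Ideal.mul_le_left : 𝔪 * 𝔪' ≤ 𝔪) h1
      have h3 : α - 1 ∈ 𝔪' := (Ideal.mul_le_right : 𝔪 * 𝔪' ≤ 𝔪') h1
      have h4 := pow_ne_zero l (embedding_ne_zero σ hα)
      simp only [hψ.map_principal α hα h2, hψ'.map_principal α hα h3, pow_zero]
      exact div_self h4)
  have hu : ∀ 𝔞, Ξ 𝔞 ≠ 0 → ∃ u : 𝓞 K, IsUnit u ∧ Ξ 𝔞 = σ (u : K) := by
    intro 𝔞 h0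
    obtain ⟨h1, h2⟩ := (hΞ.ne_zero_iff 𝔞).mp h0
    obtain ⟨h3, h4⟩ := hz 𝔞 h1 h2
    obtain ⟨u, hu, h5⟩ := Q.exists_isUnit_of_apply_ne_zero hψ hψ' he he' h3 h4
    exact ⟨u, hu, by rw [hv 𝔞 h1 h2, h5, mul_div_cancel_left₀ _ h3]⟩
  refine ⟨Ξ, ?_, fun 𝔞 h0 h1 => ?_⟩
  · rcases h with h | h
    · refine Or.inr (Or.inr ⟨h, ⟨_, hΞ⟩, fun 𝔞 h0 => ?_⟩)
      obtain ⟨u, hu, h1⟩ := hu 𝔞 h0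
      rw [h1, ← embedding_pow, Q.unit_pow_six h hu]
      simp
    · refine Or.inr (Or.inl ⟨h, ⟨_, hΞ⟩, fun 𝔞 h0 => ?_⟩)
      obtain ⟨u, hu, h1⟩ := hu 𝔞 h0
      rw [h1, ← embedding_pow, Q.unit_pow_four h hu]
      simp
  · obtain ⟨h2, h3⟩ := (hΞ.ne_zero_iff 𝔞).mp h1
    rw [hv 𝔞 h2 h3, mul_div_cancel₀ _ h0]

theorem coprime_absNorm_iff (Q : QuadraticData σ) {n : ℕ} {𝔞 : Ideal (𝓞 K)} :
    Nat.Coprime (Ideal.absNorm 𝔞) n ↔ IsCoprime 𝔞 (Ideal.span {(n : 𝓞 K)}) :=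
  ⟨fun h => isCoprime_of_dvd_left (Ideal.dvd_iff_le.mpr
      ((Ideal.span_singleton_le_iff_mem _).mpr (Ideal.absNorm_mem 𝔞)))
    (isCoprime_span_natCast h (Ideal.mem_span_singleton_self _)), Q.coprime_absNorm⟩

/-- A Dirichlet character composed with the norm. -/
theorem exists_comp_absNorm (Q : QuadraticData σ) {n : ℕ} (hn : 2 ≤ n)
    (φ : DirichletCharacter ℂ n) (hφ : φ ^ 2 = 1) :
    ∃ Ξ : Ideal (𝓞 K) →*₀ ℂ, IsTwistingCharacter σ Ξ ∧
      (∀ 𝔞, Ξ 𝔞 = φ (Ideal.absNorm 𝔞 : ZMod n)) ∧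
      ∀ 𝔞, (Ξ 𝔞 ≠ 0 ↔ IsCoprime 𝔞 (Ideal.span {(n : 𝓞 K)})) ∧
        (Ξ 𝔞 ≠ 0 → Ξ 𝔞 = 1 ∨ Ξ 𝔞 = -1) := by
  -- For `n = 1` the zero ideal would get the value `1`, hence the assumption `2 ≤ n`.
  have : Fact (1 < n) := ⟨hn⟩
  let Ξ : Ideal (𝓞 K) →*₀ ℂ :=
    { toFun := fun 𝔞 => φ (Ideal.absNorm 𝔞 : ZMod n)
      map_zero' := by
        rw [← Ideal.zero_eq_bot.symm, Ideal.absNorm_bot, Nat.cast_zero]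
        exact φ.map_nonunit not_isUnit_zero
      map_one' := by simp
      map_mul' := fun 𝔞 𝔟 => by simp }
  have hΞ : ∀ 𝔞, Ξ 𝔞 = φ (Ideal.absNorm 𝔞 : ZMod n) := fun _ => rfl
  refine ⟨Ξ, Or.inl ⟨n, φ, by omega, hφ, fun 𝔞 _ => hΞ 𝔞⟩, hΞ, fun 𝔞 => ⟨?_, ?_⟩⟩
  · rw [hΞ, ← Q.coprime_absNorm_iff, ← ZMod.isUnit_iff_coprime]
    exact ⟨fun h => by
      by_contra hne
      exact h (φ.map_nonunit hne), fun h => (h.map φ).ne_zero⟩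
  · intro h
    rw [hΞ] at h ⊢
    have hu : IsUnit (Ideal.absNorm 𝔞 : ZMod n) := by
      by_contra hne
      exact h (φ.map_nonunit hne)
    have h1 : φ (Ideal.absNorm 𝔞 : ZMod n) ^ 2 = 1 := by
      rw [← MulChar.pow_apply' φ two_ne_zero, hφ, MulChar.one_apply hu]
    exact mul_self_eq_one_iff.mp (by rw [← sq]; exact h1)

end QuadraticData

namespace QuadraticData

variable (Q : QuadraticData σ)

/-! ### The sign of a Hecke character on principal ideals -/

theorem eq_or_eq_neg_of_units (Q : QuadraticData σ) (h3 : discr K ≠ -3) (h4 : discr K ≠ -4)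
    {𝔪 𝔪' : Ideal (𝓞 K)} {l : ℕ} {ψ ψ' : Ideal (𝓞 K) →*₀ ℂ}
    (hψ : IsHeckeCharacter σ 𝔪 l ψ) (hψ' : IsHeckeCharacter σ 𝔪' l ψ')
    (he : Q.IsEquivariant ψ) (he' : Q.IsEquivariant ψ') {𝔞 : Ideal (𝓞 K)} (h : ψ 𝔞 ≠ 0)
    (h' : ψ' 𝔞 ≠ 0) : ψ' 𝔞 = ψ 𝔞 ∨ ψ' 𝔞 = -ψ 𝔞 := by
  obtain ⟨u, hu, h1⟩ := Q.exists_isUnit_of_apply_ne_zero hψ hψ' he he' h h'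
  rcases Q.unit_eq_one_or_neg_one h3 h4 hu with rfl | rfl
  · left; rw [h1]; simp
  · right; rw [h1]; simp

theorem apply_span_eq_or (Q : QuadraticData σ) (h3 : discr K ≠ -3) (h4 : discr K ≠ -4)
    {𝔪 : Ideal (𝓞 K)} {l : ℕ} {ψ : Ideal (𝓞 K) →*₀ ℂ} (hψ : IsHeckeCharacter σ 𝔪 l ψ)
    (he : Q.IsEquivariant ψ) {α : 𝓞 K} (hα : α ≠ 0) (hc : IsCoprime (Ideal.span {α}) 𝔪) :
    ψ (Ideal.span {α}) = σ (α : K) ^ l ∨ ψ (Ideal.span {α}) = -σ (α : K) ^ l := by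
  obtain ⟨x, hx, -⟩ := he (Ideal.span {α})
  have h1 := hψ.span_eq_pow (hψ.apply_ne_zero (span_ne_bot hα) hc) hx
  rw [Ideal.span_singleton_pow] at h1
  obtain ⟨u, hu, rfl⟩ := exists_isUnit_eq_mul h1.symm
  rw [hx]
  rcases Q.unit_eq_one_or_neg_one h3 h4 hu with rfl | rfl
  · left; rw [one_mul, embedding_pow]
  · right; rw [embedding_mul, embedding_pow]; simp

/-- As `𝔠 ^ 2 = (N 𝔠)`, an even power of `𝔠` has the rational generator `N 𝔠 ^ (l / 2)`, and `y`
differs from it by a sign. -/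
theorem conj_eq_of_span_eq_pow (Q : QuadraticData σ) (h3 : discr K ≠ -3) (h4 : discr K ≠ -4)
    {𝔠 : Ideal (𝓞 K)} (hc : Q.conjIdeal 𝔠 = 𝔠) {l : ℕ} (hl : Even l) {y : 𝓞 K}
    (hy : Ideal.span {y} = 𝔠 ^ l) : Q.conj y = y := by
  obtain ⟨m, rfl⟩ := hl
  have h1 : 𝔠 ^ (m + m) = Ideal.span {((Ideal.absNorm 𝔠 : 𝓞 K)) ^ m} := by
    rw [← two_mul, pow_mul, sq]
    nth_rewrite 2 [← hc]
    rw [Q.mul_conjIdeal, Ideal.span_singleton_pow]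
  obtain ⟨u, hu, rfl⟩ := exists_isUnit_eq_mul (h1.symm.trans hy.symm)
  rcases Q.unit_eq_one_or_neg_one h3 h4 hu with rfl | rfl <;> simp

theorem isCoprime_of_isCoprime_span_natCast {n : ℕ} {𝔞 𝔪 : Ideal (𝓞 K)} (hn : (n : 𝓞 K) ∈ 𝔪)
    (h : IsCoprime 𝔞 (Ideal.span {(n : 𝓞 K)})) : IsCoprime 𝔞 𝔪 :=
  h.of_isCoprime_of_dvd_right (Ideal.dvd_iff_le.mpr ((Ideal.span_singleton_le_iff_mem _).mpr hn))

theorem ne_zero_of_isCoprime_span_natCast (Q : QuadraticData σ) {n : ℕ} (hn : 2 ≤ n) {α : 𝓞 K}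
    (h : IsCoprime (Ideal.span {α}) (Ideal.span {(n : 𝓞 K)})) : α ≠ 0 := by
  rintro rfl
  have := Q.coprime_absNorm h
  rw [Ideal.span_singleton_eq_bot.mpr rfl, Ideal.absNorm_bot, Nat.coprime_zero_left] at this
  omega

/-- The sign of a Hecke character of even `∞`-type with rational coefficients at principal ideals
is a quadratic character of the norm. -/
theorem exists_dirichletCharacter_of_even (Q : QuadraticData σ) (h3 : discr K ≠ -3)
    (h4 : discr K ≠ -4) {𝔪 : Ideal (𝓞 K)} {l : ℕ} (hl : Even l) {ψ : Ideal (𝓞 K) →*₀ ℂ}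
    (hψ : IsHeckeCharacter σ 𝔪 l ψ) (he : Q.IsEquivariant ψ) :
    ∃ (n : ℕ) (φ : DirichletCharacter ℂ n), 2 ≤ n ∧ (n : 𝓞 K) ∈ 𝔪 ∧ φ ^ 2 = 1 ∧
      ∀ α : 𝓞 K, IsCoprime (Ideal.span {α}) (Ideal.span {(n : 𝓞 K)}) →
        ψ (Ideal.span {α}) = σ (α : K) ^ l * φ (Ideal.absNorm (Ideal.span {α}) : ZMod n) := by
  -- The factor `2` ensures `M ≥ 2` and makes integers prime to `n` odd, as the Jacobi symbol
  -- requires; `M ^ 2 Δ` is the modulus of the Hilbert 90 step.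
  set M : ℕ := 2 * Ideal.absNorm 𝔪 with hMdef
  set n : ℕ := M ^ 2 * (discr K).natAbs with hn
  have hΔ : (discr K).natAbs ≠ 0 := Int.natAbs_ne_zero.mpr (discr_ne_zero K)
  have hN0 : Ideal.absNorm 𝔪 ≠ 0 := by
    rw [Ne, Ideal.absNorm_eq_zero_iff]; exact hψ.modulus_ne_bot
  have hM2 : 2 ≤ M := by omega
  have hM0 : M ≠ 0 := by omega
  have hn2 : 2 ≤ n := by
    have h1 := Nat.pos_of_ne_zero hΔ
    nlinarith
  have : NeZero n := ⟨by omega⟩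
  have hM𝔪 : (M : 𝓞 K) ∈ 𝔪 := by
    have := Ideal.mul_mem_left 𝔪 2 (Ideal.absNorm_mem 𝔪)
    convert this using 1; rw [hMdef]; push_cast; ring
  have hn𝔪 : (n : 𝓞 K) ∈ 𝔪 := by
    have := Ideal.mul_mem_left 𝔪 ((M : 𝓞 K) * ((discr K).natAbs : 𝓞 K)) hM𝔪
    convert this using 1; rw [hn]; push_cast; ring
  have key : ∀ {α : 𝓞 K}, IsCoprime (Ideal.span {α}) (Ideal.span {(n : 𝓞 K)}) → α ≠ 0 ∧
      IsCoprime (Ideal.span {α}) 𝔪 ∧ σ (α : K) ^ l ≠ 0 := by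
    intro α hc
    have hα := Q.ne_zero_of_isCoprime_span_natCast hn2 hc
    exact ⟨hα, isCoprime_of_isCoprime_span_natCast hn𝔪 hc,
      pow_ne_zero l (embedding_ne_zero σ hα)⟩
  obtain ⟨φ, hφ, hv⟩ := Q.exists_dirichletCharacter (n := n)
    (fun α => ψ (Ideal.span {α}) / σ (α : K) ^ l)
    (fun α β _ _ => by
      simp only [← Ideal.span_singleton_mul_span_singleton, map_mul, mul_pow, mul_div_mul_comm])
    (fun α hc => by
      obtain ⟨hα, h1, h2⟩ := key hc
      rcases Q.apply_span_eq_or h3 h4 hψ he hα h1 with h | h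
      · left; simp only [h]; exact div_self h2
      · right; simp only [h]; rw [neg_div, div_self h2])
    (fun a ha => by
      have haM : Nat.Coprime a M :=
        Nat.Coprime.coprime_dvd_right ⟨M * (discr K).natAbs, by rw [hn]; ring⟩ ha
      have haΔ : Nat.Coprime a (discr K).natAbs := Nat.Coprime.coprime_dvd_right ⟨M ^ 2, by
        rw [hn]; ring⟩ ha
      have hodd : Odd a := Nat.coprime_two_right.mp
        (Nat.Coprime.coprime_dvd_right ⟨_, hMdef⟩ haM)
      obtain ⟨hα, h1, h2⟩ := key (isCoprime_span_natCast ha (Ideal.mem_span_singleton_self _))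
      have h5 := Q.apply_span_natCast hψ he hM0 hM𝔪 hodd haM haΔ
      have h6 : jacobiSym (discr K) a ≠ 0 := jacobiSym.ne_zero haΔ.symm
      simp only [h5, embedding_natCast]
      rw [embedding_natCast] at h2
      rw [mul_pow]
      rcases (jacobiSym.trichotomy (discr K) a).resolve_left h6 with h7 | h7 <;> rw [h7] <;>
        simp [hl.neg_pow, h2])
    (fun α hN => by
      obtain ⟨hα, h1, h2⟩ := key (α := α) (isCoprime_span_iff.mpr ⟨Q.conj α, by rwa [mul_comm]⟩)
      obtain ⟨𝔠, h𝔠0, h𝔠, h⟩ := Q.exists_conjIdeal_eq_and_forall hM2 hα hN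
      obtain ⟨y, hy, hy'⟩ := h 𝔪 l ψ hψ hM𝔪 he
      have hy0 : y ≠ 0 := by
        rintro rfl
        rw [Ideal.span_singleton_eq_bot.mpr rfl] at hy
        exact pow_ne_zero l h𝔠0 hy.symm
      rw [Q.conj_eq_of_span_eq_pow h3 h4 h𝔠 hl hy] at hy'
      have h6 := mul_right_cancel₀ (embedding_ne_zero σ hy0) hy'
      simp only [h6]
      exact div_self h2)
  refine ⟨n, φ, hn2, hn𝔪, hφ, fun α hc => ?_⟩
  rw [← hv α hc, mul_div_cancel₀ _ (key hc).2.2]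

/-- The quotient of two Hecke characters of the same `∞`-type with rational coefficients is a
quadratic character of the norm at principal ideals. -/
theorem exists_dirichletCharacter_of_isHeckeCharacter (Q : QuadraticData σ) (h3 : discr K ≠ -3)
    (h4 : discr K ≠ -4) {𝔪 𝔪' : Ideal (𝓞 K)} {l : ℕ} {ψ ψ' : Ideal (𝓞 K) →*₀ ℂ}
    (hψ : IsHeckeCharacter σ 𝔪 l ψ) (he : Q.IsEquivariant ψ)
    (hψ' : IsHeckeCharacter σ 𝔪' l ψ') (he' : Q.IsEquivariant ψ') :
    ∃ (n : ℕ) (φ : DirichletCharacter ℂ n), 2 ≤ n ∧ (n : 𝓞 K) ∈ 𝔪 ∧ (n : 𝓞 K) ∈ 𝔪' ∧ φ ^ 2 = 1 ∧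
      ∀ α : 𝓞 K, IsCoprime (Ideal.span {α}) (Ideal.span {(n : 𝓞 K)}) →
        ψ' (Ideal.span {α}) = ψ (Ideal.span {α}) * φ (Ideal.absNorm (Ideal.span {α}) : ZMod n) := by
  set M : ℕ := 2 * (Ideal.absNorm 𝔪 * Ideal.absNorm 𝔪') with hMdef
  set n : ℕ := M ^ 2 * (discr K).natAbs with hn
  have hΔ : (discr K).natAbs ≠ 0 := Int.natAbs_ne_zero.mpr (discr_ne_zero K)
  have hN0 : Ideal.absNorm 𝔪 ≠ 0 := by
    rw [Ne, Ideal.absNorm_eq_zero_iff]; exact hψ.modulus_ne_bot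
  have hN0' : Ideal.absNorm 𝔪' ≠ 0 := by
    rw [Ne, Ideal.absNorm_eq_zero_iff]; exact hψ'.modulus_ne_bot
  have hM0 : M ≠ 0 := by positivity
  have hM2 : 2 ≤ M := by
    have := Nat.pos_of_ne_zero (mul_ne_zero hN0 hN0')
    omega
  have hn2 : 2 ≤ n := by
    have h1 := Nat.pos_of_ne_zero hΔ
    nlinarith
  have : NeZero n := ⟨by omega⟩
  have hM𝔪 : (M : 𝓞 K) ∈ 𝔪 := by
    have := Ideal.mul_mem_left 𝔪 (2 * (Ideal.absNorm 𝔪' : 𝓞 K)) (Ideal.absNorm_mem 𝔪)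
    convert this using 1; rw [hMdef]; push_cast; ring
  have hM𝔪' : (M : 𝓞 K) ∈ 𝔪' := by
    have := Ideal.mul_mem_left 𝔪' (2 * (Ideal.absNorm 𝔪 : 𝓞 K)) (Ideal.absNorm_mem 𝔪')
    convert this using 1; rw [hMdef]; push_cast; ring
  have hnM : ∀ {I : Ideal (𝓞 K)}, (M : 𝓞 K) ∈ I → (n : 𝓞 K) ∈ I := by
    intro I hI
    have := Ideal.mul_mem_left I ((M : 𝓞 K) * ((discr K).natAbs : 𝓞 K)) hI
    convert this using 1; rw [hn]; push_cast; ring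
  have key : ∀ {α : 𝓞 K}, IsCoprime (Ideal.span {α}) (Ideal.span {(n : 𝓞 K)}) → α ≠ 0 ∧
      ψ (Ideal.span {α}) ≠ 0 ∧ ψ' (Ideal.span {α}) ≠ 0 := by
    intro α hc
    have hα := Q.ne_zero_of_isCoprime_span_natCast hn2 hc
    exact ⟨hα, hψ.apply_ne_zero (span_ne_bot hα) (isCoprime_of_isCoprime_span_natCast (hnM hM𝔪) hc),
      hψ'.apply_ne_zero (span_ne_bot hα) (isCoprime_of_isCoprime_span_natCast (hnM hM𝔪') hc)⟩
  obtain ⟨φ, hφ, hv⟩ := Q.exists_dirichletCharacter (n := n)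
    (fun α => ψ' (Ideal.span {α}) / ψ (Ideal.span {α}))
    (fun α β _ _ => by
      simp only [← Ideal.span_singleton_mul_span_singleton, map_mul, mul_div_mul_comm])
    (fun α hc => by
      obtain ⟨hα, h1, h2⟩ := key hc
      rcases Q.eq_or_eq_neg_of_units h3 h4 hψ hψ' he he' h1 h2 with h | h
      · left; simp only [h]; exact div_self h1
      · right; simp only [h]; rw [neg_div, div_self h1])
    (fun a ha => by
      have haM : Nat.Coprime a M :=
        Nat.Coprime.coprime_dvd_right ⟨M * (discr K).natAbs, by rw [hn]; ring⟩ ha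
      have haΔ : Nat.Coprime a (discr K).natAbs := Nat.Coprime.coprime_dvd_right ⟨M ^ 2, by
        rw [hn]; ring⟩ ha
      have hodd : Odd a := Nat.coprime_two_right.mp
        (Nat.Coprime.coprime_dvd_right ⟨_, hMdef⟩ haM)
      have h0 := (key (isCoprime_span_natCast ha (Ideal.mem_span_singleton_self _))).2.1
      have h1 := Q.apply_span_natCast hψ he hM0 hM𝔪 hodd haM haΔ
      have h2 := Q.apply_span_natCast hψ' he' hM0 hM𝔪' hodd haM haΔ
      simp only [h2]
      rw [← h1, div_self h0])
    (fun α hN => by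
      obtain ⟨hα, h1, h2⟩ := key (α := α) (isCoprime_span_iff.mpr ⟨Q.conj α, by rwa [mul_comm]⟩)
      obtain ⟨𝔠, h𝔠0, h𝔠, h⟩ := Q.exists_conjIdeal_eq_and_forall hM2 hα hN
      obtain ⟨y, hy, hy'⟩ := h 𝔪 l ψ hψ hM𝔪 he
      obtain ⟨z, hz, hz'⟩ := h 𝔪' l ψ' hψ' hM𝔪' he'
      have hy0 : y ≠ 0 := by
        rintro rfl
        rw [Ideal.span_singleton_eq_bot.mpr rfl] at hy
        exact pow_ne_zero l h𝔠0 hy.symm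
      have hyc := embedding_ne_zero σ hy0
      -- `y` and `z` both generate `𝔠 ^ l`, so `z = ± y`, and the sign cancels in `z̄ / z`.
      obtain ⟨u, hu, rfl⟩ := exists_isUnit_eq_mul (hy.trans hz.symm)
      have h5 : ψ' (Ideal.span {α}) * σ (y : K) = σ (α : K) ^ l * σ (Q.conj y : K) := by
        rcases Q.unit_eq_one_or_neg_one h3 h4 hu with rfl | rfl
        · simpa using hz'
        · simpa using hz'
      have h6 : ψ' (Ideal.span {α}) = ψ (Ideal.span {α}) :=
        mul_right_cancel₀ hyc (h5.trans hy'.symm)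
      simp only [h6]
      exact div_self h1)
  refine ⟨n, φ, hn2, hnM hM𝔪, hnM hM𝔪', hφ, fun α hc => ?_⟩
  rw [← hv α hc, mul_div_cancel₀ _ (key hc).2.1]

/-! ### Existence of canonical twists -/

/-- Off the principal ideals `ψ'` and `ψ Ξ` still agree up to sign. Their `l`-th powers agree
because `𝔞 ^ l` is principal, so for odd `l` the sign is `1`. -/
theorem exists_isCanonical_isTwist_of_odd [IsTotallyComplex K] (Q : QuadraticData σ)
    (h3 : discr K ≠ -3) (h4 : discr K ≠ -4) {𝔪 : Ideal (𝓞 K)} {l : ℕ} (hl : Odd l)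
    {ψ : Ideal (𝓞 K) →*₀ ℂ} (hψ : IsHeckeCharacter σ 𝔪 l ψ) (he : Q.IsEquivariant ψ) :
    ∃ (𝔣 : Ideal (𝓞 K)) (ψ' : Ideal (𝓞 K) →*₀ ℂ), IsCanonical σ 𝔣 l ψ' ∧ IsTwist σ ψ ψ' := by
  have hl0 := hl.pos.ne'
  obtain ⟨𝔣, ψ', hcan⟩ := Q.exists_isCanonical_of_odd h3 h4 hl fun 𝔞 h0 =>
    hψ.exists_pow_eq_span (fun 𝔟 => by obtain ⟨x, hx, -⟩ := he 𝔟; exact ⟨x, hx⟩) h0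
  have he' := (Q.isEquivariant_and_eq_of_isCanonical hl0 hcan).1
  have hψ' := hcan.1.1
  obtain ⟨n, φ, hn, hn𝔪, hn𝔣, hφ, hv⟩ := Q.exists_dirichletCharacter_of_isHeckeCharacter h3 h4 hψ he hψ' he'
  obtain ⟨Ξ, hΞ, hΞv, hΞc⟩ := Q.exists_comp_absNorm hn φ hφ
  refine ⟨𝔣, ψ', hcan, Ξ, hΞ, fun 𝔞 h0 h1 => ?_⟩
  have hc := (hΞc 𝔞).1.mp h1
  have h0' := hψ'.apply_ne_zero ((hψ.ne_zero_iff 𝔞).mp h0).1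
    (isCoprime_of_isCoprime_span_natCast hn𝔣 hc)
  obtain ⟨x, hx, -⟩ := he 𝔞
  have hpow : ψ' 𝔞 ^ l = (ψ 𝔞 * Ξ 𝔞) ^ l := by
    rw [mul_pow, ← map_pow, ← map_pow, ← map_pow, ← hψ.span_eq_pow h0 hx, hΞv]
    exact hv x (by rw [hψ.span_eq_pow h0 hx]; exact hc.pow_left)
  have hsign : ψ' 𝔞 = ψ 𝔞 * Ξ 𝔞 ∨ ψ' 𝔞 = -(ψ 𝔞 * Ξ 𝔞) := by
    rcases Q.eq_or_eq_neg_of_units h3 h4 hψ hψ' he he' h0 h0' with h2 | h2 <;>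
    rcases (hΞc 𝔞).2 h1 with h3 | h3 <;> rw [h2, h3] <;> simp
  rcases hsign with h2 | h2
  · exact h2
  · rw [h2, hl.neg_pow] at hpow
    have h5 := pow_ne_zero l (mul_ne_zero h0 h1)
    exact absurd (by linear_combination -(1 / 2) * hpow) h5

/-- Moving gives `ψ 𝔞 = γ ^ l / ψ 𝔟`, an element of `K`; a power of it is integral. -/
theorem exists_embedding_of_isHeckeCharacter_top {𝔪 : Ideal (𝓞 K)}
    (h𝔪 : 𝔪 ≠ ⊥) {l : ℕ} {ψ : Ideal (𝓞 K) →*₀ ℂ} (hψ : IsHeckeCharacter σ ⊤ l ψ)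
    (hv : ∀ 𝔞, 𝔞 ≠ ⊥ → IsCoprime 𝔞 𝔪 → ∃ x : 𝓞 K, ψ 𝔞 = σ (x : K)) (𝔞 : Ideal (𝓞 K)) :
    ∃ x : 𝓞 K, ψ 𝔞 = σ (x : K) := by
  by_cases h0 : ψ 𝔞 = 0
  · exact ⟨0, by rw [h0]; simp⟩
  have ha := ((hψ.ne_zero_iff 𝔞).mp h0).1
  obtain ⟨𝔟, γ, h1, h2⟩ := exists_isCoprime_mul_eq_span (𝔪 := 𝔪 * Ideal.span {2}) ha
    (mul_ne_zero h𝔪 (span_ne_bot two_ne_zero))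
  have hb : 𝔟 ≠ ⊥ := by
    rintro rfl
    exact not_isCoprime_bot h2
  replace h2 := IsCoprime.of_mul_right_left h2
  obtain ⟨y, hy⟩ := hv 𝔟 hb h2
  have hγ : γ ≠ 0 := by
    rintro rfl
    rw [Ideal.span_singleton_eq_bot.mpr rfl] at h1
    exact mul_ne_zero ha hb h1
  have hb0 : ψ 𝔟 ≠ 0 := (hψ.ne_zero_iff 𝔟).mpr ⟨hb, by
    rw [← Ideal.one_eq_top]; exact isCoprime_one_right⟩
  have h3 := congrArg ψ h1
  rw [map_mul, hψ.map_principal γ hγ (by trivial), hy] at h3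
  obtain ⟨k, α, hk, -, h4⟩ := hψ.exists_pow_eq h0
  refine exists_embedding_eq_of_pow (k := (γ : K) ^ l / y) ?_ hk h4
  rw [map_div₀, map_pow, ← h3, ← hy, mul_div_cancel_right₀ _ hb0]

/-- After twisting by `Ξ` the value at `α` prime to `n` is `α ^ l` with no congruence condition, so
the twist extends to modulus `⊤`. For `Δ = 8` this is `ψ₁ ^ l`, since `ψ₁ (α) = ± α`. -/
theorem exists_isCanonical_isTwist_of_even [IsTotallyComplex K] (Q : QuadraticData σ)
    (h3 : discr K ≠ -3) (h4 : discr K ≠ -4) {𝔪 : Ideal (𝓞 K)} {l : ℕ} (hl : Even l)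
    {ψ : Ideal (𝓞 K) →*₀ ℂ} (hψ : IsHeckeCharacter σ 𝔪 l ψ) (he : Q.IsEquivariant ψ) :
    ∃ (𝔣 : Ideal (𝓞 K)) (ψ' : Ideal (𝓞 K) →*₀ ℂ), IsCanonical σ 𝔣 l ψ' ∧ IsTwist σ ψ ψ' := by
  obtain ⟨n, φ, hn, hn𝔪, hφ, hv⟩ := Q.exists_dirichletCharacter_of_even h3 h4 hl hψ he
  obtain ⟨Ξ, hΞ, hΞv, hΞc⟩ := Q.exists_comp_absNorm hn φ hφ
  have hn0 : Ideal.span {(n : 𝓞 K)} ≠ ⊥ := span_ne_bot (by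
    have : n ≠ 0 := by omega
    exact_mod_cast this)
  have hcop : ∀ 𝔞 : Ideal (𝓞 K), IsCoprime 𝔞 ⊤ := fun 𝔞 => by
    rw [← Ideal.one_eq_top]; exact isCoprime_one_right
  let χ : Ideal (𝓞 K) →*₀ ℂ :=
    { toFun := fun 𝔞 => ψ 𝔞 * Ξ 𝔞
      map_zero' := by rw [map_zero, zero_mul]
      map_one' := by rw [map_one, map_one, one_mul]
      map_mul' := fun 𝔞 𝔟 => by rw [map_mul, map_mul, mul_mul_mul_comm] }
  have hχ : ∀ 𝔞, χ 𝔞 = ψ 𝔞 * Ξ 𝔞 := fun _ => rfl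
  obtain ⟨ψ', hψ', hψ'v⟩ := IsHeckeCharacter.exists_extension (σ := σ) (ψ := χ) (l := l) hn0
    (fun 𝔞 => by
      rw [hχ, mul_ne_zero_iff, hψ.ne_zero_iff, (hΞc 𝔞).1]
      exact ⟨fun h => ⟨h.1.1, h.2⟩,
        fun h => ⟨⟨h.1, isCoprime_of_isCoprime_span_natCast hn𝔪 h.2⟩, h.2⟩⟩)
    (𝔣 := ⊤) top_ne_bot
    (fun α hα _ hc => by
      have h1 := (hΞc _).2 ((hΞc _).1.mpr hc)
      rw [hχ, hv α hc, ← hΞv]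
      rcases h1 with h1 | h1 <;> rw [h1] <;> ring)
  have hval : ∀ 𝔞, ψ 𝔞 ≠ 0 → Ξ 𝔞 ≠ 0 → ψ' 𝔞 = ψ 𝔞 * Ξ 𝔞 := fun 𝔞 h0 h1 =>
    hψ'v 𝔞 ((hψ.ne_zero_iff 𝔞).mp h0).1 ((hΞc 𝔞).1.mp h1) (hcop 𝔞)
  have hprin : ∀ α : 𝓞 K, α ≠ 0 → ψ' (Ideal.span {α}) = σ (α : K) ^ l :=
    fun α hα => hψ'.map_principal α hα (by trivial)
  refine ⟨⊤, ψ', ?_, Ξ, hΞ, hval⟩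
  by_cases h8 : discr K = -8
  · have hs : discr K = -3 ∨ discr K = -4 ∨ discr K = -8 := Or.inr (Or.inr h8)
    obtain ⟨ψ₁, hψ₁, he₁⟩ := Q.exists_elliptic hs
    refine Q.isCanonical_of_elliptic hs (hasConductor_top hψ') hψ₁ he₁ fun 𝔞 h0 hc => ?_
    have := Q.isPrincipalIdealRing (by rw [h8]; norm_num)
    obtain ⟨α, rfl⟩ := IsPrincipalIdealRing.principal 𝔞
    have hα : α ≠ 0 := by
      rintro rfl
      exact h0 (Ideal.span_singleton_eq_bot.mpr rfl)
    refine (hprin α hα).trans ?_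
    rcases Q.apply_span_eq_or h3 h4 hψ₁.1 he₁ hα hc with h | h <;>
      · refine Eq.trans ?_ (congrArg (· ^ l) h).symm
        simp [hl.neg_pow]
  · refine ⟨hasConductor_top hψ', fun h => ?_, fun _ => ⟨?_, fun _ => hprin,
      fun h => absurd hl (Nat.not_even_iff_odd.mpr h)⟩⟩
    · rcases h with h | h | h
      exacts [absurd h h3, absurd h h4, absurd h h8]
    · refine exists_embedding_of_isHeckeCharacter_top hn0 hψ' fun 𝔞 h0 hc => ?_
      obtain ⟨x, hx, -⟩ := he 𝔞
      have hΞ0 := (hΞc 𝔞).1.mpr hc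
      rw [hψ'v 𝔞 h0 hc (hcop 𝔞), hχ, hx]
      rcases (hΞc 𝔞).2 hΞ0 with h | h <;> rw [h]
      · exact ⟨x, mul_one _⟩
      · exact ⟨-x, by simp⟩

end QuadraticData

end CMHecke

/-! ### The proposition. -/

theorem proposition5p1 (K : Type*) [Field K] [NumberField K] [NumberField.IsTotallyComplex K]
    (hK : Module.finrank ℚ K = 2) (σ : K →+* ℂ) (l : ℕ) (hl : 0 < l) :
    (∀ (𝔪 : Ideal (𝓞 K)) (ψ : Ideal (𝓞 K) →*₀ ℂ), CMHecke.IsHeckeCharacter σ 𝔪 l ψ →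
      CMHecke.HasRationalCoeffs ψ →
      ∃ (𝔣 : Ideal (𝓞 K)) (ψ' : Ideal (𝓞 K) →*₀ ℂ),
        CMHecke.IsCanonical σ 𝔣 l ψ' ∧ CMHecke.IsTwist σ ψ ψ') ∧
    (∀ (𝔣 : Ideal (𝓞 K)) (ψ : Ideal (𝓞 K) →*₀ ℂ), CMHecke.IsCanonical σ 𝔣 l ψ →
      CMHecke.HasRationalCoeffs ψ ∧ 𝔣 = CMHecke.canonicalConductor K l) := by
  obtain ⟨Q⟩ := CMHecke.exists_quadraticData hK σ
  refine ⟨fun 𝔪 ψ hψ hr => ?_, fun 𝔣 ψ h => ?_⟩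
  · have he := Q.isEquivariant_of_hasRationalCoeffs hl.ne' hψ hr
    -- For `Δ = 3, 4` all characters of type `l` with rational coefficients are twists of one
    -- another, so any canonical one serves.
    by_cases h34 : discr K = -3 ∨ discr K = -4
    · obtain ⟨𝔣, ψ', hcan⟩ := Q.exists_isCanonical_of_elliptic (by tauto) hl.ne'
      exact ⟨𝔣, ψ', hcan, Q.isTwist_of_units h34 hψ hcan.1.1 he
        (Q.isEquivariant_and_eq_of_isCanonical hl.ne' hcan).1⟩
    · push Not at h34
      rcases Nat.even_or_odd l with hev | hodd
      · exact Q.exists_isCanonical_isTwist_of_even h34.1 h34.2 hev hψ he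
      · exact Q.exists_isCanonical_isTwist_of_odd h34.1 h34.2 hodd hψ he
  · obtain ⟨he, h𝔣⟩ := Q.isEquivariant_and_eq_of_isCanonical hl.ne' h
    exact ⟨he.hasRationalCoeffs, h𝔣⟩
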